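/- **Setting.** Let $n\ge 1$ and let $(M,\eta)$ be a contact manifold of dimension $2n+1$: $M$ is a smooth (Hausdorff, second countable) manifold and $\eta$ is a smooth 1-form that vanishes nowhere and such that $d\eta$ is nondegenerate on $\ker\eta$. Put $b(X)=X\lrcorner d\eta+\eta(X)\eta$, let $\mathcal R=b^{-1}(\eta)$ be the Reeb field, $E=-\mathcal R$, and $\Lambda(\alpha,\beta)=-d\eta(b^{-1}\alpha,b^{-1}\beta)$. The Jacobi bracket is $\{f,g\}=\Lambda(df,dg)+fE(g)-gE(f)$, and the Hamiltonian vector field $X_f$ of $f\in C^\infty(M)$ is given by $b(X_f)=df-(\mathcal R(f)+f)\eta$. For vector fields $Y_i$ on an open set $V$, $\langle Y_i\rangle$ is the $C^\infty(V)$-module that they generate. Let $H\in C^\infty(M)$. A *Jacobi $C^\infty$-structure* for $(M,H)$ is a family $(f_1,\dots,f_{2n-1})$ of smooth functions on $M$ such that, with $f_0=H$: 1. $X_{f_0},\dots,X_{f_{2n-1}}$ are pointwise linearly independent on an open dense subset of $M$; 2. for all $0\le i<j\le 2n-1$ there is $F_{ji}\in C^\infty(\mathbb R^{j+1})$ with $\{f_j,f_i\}=F_{ji}(f_0,\dots,f_j)$;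 3. for these $F_{ji}$, the vector field $\bigl(F_{ji}(f_0,\dots,f_j)-\sum_{k=0}^{j}f_k\,\tfrac{\partial F_{ji}}{\partial u_k}(f_0,\dots,f_j)\bigr)E$ belongs to $\langle X_{f_0},\dots,X_{f_j}\rangle$ locally around each point at which $X_{f_0},\dots,X_{f_{2n-1}}$ are linearly independent. A *$C^\infty$-structure* on an open set $V$ for a distribution $\mathcal D$ of rank $k$ is an ordered family of $\dim M-k$ smooth vector fields $(X_1,\dots,X_{\dim M-k})$ on $V$ such that each $X_j$ is nowhere tangent to $\mathcal D_{j-1}=\mathcal D\oplus\langle X_1,\dots,X_{j-1}\rangle$ and $[X_j,\mathcal D_{j-1}]\subset\mathcal D_{j-1}\oplus\langle X_j\rangle$. **Theorem.** Let $(f_1,\dots,f_{2n-1})$ be a Jacobi $C^\infty$-structure for the Hamiltonian system $(M,H)$ on the $(2n+1)$-dimensional contact manifold $(M,\eta)$. Then the set $U$ of points at which $X_{f_0},\dots,X_{f_{2n-1}}$ are linearly independent is open and dense. Each point of $U$ has an open neighbourhood $V\subseteq U$ that carries a volume form and a smooth vector field $R$ with $R(p)\notin\operatorname{span}\{X_{f_0}(p),\dots,X_{f_{2n-1}}(p)\}$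 for all $p\in V$. Moreover, for every open $V\subseteq U$ and every such $R$ on $V$: **(A)** $(X_1,\dots,X_{2n}):=(X_{f_1},\dots,X_{f_{2n-1}},R)$ is a $C^\infty$-structure on $V$ for $\mathcal D_H=\langle X_H\rangle$. **(B)** $\mathcal D_H$ is integrated by solving a sequence of $2n$ completely integrable Pfaffian equations. Precisely, for every volume form $\Omega$ on $V$, the $2n$ 1-forms $$\omega_i=X_{2n}\lrcorner\cdots\widehat{X_i}\cdots\lrcorner X_1\lrcorner X_H\lrcorner\Omega,\qquad 1\le i\le 2n,$$ are smooth and pointwise linearly independent on $V$, their common kernel at $p$ is $\mathbb R X_H(p)$, and $d\omega_i\equiv 0$ modulo $\langle\omega_i,\dots,\omega_{2n}\rangle$, that is, $d\omega_i=\sum_{l\ge i}\theta_l\wedge\omega_l$ with smooth 1-forms $\theta_l$ on $V$. For open $W\subseteq V$ and functions $I_k$ on $W$, say that $I_k$ *solves the $k$-th equation* (given $I_{k+1},\dots,I_{2n}$) if it is smooth and, on $\bigcap_{l>k}\ker dI_l$ at every point of $W$, $dI_k\wedge\omega_k=0$ and $dI_k\ne 0$; i.e. $I_k$ is a regular solution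 of $\omega_k\equiv 0$ restricted to the common level sets of $I_{k+1},\dots,I_{2n}$. Then: - for each $k$, if $I_{k+1},\dots,I_{2n}$ solve the equations $k+1,\dots,2n$ on $W$, then every point of $W$ has an open neighbourhood $W'\subseteq W$ on which some function $I_k$ solves the $k$-th equation; - if $I_1,\dots,I_{2n}$ on $W$ solve all $2n$ equations, then every common level set $\{p\in W: I_1(p)=c_1,\dots,I_{2n}(p)=c_{2n}\}$ is an integral manifold of $\mathcal D_H$: near each of its points it is an embedded arc of an integral curve of $X_H$. -/

import Mathlib

open scoped Manifold ContDiff Topology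

noncomputable section

namespace ContactPfaff

/-! ### Vector fields, 1-forms and volume forms on a smooth `m`-dimensional manifold

All fields and forms are functions on `M`; smoothness is required on a given open set only, so that
the local objects of the theory need no separate type. -/

section Forms

variable (m : ℕ) (M : Type*) [TopologicalSpace M] [ChartedSpace (EuclideanSpace ℝ (Fin m)) M]
  [IsManifold (𝓡 m) ∞ M]

/-- A (not necessarily smooth) vector field. -/
abbrev VField := (p : M) → TangentSpace (𝓡 m) p

/-- A (not necessarily smooth) 1-form. -/
abbrev OneForm := (p : M) → (TangentSpace (𝓡 m) p →L[ℝ] ℝ)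

/-- A (not necessarily smooth) differential form of degree `m = dim M`. -/
abbrev TopForm := (p : M) → (TangentSpace (𝓡 m) p [⋀^Fin m]→L[ℝ] ℝ)

variable {m M}

/-- The real function `f` is smooth on `V`. -/
def SmoothFunOn (V : Set M) (f : M → ℝ) : Prop :=
  ContMDiffOn (𝓡 m) 𝓘(ℝ, ℝ) ∞ f V

/-- The vector field `X` is smooth on `V`. -/
def VField.SmoothOn (V : Set M) (X : VField m M) : Prop :=
  ContMDiffOn (𝓡 m) (𝓡 m).tangent ∞ (fun p => (⟨p, X p⟩ : TangentBundle (𝓡 m) M)) V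

/-- The differential `df`. -/
def diff (f : M → ℝ) : OneForm m M := fun p => mfderiv (𝓡 m) 𝓘(ℝ, ℝ) f p

/-- The local representative of a 1-form in the chart at `x`: its pullback by the inverse chart. -/
def OneForm.rep (α : OneForm m M) (x : M) (y : EuclideanSpace ℝ (Fin m)) :
    EuclideanSpace ℝ (Fin m) →L[ℝ] ℝ :=
  (α ((extChartAt (𝓡 m) x).symm y)).comp
    (mfderiv 𝓘(ℝ, EuclideanSpace ℝ (Fin m)) (𝓡 m) (extChartAt (𝓡 m) x).symm y)

/-- The 1-form `α` is smooth on `V`: its local representatives are smooth. -/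
def OneForm.SmoothOn (V : Set M) (α : OneForm m M) : Prop :=
  ∀ x : M, ContDiffOn ℝ ∞ (α.rep x)
    ((extChartAt (𝓡 m) x).target ∩ (extChartAt (𝓡 m) x).symm ⁻¹' V)

/-- The exterior derivative of a 1-form, `dα(u, v) = ∂ᵤα(v) - ∂ᵥα(u)`, computed at `p` in the
chart at `p`. -/
def OneForm.extd (α : OneForm m M) (p : M) :
    TangentSpace (𝓡 m) p →L[ℝ] TangentSpace (𝓡 m) p →L[ℝ] ℝ :=
  let A : EuclideanSpace ℝ (Fin m) →L[ℝ] EuclideanSpace ℝ (Fin m) →L[ℝ] ℝ :=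
    fderiv ℝ (α.rep p) (extChartAt (𝓡 m) p p)
  let T : EuclideanSpace ℝ (Fin m) →L[ℝ] EuclideanSpace ℝ (Fin m) :=
    mfderiv (𝓡 m) 𝓘(ℝ, EuclideanSpace ℝ (Fin m)) (extChartAt (𝓡 m) p) p
  (A - A.flip).bilinearComp T T

theorem OneForm.extd_skew (α : OneForm m M) (p : M) (u v : TangentSpace (𝓡 m) p) :
    α.extd p u v = -α.extd p v u := by
  let A : EuclideanSpace ℝ (Fin m) →L[ℝ] EuclideanSpace ℝ (Fin m) →L[ℝ] ℝ :=
    fderiv ℝ (α.rep p) (extChartAt (𝓡 m) p p)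
  let T : EuclideanSpace ℝ (Fin m) →L[ℝ] EuclideanSpace ℝ (Fin m) :=
    mfderiv (𝓡 m) 𝓘(ℝ, EuclideanSpace ℝ (Fin m)) (extChartAt (𝓡 m) p) p
  change A (T u) (T v) - A (T v) (T u) = -(A (T v) (T u) - A (T u) (T v))
  ring

/-- The local representative of a top-degree form in the chart at `x`. -/
def TopForm.rep (Ω : TopForm m M) (x : M) (y : EuclideanSpace ℝ (Fin m)) :
    EuclideanSpace ℝ (Fin m) [⋀^Fin m]→L[ℝ] ℝ :=
  (Ω ((extChartAt (𝓡 m) x).symm y)).compContinuousLinearMap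
    (mfderiv 𝓘(ℝ, EuclideanSpace ℝ (Fin m)) (𝓡 m) (extChartAt (𝓡 m) x).symm y)

/-- `Ω` is a volume form on `V`: smooth and nowhere zero there. -/
structure TopForm.IsVolumeOn (V : Set M) (Ω : TopForm m M) : Prop where
  smooth : ∀ x : M, ContDiffOn ℝ ∞ (Ω.rep x)
    ((extChartAt (𝓡 m) x).target ∩ (extChartAt (𝓡 m) x).symm ⁻¹' V)
  ne_zero : ∀ p ∈ V, Ω p ≠ 0

/-! ### `C^∞`-symmetries and `C^∞`-structures of distributions -/

/-- `Z` belongs to the `C^∞(V)`-module `⟨Y_i⟩` generated by the vector fields `Y i` on `V`. -/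
def InModule {ι : Type} [Fintype ι] (V : Set M) (Y : ι → VField m M) (Z : VField m M) : Prop :=
  ∃ c : ι → M → ℝ, (∀ i, SmoothFunOn (m := m) V (c i)) ∧ ∀ p ∈ V, Z p = ∑ i, c i p • Y i p

/-- `X` is a `C^∞`-symmetry on `V` of the distribution `𝒟 = ⟨Y_i⟩`: it is nowhere tangent to `𝒟`
and `[X, 𝒟] ⊆ 𝒟 ⊕ ⟨X⟩`. -/
structure IsCInfSymmetry {ι : Type} [Fintype ι] (V : Set M) (Y : ι → VField m M)
    (X : VField m M) : Prop where
  smooth : X.SmoothOn V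
  transverse : ∀ p ∈ V, X p ∉ Submodule.span ℝ (Set.range fun i => Y i p)
  bracket : ∀ Z : VField m M, Z.SmoothOn V → InModule V Y Z →
    InModule V (fun o : Option ι => o.elim X Y) (VectorField.mlieBracket (𝓡 m) X Z)

/-- `(X_0, …, X_{l-1})` is a `C^∞`-structure on `V` for the rank `k` distribution `𝒟` with the
pointwise independent generators `Y_0, …, Y_{k-1}`: here `k + l = m`, and each `X_j` is a
`C^∞`-symmetry of `𝒟 ⊕ ⟨X_0, …, X_{j-1}⟩`. -/
structure IsCInfStructure {k l : ℕ} (V : Set M) (Y : Fin k → VField m M)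
    (X : Fin l → VField m M) : Prop where
  dim : k + l = m
  smooth : ∀ i, (Y i).SmoothOn V
  indep : ∀ p ∈ V, LinearIndependent ℝ fun i => Y i p
  symmetry : ∀ j : Fin l,
    IsCInfSymmetry V (Sum.elim Y fun i : {i : Fin l // i < j} => X i) (X j)

/-! ### Integration by a sequence of Pfaffian equations -/

/-- `I_k` solves on `W` the `k`-th equation of the sequence of Pfaffian equations
`w_{N-1} ≡ 0, …, w_0 ≡ 0`, that is, the equation `w_k ≡ 0` restricted to the common level sets of
`I_{k+1}, …, I_{N-1}`: on the tangent spaces of these level sets, `dI_k ∧ w_k = 0` and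
`dI_k ≠ 0`. -/
structure SolvesPfaff {N : ℕ} (W : Set M) (w : Fin N → OneForm m M) (I : Fin N → M → ℝ)
    (k : Fin N) : Prop where
  smooth : SmoothFunOn (m := m) W (I k)
  wedge : ∀ p ∈ W, ∀ u v : TangentSpace (𝓡 m) p,
    (∀ l, k < l → diff (m := m) (I l) p u = 0) → (∀ l, k < l → diff (m := m) (I l) p v = 0) →
    diff (m := m) (I k) p u * w k p v = diff (m := m) (I k) p v * w k p u
  regular : ∀ p ∈ W, ∃ u : TangentSpace (𝓡 m) p,
    (∀ l, k < l → diff (m := m) (I l) p u = 0) ∧ diff (m := m) (I k) p u ≠ 0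

/-- `S` is a one-dimensional (embedded) integral manifold of `⟨X⟩`: near each of its points it is
an embedded arc of an integral curve of `X`. -/
def IsIntegralManifold (X : VField m M) (S : Set M) : Prop :=
  ∀ p ∈ S, ∃ O : Set M, IsOpen O ∧ p ∈ O ∧ ∃ ε : ℝ, 0 < ε ∧ ∃ γ : ℝ → M, γ 0 = p ∧
    IsMIntegralCurveOn (I := 𝓡 m) γ X (Set.Ioo (-ε) ε) ∧
    Topology.IsEmbedding (fun t : Set.Ioo (-ε) ε => γ t) ∧
    γ '' Set.Ioo (-ε) ε = S ∩ O

/-- The distribution `⟨X⟩` is integrated on `V` by solving successively the `N` completely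
integrable Pfaffian equations `w_{N-1} ≡ 0, …, w_0 ≡ 0`. -/
structure IntegratedByPfaff {N : ℕ} (V : Set M) (X : VField m M)
    (w : Fin N → OneForm m M) : Prop where
  smooth : ∀ i, (w i).SmoothOn V
  indep : ∀ p ∈ V, LinearIndependent ℝ fun i => w i p
  annihilator : ∀ p ∈ V, ∀ v : TangentSpace (𝓡 m) p,
    (∀ i, w i p v = 0) ↔ v ∈ Submodule.span ℝ {X p}
  /-- `dw_i = 0` modulo `⟨w_i, …, w_{N-1}⟩`. -/
  completely_integrable : ∀ i, ∃ θ : Fin N → OneForm m M, (∀ l, (θ l).SmoothOn V) ∧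
    ∀ p ∈ V, ∀ u v : TangentSpace (𝓡 m) p, (w i).extd p u v =
      ∑ l ∈ Finset.Ici i, (θ l p u * w l p v - θ l p v * w l p u)
  /-- Whatever solutions `I_{k+1}, …, I_{N-1}` of the earlier equations have been found, the next
  equation can be solved locally. -/
  solvable : ∀ W : Set M, IsOpen W → W ⊆ V → ∀ (I : Fin N → M → ℝ) (k : Fin N),
    (∀ l, k < l → SolvesPfaff W w I l) → ∀ p ∈ W, ∃ W' : Set M, IsOpen W' ∧ p ∈ W' ∧ W' ⊆ W ∧
      ∃ J : M → ℝ, SolvesPfaff W' w (Function.update I k J) k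
  /-- The common level sets of any full sequence of solutions are integral manifolds of `⟨X⟩`. -/
  integral : ∀ W : Set M, IsOpen W → W ⊆ V → ∀ I : Fin N → M → ℝ,
    (∀ k, SolvesPfaff W w I k) → ∀ c : Fin N → ℝ,
      IsIntegralManifold X {p | p ∈ W ∧ ∀ k, I k p = c k}

/-- The 1-forms `w_i = X_{N-1} ⌟ ⋯ X̂_i ⋯ ⌟ X_0 ⌟ Y ⌟ Ω`, that is,
`w_i(Z) = Ω(Y, X_0, …, X̂_i, …, X_{N-1}, Z)`. The code puts `Z` in the place of `X_i` and corrects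
the sign. -/
def pfaffForm {N : ℕ} {M : Type*} [TopologicalSpace M]
    [ChartedSpace (EuclideanSpace ℝ (Fin (N + 1))) M] (Ω : TopForm (N + 1) M)
    (Y : VField (N + 1) M) (X : Fin N → VField (N + 1) M) (i : Fin N) : OneForm (N + 1) M :=
  fun p => (-1 : ℝ) ^ (N - 1 - (i : ℕ)) •
    (Ω p).toContinuousMultilinearMap.toContinuousLinearMap
      (Fin.cons (α := fun _ => TangentSpace (𝓡 (N + 1)) p) (Y p) fun j => X j p) i.succ

end Forms

/-! ### Contact manifolds and their Jacobi structure -/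

section Contact

variable {m : ℕ} {M : Type*} [TopologicalSpace M] [ChartedSpace (EuclideanSpace ℝ (Fin m)) M]

/-- `η` is a contact form: smooth, nowhere zero, and `dη` is nondegenerate on `ker η` (for
`dim M = 2n+1` this says that `η ∧ (dη)^n` vanishes nowhere). -/
structure IsContactForm (η : OneForm m M) : Prop where
  smooth : η.SmoothOn Set.univ
  ne_zero : ∀ p, η p ≠ 0
  nondegenerate : ∀ (p : M) (v : TangentSpace (𝓡 m) p), η p v = 0 →
    (∀ w : TangentSpace (𝓡 m) p, η p w = 0 → η.extd p v w = 0) → v = 0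

/-- The map `b(v) = v ⌟ dη + η(v) η`, an isomorphism for a contact form. -/
def flat (η : OneForm m M) (p : M) :
    TangentSpace (𝓡 m) p →L[ℝ] (TangentSpace (𝓡 m) p →L[ℝ] ℝ) :=
  η.extd p + (η p).smulRight (η p)

/-- The inverse map `b⁻¹`. -/
def sharp (η : OneForm m M) (p : M) :
    (TangentSpace (𝓡 m) p →L[ℝ] ℝ) →L[ℝ] TangentSpace (𝓡 m) p :=
  (flat η p).inverse

/-- The Reeb vector field `ℛ = b⁻¹(η)`. -/
def reeb (η : OneForm m M) : VField m M := fun p => sharp η p (η p)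

/-- The vector field `E = -ℛ` of the Jacobi structure `(Λ, E)` of a contact manifold. -/
def jacobiE (η : OneForm m M) : VField m M := fun p => -reeb η p

/-- The bivector `Λ(α, β) = -dη(b⁻¹α, b⁻¹β)` of the Jacobi structure of a contact manifold. -/
def bivector (η : OneForm m M) (p : M) (α β : TangentSpace (𝓡 m) p →L[ℝ] ℝ) : ℝ :=
  -η.extd p (sharp η p α) (sharp η p β)

/-- The Jacobi bracket `{f, g} = Λ(df, dg) + f E(g) - g E(f)`. -/
def jacobiBracket (η : OneForm m M) (f g : M → ℝ) (p : M) : ℝ :=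
  bivector η p (diff f p) (diff g p) + f p * diff g p (jacobiE η p) -
    g p * diff f p (jacobiE η p)

/-- The Hamiltonian vector field `X_f`, given by `b(X_f) = df - (ℛ(f) + f) η`. -/
def ham (η : OneForm m M) (f : M → ℝ) : VField m M := fun p =>
  sharp η p (diff f p - (diff f p (reeb η p) + f p) • η p)

end Contact

/-! ### Jacobi `C^∞`-structures on a contact manifold of dimension `2n+1` -/

section Structures

variable {n : ℕ} {M : Type*} [TopologicalSpace M]
  [ChartedSpace (EuclideanSpace ℝ (Fin (2 * n + 1))) M] [IsManifold (𝓡 (2 * n + 1)) ∞ M]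

/-- The family `(f_0, f_1, …, f_{2n-1})` with `f_0 = H`, where `(f_1, …, f_{2n-1})` is `F`. -/
def family (H : C^∞⟮𝓡 (2 * n + 1), M; ℝ⟯) (F : Fin (2 * n - 1) → C^∞⟮𝓡 (2 * n + 1), M; ℝ⟯)
    (j : Fin (2 * n)) : C^∞⟮𝓡 (2 * n + 1), M; ℝ⟯ :=
  if h : (j : ℕ) = 0 then H else F ⟨(j : ℕ) - 1, by omega⟩

/-- The set of points at which `X_{f_0}, …, X_{f_{2n-1}}` are linearly independent. -/
def indepSet (η : OneForm (2 * n + 1) M) (H : C^∞⟮𝓡 (2 * n + 1), M; ℝ⟯)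
    (F : Fin (2 * n - 1) → C^∞⟮𝓡 (2 * n + 1), M; ℝ⟯) : Set M :=
  {p | LinearIndependent ℝ fun j => ham η (family H F j) p}

/-- `F = (f_1, …, f_{2n-1})` is a Jacobi `C^∞`-structure for the Hamiltonian system `(M, H)` on
the `(2n+1)`-dimensional contact manifold `(M, η)`. -/
structure IsJacobiCInfStructure (η : OneForm (2 * n + 1) M) (H : C^∞⟮𝓡 (2 * n + 1), M; ℝ⟯)
    (F : Fin (2 * n - 1) → C^∞⟮𝓡 (2 * n + 1), M; ℝ⟯) : Prop where
  independence : ∃ U : Set M, IsOpen U ∧ Dense U ∧ ∀ p ∈ U,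
    LinearIndependent ℝ fun j => ham η (family H F j) p
  /-- Triangular bracket closure `{f_j, f_i} = F_{ji}(f_0, …, f_j)`, and Reeb compatibility: the
  field `(F_{ji} - ∑ f_k ∂F_{ji}/∂u_k) E` belongs to `⟨X_{f_0}, …, X_{f_j}⟩` locally
  around the points of the set where all the `X_{f_j}` are independent. -/
  closure : ∀ i j : Fin (2 * n), i < j →
    ∃ G : (({k : Fin (2 * n) // k ≤ j} → ℝ) → ℝ), ContDiff ℝ ∞ G ∧
      (∀ p, jacobiBracket η (family H F j) (family H F i) p = G fun k => family H F k p) ∧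
      ∀ p ∈ indepSet η H F, ∃ O : Set M, IsOpen O ∧ p ∈ O ∧
        InModule O (fun k : {k : Fin (2 * n) // k ≤ j} => ham η (family H F k))
          (fun q => (G (fun k => family H F k q) -
            ∑ k : {k : Fin (2 * n) // k ≤ j}, family H F k q *
              fderiv ℝ G (fun k => family H F k q) (Pi.single k 1)) • jacobiE η q)

/-- The family `(X_{f_1}, …, X_{f_{2n-1}}, R)`. -/
def completed (η : OneForm (2 * n + 1) M) (F : Fin (2 * n - 1) → C^∞⟮𝓡 (2 * n + 1), M; ℝ⟯)
    (R : VField (2 * n + 1) M) (j : Fin (2 * n)) : VField (2 * n + 1) M :=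
  if h : (j : ℕ) < 2 * n - 1 then ham η (F ⟨j, h⟩) else R

/-- `R` is smooth on `V` and pointwise independent there of `X_{f_0}, …, X_{f_{2n-1}}`. -/
structure IsComplement (η : OneForm (2 * n + 1) M) (H : C^∞⟮𝓡 (2 * n + 1), M; ℝ⟯)
    (F : Fin (2 * n - 1) → C^∞⟮𝓡 (2 * n + 1), M; ℝ⟯) (V : Set M)
    (R : VField (2 * n + 1) M) : Prop where
  smooth : R.SmoothOn V
  transverse : ∀ p ∈ V, R p ∉ Submodule.span ℝ (Set.range fun j => ham η (family H F j) p)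

end Structures

end ContactPfaff

end

noncomputable section

namespace ContactPfaff

/-!
The identity `[X_f, X_g] = X_{{f, g}}` turns the closure conditions of a Jacobi `C^∞`-structure
into `[X_{f_j}, X_{f_i}] ∈ ⟨X_{f_0}, …, X_{f_j}⟩` for `i < j`. So every initial segment of the
frame `(X_H, X_{f_1}, …, X_{f_{2n-1}}, R)` spans an involutive distribution, which is part (A),
and the dual coframe satisfies `dβ_i ≡ 0` modulo `β_i, …, β_{2n}`. The form `ω_i` is a nowhere
vanishing function times `β_i`, so each tail `ω_k, …, ω_{2n}` is an integrable Pfaffian system,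
and the Frobenius theorem provides the solutions `I_k`. At each point the common kernel of `dI_1,
…, dI_{2n}` is `ℝ X_H`; hence the `I_k` together with a function increasing along `X_H` are local
coordinates, and a common level set is locally an arc of an integral curve.

For the Frobenius theorem, let `f z` be a projection onto the kernel of the Pfaffian system at
`z`. Integrability says `Df(z)(f(z) x) v = Df(z)(f(z) v) x` for all `x` and `v`, and it makes the
time-one map `Φ(v, z)` of `z' = f(z) v` move `z` within its leaf. Choosing `v` so that `Φ(v, z)`
lies on a transversal of the leaves gives the first integrals.
-/

section Superposition

/-- Pointwise evaluation `(a, h) ↦ (t ↦ a(t) h(t))` of operator-valued functions, as a bounded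
bilinear map; it expresses the derivative of a superposition operator `γ ↦ f ∘ γ`. -/
def pointwiseApply (K : Type*) [TopologicalSpace K] [CompactSpace K]
    (E : Type*) [NormedAddCommGroup E] [NormedSpace ℝ E]
    (F : Type*) [NormedAddCommGroup F] [NormedSpace ℝ F] :
    C(K, E →L[ℝ] F) →L[ℝ] C(K, E) →L[ℝ] C(K, F) :=
  LinearMap.mkContinuous₂
    (LinearMap.mk₂ ℝ (fun (a : C(K, E →L[ℝ] F)) (h : C(K, E)) =>
        (⟨fun t => a t (h t), by fun_prop⟩ : C(K, F)))
      (fun _ _ _ => by ext; simp) (fun _ _ _ => by ext; simp)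
      (fun _ _ _ => by ext; simp) (fun _ _ _ => by ext; simp)) 1
    (fun a h => by
      rw [ContinuousMap.norm_le _ (by positivity)]
      intro t
      simp only [LinearMap.mk₂_apply, ContinuousMap.coe_mk, one_mul]
      exact (a t).le_of_opNorm_le_of_le (a.norm_coe_le_norm t) (h.norm_coe_le_norm t))

variable {K : Type*} [TopologicalSpace K] [CompactSpace K]
  {E : Type*} [NormedAddCommGroup E] [NormedSpace ℝ E]

@[simp] theorem pointwiseApply_apply {F : Type*} [NormedAddCommGroup F] [NormedSpace ℝ F]
    (a : C(K, E →L[ℝ] F)) (h : C(K, E)) (t : K) : pointwiseApply K E F a h t = a t (h t) := rfl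

theorem hasFDerivAt_superposition {F : Type*} [NormedAddCommGroup F] [NormedSpace ℝ F]
    {f : C(E, F)} {f' : C(E, E →L[ℝ] F)} (hf : ∀ x, HasFDerivAt f (f' x) x) (γ : C(K, E)) :
    HasFDerivAt (fun γ : C(K, E) => f.comp γ) (pointwiseApply K E F (f'.comp γ)) γ := by
  rw [hasFDerivAt_iff_isLittleO_nhds_zero, Asymptotics.isLittleO_iff]
  intro ε hε
  have hunif := (isCompact_range γ.continuous).uniformContinuousAt_of_continuousAt f'
    (fun x _ => f'.continuous.continuousAt) (Metric.dist_mem_uniformity hε)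
  obtain ⟨δ, hδ, hf'δ⟩ := Metric.mem_uniformity_dist.1 hunif
  filter_upwards [Metric.ball_mem_nhds (0 : C(K, E)) hδ] with h hh
  rw [ContinuousMap.norm_le _ (by positivity)]
  intro t
  have hht : ‖h t‖ < δ := (h.norm_coe_le_norm t).trans_lt (by simpa using hh)
  have hclose : ∀ x ∈ Metric.ball (γ t) δ, ‖f' x - f' (γ t)‖ ≤ ε := fun x hx => by
    have : dist (f' (γ t)) (f' x) < ε := hf'δ (by rwa [dist_comm]) ⟨t, rfl⟩
    rw [← dist_eq_norm, dist_comm]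
    exact this.le
  have hmean := (convex_ball (γ t) δ).norm_image_sub_le_of_norm_hasFDerivWithin_le'
    (fun x _ => (hf x).hasFDerivWithinAt) hclose (Metric.mem_ball_self hδ)
    (y := γ t + h t) (by simpa using hht)
  rw [add_sub_cancel_left] at hmean
  exact hmean.trans (by gcongr; exact h.norm_coe_le_norm t)

/-- The induction on `n` passes from `f` to `fderiv ℝ f`, so that the codomain has to vary. -/
theorem contDiff_superposition.{u} {E : Type u} [NormedAddCommGroup E] [NormedSpace ℝ E]
    (n : ℕ) : ∀ {F : Type u} [NormedAddCommGroup F] [NormedSpace ℝ F] (f : C(E, F)),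
    ContDiff ℝ ∞ f → ContDiff ℝ n (fun γ : C(K, E) => f.comp γ) := by
  induction n with
  | zero => exact fun f _ => contDiff_zero.2 (ContinuousMap.continuous_postcomp f)
  | succ n ih =>
    intro F _ _ f hf
    have hf' : ContDiff ℝ ∞ (fderiv ℝ f) := hf.fderiv_right (by simp)
    let f' : C(E, E →L[ℝ] F) := ⟨fderiv ℝ f, hf'.continuous⟩
    rw [show ((n + 1 : ℕ) : ℕ∞ω) = (n : ℕ∞ω) + 1 by norm_cast, contDiff_succ_iff_hasFDerivAt]
    exact ⟨fun γ => pointwiseApply K E F (f'.comp γ),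
      ContDiff.comp (g := pointwiseApply K E F) (ContinuousLinearMap.contDiff _) (ih f' hf'),
      hasFDerivAt_superposition fun x => (hf.differentiable (by simp) x).hasFDerivAt⟩

end Superposition

section Volterra

variable {E : Type*} [NormedAddCommGroup E] [NormedSpace ℝ E]

/-- The Volterra operator `g ↦ (t ↦ ∫₀ᵗ g)` on `C([0, 1], E)`, which turns initial value problems
on `[0, 1]` into equations in a Banach space. -/
def volterra (E : Type*) [NormedAddCommGroup E] [NormedSpace ℝ E] :
    C(unitInterval, E) →L[ℝ] C(unitInterval, E) :=
  have integrable (g : C(unitInterval, E)) (a b : ℝ) : IntervalIntegrable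
      (Set.IccExtend zero_le_one g) MeasureTheory.volume a b :=
    (g.continuous.Icc_extend' (h := zero_le_one)).intervalIntegrable a b
  LinearMap.mkContinuous
    { toFun := fun g => ⟨fun t => ∫ s in (0 : ℝ)..t, Set.IccExtend zero_le_one g s,
        (intervalIntegral.continuous_primitive (integrable g) 0).comp continuous_subtype_val⟩
      map_add' := fun g h => ContinuousMap.ext fun t =>
        intervalIntegral.integral_add (integrable g 0 t) (integrable h 0 t)
      map_smul' := fun c g => ContinuousMap.ext fun t => intervalIntegral.integral_smul c _ } 1
    fun g => by
      rw [ContinuousMap.norm_le _ (by positivity)]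
      intro t
      refine (intervalIntegral.norm_integral_le_of_norm_le_const
        fun s _ => g.norm_coe_le_norm _).trans ?_
      rw [one_mul, sub_zero, abs_of_nonneg t.2.1]
      exact mul_le_of_le_one_right (norm_nonneg _) t.2.2

theorem volterra_apply_zero (g : C(unitInterval, E)) : volterra E g 0 = 0 :=
  intervalIntegral.integral_same

theorem hasDerivWithinAt_of_eq_volterra [CompleteSpace E] {c : E} {g h : C(unitInterval, E)}
    (hh : h = ContinuousMap.const _ c + volterra E g) (t : unitInterval) :
    HasDerivWithinAt (Set.IccExtend zero_le_one h) (g t) (Set.Icc 0 1) t := by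
  have hc : Continuous (Set.IccExtend zero_le_one g) := g.continuous.Icc_extend'
  have hd := intervalIntegral.integral_hasDerivAt_right (hc.intervalIntegrable 0 t)
    (hc.stronglyMeasurableAtFilter _ _) hc.continuousAt
  rw [Set.IccExtend_val] at hd
  refine ((hd.const_add c).hasDerivWithinAt (s := Set.Icc 0 1)).congr (fun s hs => ?_) ?_
  · rw [Set.IccExtend_of_mem _ _ hs, hh]; rfl
  · rw [Set.IccExtend_val, hh]; rfl

theorem eq_of_hasDerivWithinAt_affine {A : C(unitInterval, E →L[ℝ] E)}
    {b f g : C(unitInterval, E)}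
    (hf : ∀ t : unitInterval,
      HasDerivWithinAt (Set.IccExtend zero_le_one f) (b t + A t (f t)) (Set.Icc 0 1) t)
    (hg : ∀ t : unitInterval,
      HasDerivWithinAt (Set.IccExtend zero_le_one g) (b t + A t (g t)) (Set.Icc 0 1) t)
    (h0 : f 0 = g 0) : f = g := by
  let field (t : ℝ) (z : E) : E := Set.IccExtend zero_le_one b t + Set.IccExtend zero_le_one A t z
  have lipschitz : ∀ t, LipschitzWith ‖A‖₊ (field t) := fun t =>
    LipschitzWith.of_dist_le_mul fun y z => by
      rw [dist_add_left, dist_eq_norm, dist_eq_norm, ← map_sub]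
      exact (Set.IccExtend zero_le_one A t).le_of_opNorm_le (A.norm_coe_le_norm _) _
  have solution : ∀ h : C(unitInterval, E), (∀ t : unitInterval,
      HasDerivWithinAt (Set.IccExtend zero_le_one h) (b t + A t (h t)) (Set.Icc 0 1) t) →
      ∀ t ∈ Set.Ico (0 : ℝ) 1, HasDerivWithinAt (Set.IccExtend zero_le_one h)
        (field t (Set.IccExtend zero_le_one h t)) (Set.Ici t) t := fun h hh t ht => by
    have htI := Set.Ico_subset_Icc_self ht
    simp only [field, Set.IccExtend_of_mem _ _ htI]
    exact (hh ⟨t, htI⟩).mono_of_mem_nhdsWithin (Icc_mem_nhdsGE_of_mem ht)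
  have heq := ODE_solution_unique lipschitz f.continuous.Icc_extend'.continuousOn (solution f hf)
    g.continuous.Icc_extend'.continuousOn (solution g hg)
    (by rw [Set.IccExtend_left, Set.IccExtend_left]; exact h0)
  ext t
  simpa only [Set.IccExtend_val] using heq t.2

end Volterra

theorem eventually_isInvertible {X E F : Type*} [TopologicalSpace X]
    [NormedAddCommGroup E] [NormedSpace ℝ E] [CompleteSpace E]
    [NormedAddCommGroup F] [NormedSpace ℝ F] {A : X → E →L[ℝ] F} {x : X}
    (hA : ContinuousAt A x) (hx : (A x).IsInvertible) : ∀ᶠ y in 𝓝 x, (A y).IsInvertible := by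
  obtain ⟨L, hL⟩ := hx
  exact hA (hL ▸ ContinuousLinearEquiv.nhds L)

theorem eventually_contDiffAt_implicitFunction {E₁ E₂ F : Type*}
    [NormedAddCommGroup E₁] [NormedSpace ℝ E₁] [CompleteSpace E₁]
    [NormedAddCommGroup E₂] [NormedSpace ℝ E₂] [CompleteSpace E₂]
    [NormedAddCommGroup F] [NormedSpace ℝ F] [CompleteSpace F]
    {f : E₁ × E₂ → F} {u : E₁ × E₂} {n : ℕ∞ω} (hf : ∀ᶠ v in 𝓝 u, ContDiffAt ℝ n f v) (hn : n ≠ 0)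
    (hu : (fderiv ℝ f u ∘L .inr ℝ E₁ E₂).IsInvertible) :
    ∀ᶠ x in 𝓝 u.1, ContDiffAt ℝ n (hf.self_of_nhds.implicitFunction hn hu) x := by
  set ψ := hf.self_of_nhds.implicitFunction hn hu
  have hfu : ContDiffAt ℝ n f u := hf.self_of_nhds
  have hψ : ContinuousAt ψ u.1 := (hfu.contDiffAt_implicitFunction hn hu).continuousAt
  have hgraph : Filter.Tendsto (fun x => (x, ψ x)) (𝓝 u.1) (𝓝 u) := by
    have hψu : ψ u.1 = u.2 := hfu.implicitFunction_apply_self hn hu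
    have := continuousAt_id.prodMk hψ
    rwa [ContinuousAt, hψu] at this
  have hinv : ∀ᶠ v in 𝓝 u, (fderiv ℝ f v ∘L .inr ℝ E₁ E₂).IsInvertible := by
    have hderiv : ContinuousAt (fderiv ℝ f) u :=
      (hfu.fderiv_right (m := 0) (by simpa [ENat.one_le_iff_ne_zero_withTop] using hn)).continuousAt
    exact eventually_isInvertible (hderiv.clm_comp continuousAt_const) hu
  filter_upwards [hgraph.eventually hf, hgraph.eventually hinv,
    hfu.eventually_apply_implicitFunction hn hu,
    hgraph.eventually (hfu.eventually_apply_eq_iff_implicitFunction hn hu).eventually_nhds]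
    with x hfx hinvx hψx huniq
  have hsame : hfx.implicitFunction hn hinvx =ᶠ[𝓝 x] ψ := by
    have hself : hfx.implicitFunction hn hinvx x = ψ x := hfx.implicitFunction_apply_self hn hinvx
    have hgraph' : Filter.Tendsto (fun y => (y, hfx.implicitFunction hn hinvx y)) (𝓝 x)
        (𝓝 (x, ψ x)) := by
      have := continuousAt_id.prodMk (hfx.contDiffAt_implicitFunction hn hinvx).continuousAt
      rwa [ContinuousAt, id, hself] at this
    filter_upwards [hfx.eventually_apply_implicitFunction hn hinvx, hgraph'.eventually huniq]
      with y hy huniqy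
    exact (huniqy.1 (hy.trans hψx)).symm
  exact (hfx.contDiffAt_implicitFunction hn hinvx).congr_of_eventuallyEq hsame.symm

section Exponential

variable {E : Type*} [NormedAddCommGroup E] [NormedSpace ℝ E]

/-- The initial value problem `γ' = f(γ) x`, `γ(0) = c` on `[0, 1]`, as an integral equation whose
solutions `γ` are the zeros of `rayEquation f ((x, c), ·)`. -/
def rayEquation (f : C(E, E →L[ℝ] E)) (u : (E × E) × C(unitInterval, E)) : C(unitInterval, E) :=
  u.2 - (.const _ u.1.2 + volterra E (pointwiseApply _ E E (f.comp u.2) (.const _ u.1.1)))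

theorem hasFDerivAt_continuousMapConst_comp {G : Type*} [NormedAddCommGroup G] [NormedSpace ℝ G]
    (L : G →L[ℝ] E) (u : G) : HasFDerivAt (fun u => ContinuousMap.const unitInterval (L u))
      ((ContinuousLinearMap.const ℝ unitInterval).comp L) u :=
  ((ContinuousLinearMap.const ℝ unitInterval).comp L).hasFDerivAt

theorem fderiv_rayEquation_apply {f : C(E, E →L[ℝ] E)} {f' : C(E, E →L[ℝ] E →L[ℝ] E)}
    (hf : ∀ x, HasFDerivAt f (f' x) x) (u w : (E × E) × C(unitInterval, E)) :
    fderiv ℝ (rayEquation f) u w = w.2 - (.const _ w.1.2 +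
      volterra E (pointwiseApply _ E E (f.comp u.2) (.const _ w.1.1) +
        pointwiseApply _ E E (pointwiseApply _ E _ (f'.comp u.2) w.2) (.const _ u.1.1))) := by
  let curve := ContinuousLinearMap.snd ℝ (E × E) C(unitInterval, E)
  let direction :=
    ContinuousLinearMap.fst ℝ E E ∘L ContinuousLinearMap.fst ℝ (E × E) C(unitInterval, E)
  let initial :=
    ContinuousLinearMap.snd ℝ E E ∘L ContinuousLinearMap.fst ℝ (E × E) C(unitInterval, E)
  have hvelocity := (pointwiseApply unitInterval E E).hasFDerivAt_of_bilinear
    ((hasFDerivAt_superposition hf u.2).comp u curve.hasFDerivAt)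
    (hasFDerivAt_continuousMapConst_comp direction u)
  have hequation : HasFDerivAt (rayEquation f) _ u := curve.hasFDerivAt.sub
    ((hasFDerivAt_continuousMapConst_comp initial u).add
      ((volterra E).hasFDerivAt.comp u hvelocity))
  rw [hequation.fderiv]
  rfl

theorem contDiff_rayEquation {f : C(E, E →L[ℝ] E)} (hf : ContDiff ℝ ∞ f) :
    ContDiff ℝ ∞ (rayEquation f) := by
  have hconst : ContDiff ℝ ∞ (ContinuousMap.const unitInterval : E → C(unitInterval, E)) :=
    (ContinuousLinearMap.const ℝ unitInterval : E →L[ℝ] C(unitInterval, E)).contDiff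
  have hsuperposition : ContDiff ℝ ∞ (fun γ : C(unitInterval, E) => f.comp γ) :=
    contDiff_infty.2 fun n => contDiff_superposition n f hf
  have hvelocity : ContDiff ℝ ∞ (fun u : (E × E) × C(unitInterval, E) =>
      pointwiseApply _ E E (f.comp u.2) (.const _ u.1.1)) :=
    (ContDiff.comp (g := pointwiseApply _ E E) (ContinuousLinearMap.contDiff _)
      (hsuperposition.comp contDiff_snd)).clm_apply (hconst.comp (contDiff_fst.comp contDiff_fst))
  exact contDiff_snd.sub ((hconst.comp (contDiff_snd.comp contDiff_fst)).add
    (ContDiff.comp (g := volterra E) (ContinuousLinearMap.contDiff _) hvelocity))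

theorem fderiv_eq_volterra_of_rayEquation_eq_zero {f : C(E, E →L[ℝ] E)}
    {f' : C(E, E →L[ℝ] E →L[ℝ] E)} (hf : ∀ x, HasFDerivAt f (f' x) x)
    {Γ : E × E → C(unitInterval, E)} {q : E × E} (hΓ : DifferentiableAt ℝ Γ q)
    (hray : DifferentiableAt ℝ (rayEquation f) (q, Γ q))
    (hzero : ∀ᶠ q in 𝓝 q, rayEquation f (q, Γ q) = 0) (w : E × E) :
    fderiv ℝ Γ q w = .const _ w.2 +
      volterra E (pointwiseApply _ E E (f.comp (Γ q)) (.const _ w.1) +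
        pointwiseApply _ E E (pointwiseApply _ E _ (f'.comp (Γ q)) (fderiv ℝ Γ q w))
          (.const _ q.1)) := by
  have hcomp : HasFDerivAt (fun q => rayEquation f (q, Γ q)) _ q :=
    HasFDerivAt.comp (g := rayEquation f) q hray.hasFDerivAt
      ((hasFDerivAt_id q).prodMk hΓ.hasFDerivAt)
  have hconst : HasFDerivAt (fun q => rayEquation f (q, Γ q)) (0 : E × E →L[ℝ] _) q :=
    (hasFDerivAt_const (0 : C(unitInterval, E)) q).congr_of_eventuallyEq hzero
  have happly : fderiv ℝ (rayEquation f) (q, Γ q) (w, fderiv ℝ Γ q w) = 0 :=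
    DFunLike.congr_fun (hcomp.unique hconst) w
  rw [fderiv_rayEquation_apply hf] at happly
  exact sub_eq_zero.1 happly

variable [CompleteSpace E]

theorem exists_rayMap {f : C(E, E →L[ℝ] E)} (hf : ContDiff ℝ ∞ f) (z₀ : E) :
    ∃ Γ : E × E → C(unitInterval, E), Γ (0, z₀) = .const _ z₀ ∧
      ∀ᶠ q in 𝓝 ((0 : E), z₀), ContDiffAt ℝ ∞ Γ q ∧ rayEquation f (q, Γ q) = 0 := by
  let u₀ : (E × E) × C(unitInterval, E) := ((0, z₀), .const _ z₀)
  let f' : C(E, E →L[ℝ] E →L[ℝ] E) := ⟨fderiv ℝ f, (hf.fderiv_right (m := 0) (by simp)).continuous⟩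
  have hsmooth : ∀ᶠ u in 𝓝 u₀, ContDiffAt ℝ ∞ (rayEquation f) u :=
    .of_forall fun u => (contDiff_rayEquation hf).contDiffAt
  have hzero : ContinuousMap.const unitInterval (0 : E) = 0 := rfl
  have hpartial : (fderiv ℝ (rayEquation f) u₀ ∘L .inr ℝ (E × E) C(unitInterval, E)) =
      ContinuousLinearMap.id ℝ _ := by
    ext1 ζ
    rw [ContinuousLinearMap.comp_apply, fderiv_rayEquation_apply (f' := f')
      fun x => (hf.differentiable (by simp) x).hasFDerivAt]
    simp [u₀, hzero]
  have hinv : (fderiv ℝ (rayEquation f) u₀ ∘L .inr ℝ (E × E) C(unitInterval, E)).IsInvertible :=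
    ⟨.refl ℝ _, hpartial.symm⟩
  have hu₀ : rayEquation f u₀ = 0 := by simp [rayEquation, u₀, hzero]
  refine ⟨hsmooth.self_of_nhds.implicitFunction (by simp) hinv,
    hsmooth.self_of_nhds.implicitFunction_apply_self _ hinv, ?_⟩
  filter_upwards [eventually_contDiffAt_implicitFunction hsmooth (by simp) hinv,
    hsmooth.self_of_nhds.eventually_apply_implicitFunction (by simp) hinv] with q hq hqu
  exact ⟨hq, hqu.trans hu₀⟩

/-- If the fields `f(·) x` and `f(·) v` commute along the ray `γ`, then `t ↦ (1 - t) f(γ t) v` is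
the variation of `γ` with the initial value moving along `f(c) v` and the direction along `-v`. -/
theorem variation_eq_of_commute {f : C(E, E →L[ℝ] E)} {f' : C(E, E →L[ℝ] E →L[ℝ] E)}
    (hf : ∀ x, HasFDerivAt f (f' x) x) {x c v : E} {γ ζ : C(unitInterval, E)}
    (hγ : rayEquation f ((x, c), γ) = 0)
    (hζ : ζ = .const _ (f c v) + volterra E (pointwiseApply _ E E (f.comp γ) (.const _ (-v)) +
      pointwiseApply _ E E (pointwiseApply _ E _ (f'.comp γ) ζ) (.const _ x)))
    (hcomm : ∀ t, f' (γ t) (f (γ t) x) v = f' (γ t) (f (γ t) v) x) (t : unitInterval) :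
    ζ t = (1 - (t : ℝ)) • f (γ t) v := by
  have hγ' : γ = .const _ c + volterra E (pointwiseApply _ E E (f.comp γ) (.const _ x)) :=
    sub_eq_zero.1 hγ
  let Y : C(unitInterval, E) := ⟨fun t => (1 - (t : ℝ)) • f (γ t) v, by fun_prop⟩
  let A : C(unitInterval, E →L[ℝ] E) :=
    ⟨fun t => (f' (γ t)).flip x,
      ((ContinuousLinearMap.apply ℝ (E →L[ℝ] E) x).continuous.comp
        (ContinuousLinearMap.flipₗᵢ ℝ E E E).continuous).comp (f'.comp γ).continuous⟩
  have hA : ∀ s z, A s z = f' (γ s) z x := fun _ _ => rfl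
  have hγ0 : γ 0 = c := (congrArg (· 0) hγ').trans (by simp [volterra_apply_zero])
  suffices ζ = Y from congrArg (· t) this
  refine eq_of_hasDerivWithinAt_affine (A := A) (b := ⟨fun t => -f (γ t) v, by fun_prop⟩)
    (fun s => ?_) (fun s => ?_) ?_
  · refine (hasDerivWithinAt_of_eq_volterra hζ s).congr_deriv ?_
    simp [hA]
  · have hfγ : HasDerivWithinAt (fun r => f (Set.IccExtend zero_le_one γ r))
        (f' (γ s) (f (γ s) x)) (Set.Icc 0 1) s := by
      have hfs := hf (Set.IccExtend zero_le_one γ s)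
      rw [Set.IccExtend_val] at hfs
      exact HasFDerivAt.comp_hasDerivWithinAt_of_eq (s : ℝ) hfs
        (hasDerivWithinAt_of_eq_volterra hγ' s) (Set.IccExtend_val _ _ s).symm
    have hprod := ((hasDerivWithinAt_id (s : ℝ) (Set.Icc 0 1)).const_sub 1).smul
      (hfγ.clm_apply (hasDerivWithinAt_const (s : ℝ) (Set.Icc 0 1) v))
    refine (hprod.congr_of_mem (fun r hr => ?_) s.2).congr_deriv ?_
    · simp [Y, Set.IccExtend_of_mem _ _ hr]
    · simp [hA, Y, hcomm, add_comm]
  · rw [hζ]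
    simp [Y, volterra_apply_zero, hγ0]

/-- A linear family `x ↦ f(·) x` of commuting vector fields has a smooth exponential map `Φ`:
`Φ (x, c)` is the time one map of `f(·) x` applied to `c`. By commutativity it is invariant under
moving `c` along `f(c) v` and `x` along `-v`. -/
theorem exists_exponential {f : E → E →L[ℝ] E} (hf : ContDiff ℝ ∞ f) {z₀ : E}
    (hcomm : ∀ᶠ z in 𝓝 z₀, ∀ x v, fderiv ℝ f z (f z x) v = fderiv ℝ f z (f z v) x) :
    ∃ Φ : E × E → E, (∀ᶠ q in 𝓝 ((0 : E), z₀), ContDiffAt ℝ ∞ Φ q) ∧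
      (∀ᶠ c in 𝓝 z₀, Φ (0, c) = c) ∧
      ∀ᶠ q in 𝓝 ((0 : E), z₀), ∀ v, fderiv ℝ Φ q (-v, f q.2 v) = 0 := by
  let F : C(E, E →L[ℝ] E) := ⟨f, hf.continuous⟩
  let F' : C(E, E →L[ℝ] E →L[ℝ] E) := ⟨fderiv ℝ f, (hf.fderiv_right (m := 0) (by simp)).continuous⟩
  have hF : ∀ x, HasFDerivAt F (F' x) x := fun x => (hf.differentiable (by simp) x).hasFDerivAt
  obtain ⟨Γ, hΓ₀, hΓ⟩ := exists_rayMap (f := F) hf z₀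
  let endpoint : C(unitInterval, E) →L[ℝ] E := ContinuousMap.evalCLM ℝ 1
  refine ⟨endpoint ∘ Γ, hΓ.mono fun q hq => endpoint.contDiff.contDiffAt.comp q hq.1, ?_, ?_⟩
  · have hslice : Filter.Tendsto (fun c : E => ((0 : E), c)) (𝓝 z₀) (𝓝 (0, z₀)) :=
      Continuous.tendsto (by fun_prop) _
    filter_upwards [hslice.eventually hΓ] with c ⟨_, hc⟩
    have hzero : ContinuousMap.const unitInterval (0 : E) = 0 := rfl
    simp only [rayEquation, hzero, map_zero, add_zero, sub_eq_zero] at hc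
    rw [Function.comp_apply, hc]
    rfl
  · obtain ⟨δ, hδ, hball⟩ := Metric.eventually_nhds_iff.1 hcomm
    have hnear : ∀ᶠ q in 𝓝 ((0 : E), z₀), dist (Γ q) (.const _ z₀) < δ := by
      have := hΓ.self_of_nhds.1.continuousAt.eventually (Metric.ball_mem_nhds _ hδ)
      rwa [hΓ₀] at this
    filter_upwards [hΓ.eventually_nhds, hnear] with q hq hqδ v
    have hΓq : DifferentiableAt ℝ Γ q := hq.self_of_nhds.1.differentiableAt (by simp)
    have hvariation := variation_eq_of_commute hF (x := q.1) (c := q.2) hq.self_of_nhds.2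
      (fderiv_eq_volterra_of_rayEquation_eq_zero hF hΓq
        ((contDiff_rayEquation (f := F) hf).differentiable (by simp) _)
        (hq.mono fun _ h => h.2) (-v, f q.2 v))
      (fun t => hball ((ContinuousMap.dist_apply_le_dist t).trans_lt hqδ) _ _) 1
    rw [(endpoint.hasFDerivAt.comp q hΓq.hasFDerivAt).fderiv]
    exact hvariation.trans (by simp)

end Exponential

section Frobenius

theorem exists_contDiff_eventuallyEq {E G : Type*} [NormedAddCommGroup E] [NormedSpace ℝ E]
    [FiniteDimensional ℝ E] [NormedAddCommGroup G] [NormedSpace ℝ G] {g : E → G} {z₀ : E}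
    (hg : ∀ᶠ z in 𝓝 z₀, ContDiffAt ℝ ∞ g z) : ∃ f : E → G, ContDiff ℝ ∞ f ∧ f =ᶠ[𝓝 z₀] g := by
  obtain ⟨r, hr, hball⟩ := Metric.eventually_nhds_iff.1 hg
  let χ : ContDiffBump z₀ := ⟨r / 4, r / 2, by linarith, by linarith⟩
  refine ⟨fun z => χ z • g z, contDiff_iff_contDiffAt.2 fun x => ?_, ?_⟩
  · by_cases hx : dist x z₀ < r
    · exact χ.contDiffAt.smul (hball hx)
    · have hsupport : x ∉ tsupport χ := by
        rw [χ.tsupport_eq, Metric.mem_closedBall, not_le]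
        exact (half_lt_self hr).trans_le (not_lt.1 hx)
      refine (contDiffAt_const (c := (0 : G))).congr_of_eventuallyEq ?_
      filter_upwards [notMem_tsupport_iff_eventuallyEq.1 hsupport] with y hy
      rw [hy, Pi.zero_apply, zero_smul]
  · filter_upwards [χ.eventuallyEq_one] with y hy
    rw [hy, Pi.one_apply, one_smul]

variable {E F : Type*} [NormedAddCommGroup E] [NormedSpace ℝ E] [NormedAddCommGroup F]
  [NormedSpace ℝ F]

theorem contDiffAt_clm_inverse {X : Type*} [NormedAddCommGroup X] [NormedSpace ℝ X]
    [CompleteSpace E] {A : X → E →L[ℝ] F} {x : X} {n : ℕ∞ω} (hA : ContDiffAt ℝ n A x)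
    (hx : (A x).IsInvertible) : ContDiffAt ℝ n (fun y => (A y).inverse) x :=
  hx.contDiffAt_map_inverse.comp x hA

theorem fderiv_apply_apply_rightInverse {S : E → E →L[ℝ] F} {T : F →L[ℝ] E} {z : E}
    (hS : DifferentiableAt ℝ S z) (hT : ∀ᶠ z in 𝓝 z, ∀ y, S z (T y) = y) (u : E) (y : F) :
    fderiv ℝ S z u (T y) = 0 := by
  have hderiv : HasFDerivAt (fun z => S z (T y)) _ z :=
    hS.hasFDerivAt.clm_apply (hasFDerivAt_const (T y) z)
  have hzero : HasFDerivAt (fun z => S z (T y)) (0 : E →L[ℝ] F) z :=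
    (hasFDerivAt_const y z).congr_of_eventuallyEq (hT.mono fun _ h => h y)
  simpa using DFunLike.congr_fun (hderiv.unique hzero) u

/-- The projections `id - T ∘ S(z)` onto the kernels of an integrable system `S = 0` with the
constant right inverse `T` form a commuting family of vector fields. -/
theorem fderiv_id_sub_comp_apply_comm {S : E → E →L[ℝ] F} {T : F →L[ℝ] E} {z : E}
    (hS : DifferentiableAt ℝ S z) (hT : ∀ᶠ z in 𝓝 z, ∀ y, S z (T y) = y)
    (hint : ∀ u v, S z u = 0 → S z v = 0 → fderiv ℝ S z u v = fderiv ℝ S z v u) (x v : E) :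
    fderiv ℝ (fun z => .id ℝ E - T ∘L S z) z (x - T (S z x)) v =
      fderiv ℝ (fun z => .id ℝ E - T ∘L S z) z (v - T (S z v)) x := by
  have hderiv : HasFDerivAt (fun z => .id ℝ E - T ∘L S z) _ z :=
    ((ContinuousLinearMap.compL ℝ E F E T).hasFDerivAt.comp z hS.hasFDerivAt).const_sub _
  have hker : ∀ u, S z (u - T (S z u)) = 0 := fun u => by
    rw [map_sub, hT.self_of_nhds, sub_self]
  have happly : ∀ u w, fderiv ℝ S z u w = fderiv ℝ S z u (w - T (S z w)) := fun u w => by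
    rw [map_sub, fderiv_apply_apply_rightInverse hS hT, sub_zero]
  rw [hderiv.fderiv]
  change -T (fderiv ℝ S z _ v) = -T (fderiv ℝ S z _ x)
  rw [happly _ v, happly _ x, hint _ _ (hker x) (hker v)]

theorem fderiv_apply_inr_of_eventuallyEq_id {G : Type*} [NormedAddCommGroup G] [NormedSpace ℝ G]
    {Φ : G × E → E} {z : E} (hΦ : DifferentiableAt ℝ Φ (0, z))
    (hΦ₀ : ∀ᶠ y in 𝓝 z, Φ (0, y) = y) (w : E) : fderiv ℝ Φ (0, z) (0, w) = w := by
  have hcomp := hΦ.hasFDerivAt.comp z (ContinuousLinearMap.inr ℝ G E).hasFDerivAt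
  have hid : HasFDerivAt (Φ ∘ ContinuousLinearMap.inr ℝ G E) (.id ℝ E) z :=
    (hasFDerivAt_id z).congr_of_eventuallyEq hΦ₀
  exact DFunLike.congr_fun (hcomp.unique hid) w

/-- The exponential `Φ` of the projections onto `ker S` moves `z` along the leaf of `z` to a point
of the transversal through `z₀`, and the first integral `J` is the coordinate of that point. -/
theorem exists_first_integral_of_rightInverse [CompleteSpace E] {S : E → E →L[ℝ] F}
    (hS : ContDiff ℝ ∞ S) {T : F →L[ℝ] E} {z₀ : E} (hT : ∀ᶠ z in 𝓝 z₀, ∀ y, S z (T y) = y)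
    (hint : ∀ᶠ z in 𝓝 z₀, ∀ u v, S z u = 0 → S z v = 0 →
      fderiv ℝ S z u v = fderiv ℝ S z v u) :
    ∃ J : E → F, (∀ᶠ z in 𝓝 z₀, ContDiffAt ℝ ∞ J z) ∧ fderiv ℝ J z₀ = S z₀ ∧
      ∀ᶠ z in 𝓝 z₀, ∀ w, S z w = 0 → fderiv ℝ J z w = 0 := by
  let f (z : E) : E →L[ℝ] E := .id ℝ E - T ∘L S z
  have hf_apply : ∀ z v, f z v = v - T (S z v) := fun _ _ => rfl
  have hf : ContDiff ℝ ∞ f := contDiff_const.sub (contDiff_const.clm_comp hS)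
  have hcomm : ∀ᶠ z in 𝓝 z₀, ∀ x v, fderiv ℝ f z (f z x) v = fderiv ℝ f z (f z v) x := by
    filter_upwards [hT.eventually_nhds, hint] with z hTz hintz
    exact fderiv_id_sub_comp_apply_comm (hS.differentiable (by simp) z) hTz hintz
  obtain ⟨Φ, hΦ, hΦ₀, hΦinv⟩ := exists_exponential hf hcomm
  let A (z : E) : E × E := (-f z₀ (z - z₀), z)
  have hA : ∀ z, HasFDerivAt A ((-f z₀).prod (.id ℝ E)) z := fun z =>
    ((-f z₀).hasFDerivAt.comp z ((hasFDerivAt_id z).sub_const z₀)).prodMk (hasFDerivAt_id z)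
  have hAsmooth : ContDiff ℝ ∞ A :=
    ((-f z₀).contDiff.comp (contDiff_id.sub contDiff_const)).prodMk contDiff_id
  have hA₀ : A z₀ = (0, z₀) := by simp [A]
  have hAtendsto : Filter.Tendsto A (𝓝 z₀) (𝓝 (0, z₀)) := hA₀ ▸ (hA z₀).continuousAt
  have hJ : ∀ᶠ z in 𝓝 z₀, HasFDerivAt (fun z => S z₀ (Φ (A z)))
      (S z₀ ∘L fderiv ℝ Φ (A z) ∘L (-f z₀).prod (.id ℝ E)) z := by
    filter_upwards [hAtendsto.eventually hΦ] with z hz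
    exact (S z₀).hasFDerivAt.comp z ((hz.differentiableAt (by simp)).hasFDerivAt.comp z (hA z))
  have hT₀ := hT.self_of_nhds
  refine ⟨fun z => S z₀ (Φ (A z)), ?_, ?_, ?_⟩
  · filter_upwards [hAtendsto.eventually hΦ] with z hz
    exact (S z₀).contDiff.contDiffAt.comp z (hz.comp z hAsmooth.contDiffAt)
  · ext w
    have hsplit : (-f z₀ w, w) = (-f z₀ w, f z₀ (f z₀ w)) + (0, T (S z₀ w)) := by
      simp [hf_apply, hT₀]
    rw [hJ.self_of_nhds.fderiv]
    change S z₀ (fderiv ℝ Φ (A z₀) (-f z₀ w, w)) = S z₀ w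
    rw [hA₀, hsplit, map_add, hΦinv.self_of_nhds,
      fderiv_apply_inr_of_eventuallyEq_id (hΦ.self_of_nhds.differentiableAt (by simp)) hΦ₀,
      zero_add, hT₀]
  · filter_upwards [hJ, hAtendsto.eventually hΦinv, hT] with z hJz hinvz hTz w hw
    have hwf : w = f z (f z₀ w) := by simp [hf_apply, hTz, hw]
    rw [hJz.fderiv]
    change S z₀ (fderiv ℝ Φ (A z) (-f z₀ w, w)) = 0
    rw [show (-f z₀ w, w) = (-f z₀ w, f z (f z₀ w)) from congrArg _ hwf]
    exact (congrArg _ (hinvz (f z₀ w))).trans (map_zero _)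

theorem fderiv_clm_comp_apply_of_apply_eq_zero {G : Type*} [NormedAddCommGroup G]
    [NormedSpace ℝ G] {B : E → F →L[ℝ] G} {θ : E → E →L[ℝ] F} {z v : E}
    (hB : DifferentiableAt ℝ B z) (hθ : DifferentiableAt ℝ θ z) (hv : θ z v = 0) (u : E) :
    fderiv ℝ (fun z => B z ∘L θ z) z u v = B z (fderiv ℝ θ z u v) := by
  rw [(hB.hasFDerivAt.clm_comp hθ.hasFDerivAt).fderiv]
  simp [hv]

/-- Replacing `θ` by `(θ ∘ T)⁻¹ ∘ θ`, where `T` is a right inverse of `θ z₀`, changes neither the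
kernels nor the integrability. -/
theorem exists_equivalent_pfaffian_system [FiniteDimensional ℝ E] {θ : E → E →L[ℝ] F} {z₀ : E}
    (hθ : ∀ᶠ z in 𝓝 z₀, ContDiffAt ℝ ∞ θ z) (hsurj : Function.Surjective (θ z₀))
    (hint : ∀ᶠ z in 𝓝 z₀, ∀ u v, θ z u = 0 → θ z v = 0 →
      fderiv ℝ θ z u v = fderiv ℝ θ z v u) :
    ∃ (S : E → E →L[ℝ] F) (T : F →L[ℝ] E), ContDiff ℝ ∞ S ∧ S z₀ = θ z₀ ∧
      (∀ᶠ z in 𝓝 z₀, ∀ y, S z (T y) = y) ∧ (∀ᶠ z in 𝓝 z₀, ∀ v, S z v = 0 ↔ θ z v = 0) ∧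
      ∀ᶠ z in 𝓝 z₀, ∀ u v, S z u = 0 → S z v = 0 → fderiv ℝ S z u v = fderiv ℝ S z v u := by
  have : CompleteSpace E := FiniteDimensional.complete ℝ E
  have : FiniteDimensional ℝ F := Module.Finite.of_surjective (θ z₀).toLinearMap hsurj
  have : CompleteSpace F := FiniteDimensional.complete ℝ F
  obtain ⟨T, hT₀⟩ := (θ z₀).exists_rightInverse_of_surjective (LinearMap.range_eq_top.2 hsurj)
  have hinv : ∀ᶠ z in 𝓝 z₀, (θ z ∘L T).IsInvertible :=
    eventually_isInvertible (hθ.self_of_nhds.continuousAt.clm_comp continuousAt_const)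
      ⟨.refl ℝ F, hT₀.symm⟩
  have hB : ∀ᶠ z in 𝓝 z₀, ContDiffAt ℝ ∞ (fun z => (θ z ∘L T).inverse) z := by
    filter_upwards [hθ, hinv] with z hz hzinv
    exact contDiffAt_clm_inverse (hz.clm_comp contDiffAt_const) hzinv
  obtain ⟨S, hS, hSeq⟩ := exists_contDiff_eventuallyEq
    (g := fun z => (θ z ∘L T).inverse ∘L θ z) (z₀ := z₀)
    ((hB.and hθ).mono fun _ h => h.1.clm_comp h.2)
  have hSker : ∀ᶠ z in 𝓝 z₀, ∀ v, S z v = 0 ↔ θ z v = 0 := by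
    filter_upwards [hSeq, hinv] with z hSz hz v
    obtain ⟨L, hL⟩ := hz
    rw [hSz, ← hL, ContinuousLinearMap.inverse_equiv]
    exact L.symm.map_eq_zero_iff
  have hST : ∀ᶠ z in 𝓝 z₀, ∀ y, S z (T y) = y := by
    filter_upwards [hSeq, hinv] with z hSz hz y
    rw [hSz]
    exact hz.inverse_apply_self y
  have hSint : ∀ᶠ z in 𝓝 z₀, ∀ u v, S z u = 0 → S z v = 0 →
      fderiv ℝ S z u v = fderiv ℝ S z v u := by
    filter_upwards [hSeq.eventually_nhds, hSker, hB, hθ, hint]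
      with z hSz hker hBz hθz hintz u v hu hv
    rw [hker] at hu hv
    have hBd := hBz.differentiableAt (by simp)
    have hθd := hθz.differentiableAt (by simp)
    rw [Filter.EventuallyEq.fderiv_eq hSz, fderiv_clm_comp_apply_of_apply_eq_zero hBd hθd hv,
      fderiv_clm_comp_apply_of_apply_eq_zero hBd hθd hu, hintz u v hu hv]
  have hS₀ : S z₀ = θ z₀ := by
    rw [hSeq.self_of_nhds]
    change (θ z₀ ∘L T).inverse ∘L θ z₀ = θ z₀
    rw [hT₀, ContinuousLinearMap.inverse_id]
    exact ContinuousLinearMap.id_comp _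
  exact ⟨S, T, hS, hS₀, hST, hSker, hSint⟩

/-- The Frobenius theorem, in the form of the existence of first integrals. -/
theorem exists_first_integral [FiniteDimensional ℝ E] {θ : E → E →L[ℝ] F} {z₀ : E}
    (hθ : ∀ᶠ z in 𝓝 z₀, ContDiffAt ℝ ∞ θ z) (hsurj : Function.Surjective (θ z₀))
    (hint : ∀ᶠ z in 𝓝 z₀, ∀ u v, θ z u = 0 → θ z v = 0 →
      fderiv ℝ θ z u v = fderiv ℝ θ z v u) :
    ∃ J : E → F, (∀ᶠ z in 𝓝 z₀, ContDiffAt ℝ ∞ J z) ∧ fderiv ℝ J z₀ = θ z₀ ∧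
      ∀ᶠ z in 𝓝 z₀, ∀ w, θ z w = 0 → fderiv ℝ J z w = 0 := by
  have : CompleteSpace E := FiniteDimensional.complete ℝ E
  obtain ⟨S, T, hS, hS₀, hST, hker, hSint⟩ := exists_equivalent_pfaffian_system hθ hsurj hint
  obtain ⟨J, hJ, hJ₀, hJker⟩ := exists_first_integral_of_rightInverse hS hST hSint
  refine ⟨J, hJ, hJ₀.trans hS₀, ?_⟩
  filter_upwards [hJker, hker] with z hz hker w hw
  exact hz w ((hker w).2 hw)

end Frobenius

/-! ### Vector fields and 1-forms in a chart -/

section Charts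

variable {m : ℕ} {M : Type*} [TopologicalSpace M] [ChartedSpace (EuclideanSpace ℝ (Fin m)) M]

/-- The derivative at `q` of the chart at `x`. -/
def chartD (x q : M) : TangentSpace (𝓡 m) q →L[ℝ] EuclideanSpace ℝ (Fin m) :=
  mfderiv (𝓡 m) 𝓘(ℝ, EuclideanSpace ℝ (Fin m)) (extChartAt (𝓡 m) x) q

/-- The derivative of the inverse of the chart at `x`, at the image of `q`. -/
def chartDInv (x q : M) : EuclideanSpace ℝ (Fin m) →L[ℝ] TangentSpace (𝓡 m) q :=
  mfderiv 𝓘(ℝ, EuclideanSpace ℝ (Fin m)) (𝓡 m) (extChartAt (𝓡 m) x).symm (extChartAt (𝓡 m) x q)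

/-- The vector field with constant coordinates `v` in the chart at `x`. -/
def coordField (x : M) (v : EuclideanSpace ℝ (Fin m)) : VField m M := fun q => chartDInv x q v

/-- The coordinates of a vector field in the chart at `x`. -/
def VField.coords (Y : VField m M) (x q : M) : EuclideanSpace ℝ (Fin m) := chartD x q (Y q)

variable {x q : M}

theorem SmoothFunOn.contMDiffAt {f : M → ℝ} {V : Set M} (h : SmoothFunOn (m := m) V f)
    (hV : IsOpen V) {p : M} (hp : p ∈ V) : ContMDiffAt (𝓡 m) 𝓘(ℝ, ℝ) ∞ f p :=
  ContMDiffOn.contMDiffAt h (hV.mem_nhds hp)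

theorem target_inter_preimage_mem_nhds {V : Set M} (hV : V ∈ 𝓝 q)
    (hq : q ∈ (extChartAt (𝓡 m) x).source) :
    (extChartAt (𝓡 m) x).target ∩ (extChartAt (𝓡 m) x).symm ⁻¹' V ∈ 𝓝 (extChartAt (𝓡 m) x q) :=
  Filter.inter_mem (extChartAt_target_mem_nhds' ((extChartAt (𝓡 m) x).map_source hq))
    (extChartAt_preimage_mem_nhds' hq hV)

theorem OneForm.rep_extChartAt (α : OneForm m M) (hq : q ∈ (extChartAt (𝓡 m) x).source)
    (v : EuclideanSpace ℝ (Fin m)) :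
    α.rep x (extChartAt (𝓡 m) x q) v = α q (coordField x v q) := by
  have : ∀ q', q' = q → α q' (mfderiv 𝓘(ℝ, EuclideanSpace ℝ (Fin m)) (𝓡 m)
      (extChartAt (𝓡 m) x).symm (extChartAt (𝓡 m) x q) v) = α q (coordField x v q) := by
    rintro _ rfl; rfl
  exact this _ ((extChartAt (𝓡 m) x).left_inv hq)

theorem OneForm.SmoothOn.mono {w : OneForm m M} {V W : Set M} (hw : w.SmoothOn V) (hWV : W ⊆ V) :
    w.SmoothOn W := fun x => (hw x).mono fun _ hy => ⟨hy.1, hWV hy.2⟩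

theorem OneForm.SmoothOn.contDiffAt_rep {α : OneForm m M} {V : Set M} (hα : α.SmoothOn V)
    (hV : IsOpen V) (hqV : q ∈ V) (hq : q ∈ (extChartAt (𝓡 m) x).source) :
    ContDiffAt ℝ ∞ (α.rep x) (extChartAt (𝓡 m) x q) :=
  (hα x).contDiffAt (target_inter_preimage_mem_nhds (hV.mem_nhds hqV) hq)

variable [IsManifold (𝓡 m) ∞ M]

theorem chartDInv_chartD (hq : q ∈ (extChartAt (𝓡 m) x).source) (v : TangentSpace (𝓡 m) q) :
    chartDInv x q (chartD x q v) = v := by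
  have h := mfderivWithin_extChartAt_symm_comp_mfderiv_extChartAt' (I := 𝓡 m) hq
  rw [ModelWithCorners.range_eq_univ, mfderivWithin_univ] at h
  exact DFunLike.congr_fun h v

theorem chartD_chartDInv (hq : q ∈ (extChartAt (𝓡 m) x).source)
    (v : EuclideanSpace ℝ (Fin m)) : chartD x q (chartDInv x q v) = v := by
  have h := mfderiv_extChartAt_comp_mfderivWithin_extChartAt_symm' (I := 𝓡 m) hq
  rw [ModelWithCorners.range_eq_univ, mfderivWithin_univ] at h
  exact DFunLike.congr_fun h v

/-- The derivative of the chart at `x`, as an equivalence. -/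
def chartEquiv (hq : q ∈ (extChartAt (𝓡 m) x).source) :
    TangentSpace (𝓡 m) q ≃L[ℝ] EuclideanSpace ℝ (Fin m) :=
  ContinuousLinearEquiv.equivOfInverse (chartD x q) (chartDInv x q) (chartDInv_chartD hq)
    (chartD_chartDInv hq)

theorem coordField_coords (Y : VField m M) (hq : q ∈ (extChartAt (𝓡 m) x).source) :
    coordField x (Y.coords x q) q = Y q := chartDInv_chartD hq _

theorem coords_coordField (hq : q ∈ (extChartAt (𝓡 m) x).source)
    (v : EuclideanSpace ℝ (Fin m)) : (coordField x v).coords x q = v := chartD_chartDInv hq _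

theorem contMDiffAt_section_iff_coords (Y : VField m M) (hq : q ∈ (extChartAt (𝓡 m) x).source) :
    ContMDiffAt (𝓡 m) (𝓡 m).tangent ∞ (fun p => (⟨p, Y p⟩ : TangentBundle (𝓡 m) M)) q ↔
      ContMDiffAt (𝓡 m) 𝓘(ℝ, EuclideanSpace ℝ (Fin m)) ∞ (Y.coords x) q := by
  have hq' : q ∈ (chartAt (EuclideanSpace ℝ (Fin m)) x).source := by
    rwa [extChartAt_source] at hq
  rw [Bundle.Trivialization.contMDiffAt_section_iff (n := ∞)
    (trivializationAt (EuclideanSpace ℝ (Fin m)) (TangentSpace (𝓡 m)) x) (x₀ := q) (s := Y)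
    (by rwa [TangentBundle.trivializationAt_baseSet])]
  refine Filter.EventuallyEq.contMDiffAt_iff ?_
  filter_upwards [(chartAt (EuclideanSpace ℝ (Fin m)) x).open_source.mem_nhds hq'] with p hp
  refine Eq.trans ?_ (DFunLike.congr_fun
    (TangentBundle.continuousLinearMapAt_trivializationAt (𝕜 := ℝ) (I := 𝓡 m) hp) (Y p))
  rw [Bundle.Trivialization.continuousLinearMapAt_apply,
    Bundle.Trivialization.linearMapAt_apply, if_pos]
  rwa [TangentBundle.trivializationAt_baseSet]

theorem smoothOn_coordField (x : M) (v : EuclideanSpace ℝ (Fin m)) :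
    (coordField x v).SmoothOn (extChartAt (𝓡 m) x).source := by
  intro q hq
  refine ((contMDiffAt_section_iff_coords _ hq).2 ?_).contMDiffWithinAt
  refine (contMDiffAt_const (c := v)).congr_of_eventuallyEq ?_
  filter_upwards [(isOpen_extChartAt_source (I := 𝓡 m) x).mem_nhds hq] with p hp
  exact coords_coordField hp v

theorem VField.SmoothOn.contMDiffAt {Y : VField m M} {V : Set M} (h : Y.SmoothOn V) (hV : IsOpen V)
    {p : M} (hp : p ∈ V) :
    ContMDiffAt (𝓡 m) (𝓡 m).tangent ∞ (fun p => (⟨p, Y p⟩ : TangentBundle (𝓡 m) M)) p :=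
  ContMDiffOn.contMDiffAt h (hV.mem_nhds hp)

theorem VField.SmoothOn.contMDiffAt_coords {Y : VField m M} {V : Set M} (h : Y.SmoothOn V)
    (hV : IsOpen V) {p : M} (hp : p ∈ V) (hx : p ∈ (extChartAt (𝓡 m) x).source) :
    ContMDiffAt (𝓡 m) 𝓘(ℝ, EuclideanSpace ℝ (Fin m)) ∞ (Y.coords x) p :=
  (contMDiffAt_section_iff_coords _ hx).1 (h.contMDiffAt hV hp)

theorem contMDiffAt_symm_extChartAt {y : EuclideanSpace ℝ (Fin m)}
    (hy : y ∈ (extChartAt (𝓡 m) x).target) :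
    ContMDiffAt 𝓘(ℝ, EuclideanSpace ℝ (Fin m)) (𝓡 m) ∞ (extChartAt (𝓡 m) x).symm y :=
  (contMDiffOn_extChartAt_symm x).contMDiffAt ((isOpen_extChartAt_target x).mem_nhds hy)

theorem contDiffAt_comp_extChartAt_symm {F : Type*} [NormedAddCommGroup F] [NormedSpace ℝ F]
    {g : M → F} (hq : q ∈ (extChartAt (𝓡 m) x).source) (hg : ContMDiffAt (𝓡 m) 𝓘(ℝ, F) ∞ g q) :
    ContDiffAt ℝ ∞ (g ∘ (extChartAt (𝓡 m) x).symm) (extChartAt (𝓡 m) x q) := by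
  rw [← contMDiffAt_iff_contDiffAt]
  refine ContMDiffAt.comp _ ?_
    (contMDiffAt_symm_extChartAt ((extChartAt (𝓡 m) x).map_source hq))
  rwa [(extChartAt (𝓡 m) x).left_inv hq]

theorem contMDiffAt_comp_extChartAt {F : Type*} [NormedAddCommGroup F] [NormedSpace ℝ F]
    {g : EuclideanSpace ℝ (Fin m) → F} (hq : q ∈ (extChartAt (𝓡 m) x).source)
    (hg : ContDiffAt ℝ ∞ g (extChartAt (𝓡 m) x q)) :
    ContMDiffAt (𝓡 m) 𝓘(ℝ, F) ∞ (g ∘ extChartAt (𝓡 m) x) q :=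
  ContMDiffAt.comp q (contMDiffAt_iff_contDiffAt.2 hg)
    (contMDiffAt_extChartAt' (by rwa [extChartAt_source] at hq))

theorem OneForm.rep_apply_coords (α : OneForm m M) (Y : VField m M)
    (hq : q ∈ (extChartAt (𝓡 m) x).source) :
    α.rep x (extChartAt (𝓡 m) x q) (Y.coords x q) = α q (Y q) := by
  rw [α.rep_extChartAt hq, coordField_coords Y hq]

theorem OneForm.SmoothOn.apply {α : OneForm m M} {Y : VField m M} {V : Set M}
    (hα : α.SmoothOn V) (hY : Y.SmoothOn V) (hV : IsOpen V) :
    SmoothFunOn (m := m) V (fun p => α p (Y p)) := by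
  intro p hp
  have hps := mem_extChartAt_source (I := 𝓡 m) p
  have hrep := contMDiffAt_comp_extChartAt hps (hα.contDiffAt_rep hV hp hps)
  have hcoords := hY.contMDiffAt_coords hV hp hps
  refine ((hrep.clm_apply hcoords).congr_of_eventuallyEq ?_).contMDiffWithinAt
  filter_upwards [extChartAt_source_mem_nhds (I := 𝓡 m) p] with q hq
  exact (α.rep_apply_coords Y hq).symm

theorem OneForm.smoothOn_of_apply {α : OneForm m M} {V : Set M} (hV : IsOpen V)
    (h : ∀ (Z : VField m M) (W : Set M), IsOpen W → W ⊆ V → Z.SmoothOn W →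
      SmoothFunOn (m := m) W (fun p => α p (Z p))) : α.SmoothOn V := by
  intro x
  rw [contDiffOn_clm_apply]
  rintro v y ⟨hy, hyV⟩
  let q := (extChartAt (𝓡 m) x).symm y
  have hqs : q ∈ (extChartAt (𝓡 m) x).source := (extChartAt (𝓡 m) x).map_target hy
  have hyq : extChartAt (𝓡 m) x q = y := (extChartAt (𝓡 m) x).right_inv hy
  have hopen : IsOpen (V ∩ (extChartAt (𝓡 m) x).source) := hV.inter (isOpen_extChartAt_source x)
  have hsmooth := (h (coordField x v) _ hopen Set.inter_subset_left
    ((smoothOn_coordField x v).mono Set.inter_subset_right)).contMDiffAt hopen ⟨hyV, hqs⟩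
  have hcomp := contDiffAt_comp_extChartAt_symm hqs hsmooth
  rw [hyq] at hcomp
  refine (hcomp.congr_of_eventuallyEq ?_).contDiffWithinAt
  filter_upwards [extChartAt_target_mem_nhds' hy] with z hz
  have hrep := α.rep_extChartAt ((extChartAt (𝓡 m) x).map_target hz) v
  rwa [(extChartAt (𝓡 m) x).right_inv hz] at hrep

end Charts

section Calculus

variable {m : ℕ} {M : Type*} [TopologicalSpace M] [ChartedSpace (EuclideanSpace ℝ (Fin m)) M]
  {x q : M}

theorem minSmoothness_two_le_infty : minSmoothness ℝ 2 ≤ ∞ := by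
  rw [minSmoothness_of_isRCLikeNormedField]
  exact ENat.LEInfty.out

/-- The coordinates of a vector field in the chart at `x`, as a function on the chart target. -/
def VField.rep (Y : VField m M) (x : M) : EuclideanSpace ℝ (Fin m) → EuclideanSpace ℝ (Fin m) :=
  Y.coords x ∘ (extChartAt (𝓡 m) x).symm

theorem VField.rep_extChartAt (Y : VField m M) (hq : q ∈ (extChartAt (𝓡 m) x).source) :
    Y.rep x (extChartAt (𝓡 m) x q) = chartD x q (Y q) := by
  rw [VField.rep, Function.comp_apply, (extChartAt (𝓡 m) x).left_inv hq]
  rfl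

theorem extd_apply (α : OneForm m M) (p : M) (u v : TangentSpace (𝓡 m) p) :
    α.extd p u v = fderiv ℝ (α.rep p) (extChartAt (𝓡 m) p p) (chartD p p u) (chartD p p v) -
      fderiv ℝ (α.rep p) (extChartAt (𝓡 m) p p) (chartD p p v) (chartD p p u) := rfl

variable [IsManifold (𝓡 m) ∞ M]

theorem isManifold_minSmoothness (k : ℕ) : IsManifold (𝓡 m) (minSmoothness ℝ k) M := by
  rw [minSmoothness_of_isRCLikeNormedField]
  exact IsManifold.of_le (n := ∞) (by exact_mod_cast le_top)

theorem VField.SmoothOn.contDiffAt_rep {Y : VField m M} {V : Set M} (h : Y.SmoothOn V)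
    (hV : IsOpen V) {p : M} (hp : p ∈ V) (hx : p ∈ (extChartAt (𝓡 m) x).source) :
    ContDiffAt ℝ ∞ (Y.rep x) (extChartAt (𝓡 m) x p) :=
  contDiffAt_comp_extChartAt_symm hx (h.contMDiffAt_coords hV hp hx)

theorem OneForm.rep_apply_rep (α : OneForm m M) (Y : VField m M) {y : EuclideanSpace ℝ (Fin m)}
    (hy : y ∈ (extChartAt (𝓡 m) x).target) :
    α.rep x y (Y.rep x y) = α ((extChartAt (𝓡 m) x).symm y) (Y ((extChartAt (𝓡 m) x).symm y)) := by
  have h := α.rep_apply_coords Y ((extChartAt (𝓡 m) x).map_target hy)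
  rwa [(extChartAt (𝓡 m) x).right_inv hy] at h

theorem mpullback_extChartAt_symm_eq_rep (Z : VField m M) {y : EuclideanSpace ℝ (Fin m)}
    (hy : y ∈ (extChartAt (𝓡 m) x).target) :
    VectorField.mpullback 𝓘(ℝ, EuclideanSpace ℝ (Fin m)) (𝓡 m) (extChartAt (𝓡 m) x).symm Z y =
      Z.rep x y := by
  have hleft := mfderivWithin_extChartAt_symm_comp_mfderiv_extChartAt (I := 𝓡 m) hy
  have hright := mfderiv_extChartAt_comp_mfderivWithin_extChartAt_symm (I := 𝓡 m) hy
  rw [ModelWithCorners.range_eq_univ, mfderivWithin_univ] at hleft hright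
  rw [VectorField.mpullback_apply, ContinuousLinearMap.inverse_eq hleft hright]
  rfl

theorem mpullback_extChartAt_symm_eventuallyEq_rep (Z : VField m M)
    (hq : q ∈ (extChartAt (𝓡 m) x).source) :
    VectorField.mpullback 𝓘(ℝ, EuclideanSpace ℝ (Fin m)) (𝓡 m) (extChartAt (𝓡 m) x).symm Z
      =ᶠ[𝓝 (extChartAt (𝓡 m) x q)] Z.rep x := by
  filter_upwards [extChartAt_target_mem_nhds' ((extChartAt (𝓡 m) x).map_source hq)] with y hy
  exact mpullback_extChartAt_symm_eq_rep Z hy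

theorem chartD_mlieBracket {X Y : VField m M} {V : Set M} (hV : IsOpen V) (hX : X.SmoothOn V)
    (hY : Y.SmoothOn V) (hqV : q ∈ V) (hq : q ∈ (extChartAt (𝓡 m) x).source) :
    chartD x q (VectorField.mlieBracket (𝓡 m) X Y q) =
      fderiv ℝ (Y.rep x) (extChartAt (𝓡 m) x q) (X.rep x (extChartAt (𝓡 m) x q)) -
      fderiv ℝ (X.rep x) (extChartAt (𝓡 m) x q) (Y.rep x (extChartAt (𝓡 m) x q)) := by
  have hM : IsManifold (𝓡 m) (minSmoothness ℝ 2) M := isManifold_minSmoothness 2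
  let y := extChartAt (𝓡 m) x q
  have hy : y ∈ (extChartAt (𝓡 m) x).target := (extChartAt (𝓡 m) x).map_source hq
  have hdiff : ∀ Z : VField m M, Z.SmoothOn V → MDifferentiableAt (𝓡 m) (𝓡 m).tangent
      (fun p => (⟨p, Z p⟩ : TangentBundle (𝓡 m) M)) ((extChartAt (𝓡 m) x).symm y) := by
    intro Z hZ
    rw [(extChartAt (𝓡 m) x).left_inv hq]
    exact (hZ.contMDiffAt hV hqV).mdifferentiableAt (by simp)
  have hpullback := VectorField.mpullback_mlieBracket (n := ∞) (hdiff X hX) (hdiff Y hY)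
    (contMDiffAt_symm_extChartAt hy) minSmoothness_two_le_infty
  rw [mpullback_extChartAt_symm_eq_rep _ hy, VField.rep_extChartAt _ hq] at hpullback
  have hrep := (mpullback_extChartAt_symm_eventuallyEq_rep X hq).mlieBracket_vectorField_eq
    (mpullback_extChartAt_symm_eventuallyEq_rep Y hq)
  have hflat : VectorField.mlieBracket 𝓘(ℝ, EuclideanSpace ℝ (Fin m)) (X.rep x) (Y.rep x) =
      VectorField.lieBracket ℝ (X.rep x) (Y.rep x) :=
    (VectorField.mlieBracketWithin_eq_lieBracketWithin (V := X.rep x) (W := Y.rep x)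
      (s := Set.univ)).trans VectorField.lieBracketWithin_univ
  exact (hpullback.trans hrep).trans (congrFun hflat y)

theorem VField.SmoothOn.mlieBracket {X Y : VField m M} {V : Set M} (hV : IsOpen V)
    (hX : X.SmoothOn V) (hY : Y.SmoothOn V) :
    VField.SmoothOn V (VectorField.mlieBracket (𝓡 m) X Y) := by
  intro p hp
  have hM : IsManifold (𝓡 m) (minSmoothness ℝ 2) M := isManifold_minSmoothness 2
  have : IsManifold (𝓡 m) ((⊤ : ℕ∞) + 1) M := by
    rw [show (((⊤ : ℕ∞) : WithTop ℕ∞) + 1) = ∞ from rfl]; infer_instance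
  exact (ContMDiffAt.mlieBracket_vectorField (m := ⊤) (n := ⊤) (hX.contMDiffAt hV hp)
    (hY.contMDiffAt hV hp) (by simp)).contMDiffWithinAt

theorem diff_apply_eq_fderiv {f : M → ℝ} (hf : ContMDiffAt (𝓡 m) 𝓘(ℝ, ℝ) ∞ f q)
    (hq : q ∈ (extChartAt (𝓡 m) x).source) (v : TangentSpace (𝓡 m) q) :
    diff (m := m) f q v =
      fderiv ℝ (f ∘ (extChartAt (𝓡 m) x).symm) (extChartAt (𝓡 m) x q) (chartD x q v) := by
  have hrep := (contDiffAt_comp_extChartAt_symm hq hf).differentiableAt (by simp)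
  have hchart : MDifferentiableAt (𝓡 m) 𝓘(ℝ, EuclideanSpace ℝ (Fin m)) (extChartAt (𝓡 m) x) q :=
    mdifferentiableAt_extChartAt (by rwa [extChartAt_source] at hq)
  have hcomp := hrep.hasFDerivAt.hasMFDerivAt.comp q hchart.hasMFDerivAt
  have hf' : HasMFDerivAt (𝓡 m) 𝓘(ℝ, ℝ) f q _ := hcomp.congr_of_eventuallyEq (by
    filter_upwards [extChartAt_source_mem_nhds' hq] with p hp
    simp only [Function.comp_apply, (extChartAt (𝓡 m) x).left_inv hp])
  exact DFunLike.congr_fun hf'.mfderiv v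

theorem diff_rep_eventuallyEq {f : M → ℝ} {V : Set M} (hV : IsOpen V)
    (hf : SmoothFunOn (m := m) V f) (hqV : q ∈ V) (hq : q ∈ (extChartAt (𝓡 m) x).source) :
    (diff f).rep x =ᶠ[𝓝 (extChartAt (𝓡 m) x q)] fderiv ℝ (f ∘ (extChartAt (𝓡 m) x).symm) := by
  filter_upwards [target_inter_preimage_mem_nhds (hV.mem_nhds hqV) hq] with y hy
  have hys := (extChartAt (𝓡 m) x).map_target hy.1
  refine ContinuousLinearMap.ext fun v => ?_
  have hrep := (diff f).rep_extChartAt hys v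
  have hcoord : chartD x _ (coordField x v ((extChartAt (𝓡 m) x).symm y)) = v :=
    coords_coordField hys v
  rwa [diff_apply_eq_fderiv (hf.contMDiffAt hV hy.2) hys, (extChartAt (𝓡 m) x).right_inv hy.1,
    hcoord] at hrep

theorem SmoothFunOn.diff {f : M → ℝ} {V : Set M} (hV : IsOpen V)
    (hf : SmoothFunOn (m := m) V f) : (diff (m := m) f).SmoothOn V := by
  rintro x y ⟨hy, hyV⟩
  have hys := (extChartAt (𝓡 m) x).map_target hy
  have hrep := diff_rep_eventuallyEq hV hf hyV hys
  have hsmooth := contDiffAt_comp_extChartAt_symm hys (hf.contMDiffAt hV hyV)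
  rw [(extChartAt (𝓡 m) x).right_inv hy] at hrep hsmooth
  exact ((hsmooth.fderiv_right (m := ∞) (by simp)).congr_of_eventuallyEq hrep).contDiffWithinAt

theorem diff_oneForm_apply_eq {α : OneForm m M} {Y Z : VField m M} {V : Set M} (hV : IsOpen V)
    (hα : α.SmoothOn V) (hY : Y.SmoothOn V) (hqV : q ∈ V) (hq : q ∈ (extChartAt (𝓡 m) x).source) :
    diff (m := m) (fun p => α p (Y p)) q (Z q) =
      fderiv ℝ (α.rep x) (extChartAt (𝓡 m) x q) (chartD x q (Z q)) (chartD x q (Y q)) +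
        α.rep x (extChartAt (𝓡 m) x q)
          (fderiv ℝ (Y.rep x) (extChartAt (𝓡 m) x q) (chartD x q (Z q))) := by
  have hrep : (fun p => α p (Y p)) ∘ (extChartAt (𝓡 m) x).symm =ᶠ[𝓝 (extChartAt (𝓡 m) x q)]
      fun y => α.rep x y (Y.rep x y) := by
    filter_upwards [extChartAt_target_mem_nhds' ((extChartAt (𝓡 m) x).map_source hq)] with y hy
    exact (α.rep_apply_rep Y hy).symm
  have hderiv := ((hα.contDiffAt_rep hV hqV hq).differentiableAt (by simp)).hasFDerivAt.clm_apply
    ((hY.contDiffAt_rep hV hqV hq).differentiableAt (by simp)).hasFDerivAt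
  rw [diff_apply_eq_fderiv ((hα.apply hY hV).contMDiffAt hV hqV) hq, hrep.fderiv_eq,
    hderiv.fderiv, ← Y.rep_extChartAt hq, add_comm]
  rfl

theorem diff_sub_diff_sub_apply_mlieBracket {α : OneForm m M} {X Y : VField m M} {V : Set M}
    (hV : IsOpen V) (hα : α.SmoothOn V) (hX : X.SmoothOn V) (hY : Y.SmoothOn V) (hqV : q ∈ V)
    (hq : q ∈ (extChartAt (𝓡 m) x).source) :
    diff (m := m) (fun p => α p (Y p)) q (X q) - diff (m := m) (fun p => α p (X p)) q (Y q) -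
        α q (VectorField.mlieBracket (𝓡 m) X Y q) =
      fderiv ℝ (α.rep x) (extChartAt (𝓡 m) x q) (chartD x q (X q)) (chartD x q (Y q)) -
        fderiv ℝ (α.rep x) (extChartAt (𝓡 m) x q) (chartD x q (Y q)) (chartD x q (X q)) := by
  have hbracket : α q (VectorField.mlieBracket (𝓡 m) X Y q) =
      α.rep x (extChartAt (𝓡 m) x q) (chartD x q (VectorField.mlieBracket (𝓡 m) X Y q)) :=
    (α.rep_apply_coords _ hq).symm
  rw [diff_oneForm_apply_eq hV hα hY hqV hq, diff_oneForm_apply_eq hV hα hX hqV hq, hbracket,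
    chartD_mlieBracket hV hX hY hqV hq, map_sub, ← VField.rep_extChartAt _ hq,
    ← VField.rep_extChartAt _ hq]
  abel

theorem extd_apply_eq_sub_mlieBracket {α : OneForm m M} {X Y : VField m M} {V : Set M}
    (hV : IsOpen V) (hα : α.SmoothOn V) (hX : X.SmoothOn V) (hY : Y.SmoothOn V) {p : M}
    (hp : p ∈ V) :
    α.extd p (X p) (Y p) = diff (m := m) (fun q => α q (Y q)) p (X p) -
      diff (m := m) (fun q => α q (X q)) p (Y p) - α p (VectorField.mlieBracket (𝓡 m) X Y p) :=
  (diff_sub_diff_sub_apply_mlieBracket hV hα hX hY hp (mem_extChartAt_source p)).symm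

theorem extd_apply_of_mem_source {α : OneForm m M} {V : Set M} (hV : IsOpen V)
    (hα : α.SmoothOn V) (hqV : q ∈ V) (hq : q ∈ (extChartAt (𝓡 m) x).source)
    (u v : TangentSpace (𝓡 m) q) :
    α.extd q u v =
      fderiv ℝ (α.rep x) (extChartAt (𝓡 m) x q) (chartD x q u) (chartD x q v) -
        fderiv ℝ (α.rep x) (extChartAt (𝓡 m) x q) (chartD x q v) (chartD x q u) := by
  let W := V ∩ (extChartAt (𝓡 m) x).source
  have hW : IsOpen W := hV.inter (isOpen_extChartAt_source x)
  have hαW : α.SmoothOn W := hα.mono Set.inter_subset_left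
  have hcoord : ∀ a, (coordField x a).SmoothOn W := fun a =>
    (smoothOn_coordField x a).mono Set.inter_subset_right
  have hvalue : ∀ a, coordField x (chartD x q a) q = a := chartDInv_chartD hq
  have hextd := (extd_apply_eq_sub_mlieBracket hW hαW (hcoord (chartD x q u))
    (hcoord (chartD x q v)) ⟨hqV, hq⟩).trans (diff_sub_diff_sub_apply_mlieBracket hW hαW
      (hcoord (chartD x q u)) (hcoord (chartD x q v)) ⟨hqV, hq⟩ hq)
  rwa [hvalue, hvalue] at hextd

theorem extd_diff {f : M → ℝ} {V : Set M} (hV : IsOpen V) (hf : SmoothFunOn (m := m) V f)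
    {p : M} (hp : p ∈ V) (u v : TangentSpace (𝓡 m) p) : (diff (m := m) f).extd p u v = 0 := by
  have hps := mem_extChartAt_source (I := 𝓡 m) p
  rw [extd_apply, (diff_rep_eventuallyEq hV hf hp hps).fderiv_eq, sub_eq_zero]
  exact (contDiffAt_comp_extChartAt_symm hps (hf.contMDiffAt hV hp)).isSymmSndFDerivAt
    minSmoothness_two_le_infty _ _

theorem diff_mlieBracket {f : M → ℝ} {X Y : VField m M} {V : Set M} (hV : IsOpen V)
    (hf : SmoothFunOn (m := m) V f) (hX : X.SmoothOn V) (hY : Y.SmoothOn V) {p : M} (hp : p ∈ V) :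
    diff (m := m) f p (VectorField.mlieBracket (𝓡 m) X Y p) =
      diff (m := m) (fun q => diff (m := m) f q (Y q)) p (X p) -
      diff (m := m) (fun q => diff (m := m) f q (X q)) p (Y p) := by
  have hextd := extd_apply_eq_sub_mlieBracket hV (hf.diff hV) hX hY hp
  rw [extd_diff hV hf hp] at hextd
  linarith

end Calculus

section Frames

theorem isInvertible_of_injective {E F : Type*} [AddCommGroup E] [Module ℝ E]
    [TopologicalSpace E] [IsTopologicalAddGroup E] [ContinuousSMul ℝ E] [T2Space E]
    [FiniteDimensional ℝ E] [AddCommGroup F] [Module ℝ F] [TopologicalSpace F]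
    [IsTopologicalAddGroup F] [ContinuousSMul ℝ F] [T2Space F] [FiniteDimensional ℝ F]
    {L : E →L[ℝ] F} (hL : Function.Injective L)
    (h : Module.finrank ℝ E = Module.finrank ℝ F) : L.IsInvertible :=
  ⟨(L.toLinearMap.linearEquivOfInjective hL h).toContinuousLinearEquiv,
    ContinuousLinearMap.ext fun _ => rfl⟩

theorem contDiffAt_of_clm_apply_eq {X E F : Type*} [NormedAddCommGroup X] [NormedSpace ℝ X]
    [NormedAddCommGroup E] [NormedSpace ℝ E] [CompleteSpace E] [NormedAddCommGroup F]
    [NormedSpace ℝ F] {A : X → E →L[ℝ] F} {u : X → E} {g : X → F} {x : X} {n : ℕ∞ω}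
    (hA : ContDiffAt ℝ n A x) (hinv : (A x).IsInvertible) (hg : ContDiffAt ℝ n g x)
    (hu : ∀ᶠ y in 𝓝 x, A y (u y) = g y) : ContDiffAt ℝ n u x := by
  refine ((contDiffAt_clm_inverse hA hinv).clm_apply hg).congr_of_eventuallyEq ?_
  filter_upwards [hu, eventually_isInvertible hA.continuousAt hinv] with y huy hinvy
  rw [← huy, hinvy.inverse_apply_self]

theorem contDiffAt_clm_pi {X E ι : Type*} [NormedAddCommGroup X] [NormedSpace ℝ X]
    [NormedAddCommGroup E] [NormedSpace ℝ E] [Fintype ι] {A : ι → X → E →L[ℝ] ℝ} {x : X} {n : ℕ∞ω}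
    (hA : ∀ i, ContDiffAt ℝ n (A i) x) :
    ContDiffAt ℝ n (fun y => ContinuousLinearMap.pi fun i => A i y) x := by
  classical
  have hsum : (fun y => ContinuousLinearMap.pi fun i => A i y) =
      fun y => ∑ i, ContinuousLinearMap.single ℝ (fun _ : ι => ℝ) i ∘L A i y := by
    funext y
    ext v j
    simp [Finset.sum_apply, Pi.single_apply]
  rw [hsum]
  exact ContDiffAt.sum fun i _ => contDiffAt_const.clm_comp (hA i)

variable {m : ℕ}

theorem contDiffAt_basis_det {y₀ : EuclideanSpace ℝ (Fin m)} {n : ℕ∞ω}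
    {v : Fin m → EuclideanSpace ℝ (Fin m) → EuclideanSpace ℝ (Fin m)}
    (hv : ∀ i, ContDiffAt ℝ n (v i) y₀) :
    ContDiffAt ℝ n (fun y => (EuclideanSpace.basisFun (Fin m) ℝ).toBasis.det fun i => v i y)
      y₀ := by
  simp only [Module.Basis.det_apply, Matrix.det_apply]
  refine ContDiffAt.sum fun σ _ => ContDiffAt.const_smul _ (contDiffAt_prod fun i _ => ?_)
  exact (EuclideanSpace.proj (𝕜 := ℝ) (σ i)).contDiff.contDiffAt.comp y₀ (hv i)

variable {M : Type*} [TopologicalSpace M] [ChartedSpace (EuclideanSpace ℝ (Fin m)) M] {x q : M}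

instance (p : M) : T2Space (TangentSpace (𝓡 m) p) :=
  inferInstanceAs (T2Space (EuclideanSpace ℝ (Fin m)))

instance (p : M) : FiniteDimensional ℝ (TangentSpace (𝓡 m) p) :=
  inferInstanceAs (FiniteDimensional ℝ (EuclideanSpace ℝ (Fin m)))

theorem finrank_tangentSpace (p : M) : Module.finrank ℝ (TangentSpace (𝓡 m) p) = m :=
  finrank_euclideanSpace_fin (𝕜 := ℝ) (n := m)

/-- The map from coefficients to linear combinations of the fields `e i` at `p`. -/
def frameMap (e : Fin m → VField m M) (p : M) : (Fin m → ℝ) →L[ℝ] TangentSpace (𝓡 m) p :=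
  LinearMap.toContinuousLinearMap (Fintype.linearCombination ℝ fun i => e i p)

theorem frameMap_apply (e : Fin m → VField m M) (p : M) (a : Fin m → ℝ) :
    frameMap e p a = ∑ i, a i • e i p := rfl

/-- The coframe dual to the frame `e`; it is zero at the points where the fields `e i` are
dependent. -/
def dualForm (e : Fin m → VField m M) (i : Fin m) : OneForm m M := fun p =>
  ContinuousLinearMap.proj (R := ℝ) (φ := fun _ : Fin m => ℝ) i ∘L (frameMap e p).inverse

theorem frameMap_isInvertible {e : Fin m → VField m M} {p : M}
    (he : LinearIndependent ℝ fun i => e i p) : (frameMap e p).IsInvertible :=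
  isInvertible_of_injective he.fintypeLinearCombination_injective (by
    rw [finrank_tangentSpace, Module.finrank_fin_fun])

theorem sum_dualForm {e : Fin m → VField m M} {p : M}
    (he : LinearIndependent ℝ fun i => e i p) (v : TangentSpace (𝓡 m) p) :
    ∑ i, dualForm e i p v • e i p = v :=
  (frameMap_isInvertible he).self_apply_inverse v

theorem dualForm_apply {e : Fin m → VField m M} {p : M}
    (he : LinearIndependent ℝ fun i => e i p) (i j : Fin m) :
    dualForm e i p (e j p) = if i = j then 1 else 0 := by
  have hsingle : frameMap e p (Pi.single j 1) = e j p :=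
    (Fintype.linearCombination_apply_single ℝ _ j 1).trans (one_smul ℝ _)
  change (frameMap e p).inverse (e j p) i = _
  rw [← hsingle, (frameMap_isInvertible he).inverse_apply_self, Pi.single_apply]

theorem TopForm.rep_extChartAt (Ω : TopForm m M) (hq : q ∈ (extChartAt (𝓡 m) x).source)
    (v : Fin m → EuclideanSpace ℝ (Fin m)) :
    Ω.rep x (extChartAt (𝓡 m) x q) v = Ω q fun i => coordField x (v i) q := by
  have : ∀ q', q' = q → Ω q' (fun i => mfderiv 𝓘(ℝ, EuclideanSpace ℝ (Fin m)) (𝓡 m)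
      (extChartAt (𝓡 m) x).symm (extChartAt (𝓡 m) x q) (v i)) =
        Ω q fun i => coordField x (v i) q := by
    rintro _ rfl; rfl
  exact this _ ((extChartAt (𝓡 m) x).left_inv hq)

variable [IsManifold (𝓡 m) ∞ M]

theorem VField.smoothOn_of_contDiffAt_rep {Z : VField m M} {V : Set M}
    (h : ∀ p ∈ V, ContDiffAt ℝ ∞ (Z.rep p) (extChartAt (𝓡 m) p p)) : Z.SmoothOn V := by
  intro p hp
  have hps := mem_extChartAt_source (I := 𝓡 m) p
  refine ((contMDiffAt_section_iff_coords _ hps).2 ?_).contMDiffWithinAt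
  refine (contMDiffAt_comp_extChartAt hps (h p hp)).congr_of_eventuallyEq ?_
  filter_upwards [extChartAt_source_mem_nhds (I := 𝓡 m) p] with q hq
  exact (Z.rep_extChartAt hq).symm

theorem VField.smoothOn_of_coframe {β : Fin m → OneForm m M} {Z : VField m M} {V : Set M}
    (hV : IsOpen V) (hβ : ∀ i, (β i).SmoothOn V)
    (hinj : ∀ p ∈ V, ∀ v, (∀ i, β i p v = 0) → v = 0)
    (hZ : ∀ i, SmoothFunOn (m := m) V fun p => β i p (Z p)) : Z.SmoothOn V := by
  refine VField.smoothOn_of_contDiffAt_rep fun p hp => ?_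
  have hps := mem_extChartAt_source (I := 𝓡 m) p
  refine contDiffAt_of_clm_apply_eq
    (A := fun y => ContinuousLinearMap.pi fun i => (β i).rep p y)
    (g := fun y i => ((fun p => β i p (Z p)) ∘ (extChartAt (𝓡 m) p).symm) y)
    (contDiffAt_clm_pi fun i => (hβ i).contDiffAt_rep hV hp hps) ?_
    (contDiffAt_pi.2 fun i => contDiffAt_comp_extChartAt_symm hps ((hZ i).contMDiffAt hV hp)) ?_
  · refine isInvertible_of_injective ((injective_iff_map_eq_zero _).2 fun v hv => ?_) (by simp)
    have hcoord : coordField p v p = 0 := hinj p hp _ fun i => by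
      rw [← (β i).rep_extChartAt hps]
      exact congrFun hv i
    rw [← coords_coordField hps v, VField.coords, hcoord, map_zero]
  · filter_upwards [extChartAt_target_mem_nhds (I := 𝓡 m) p] with y hy
    exact funext fun i => (β i).rep_apply_rep Z hy

theorem smoothOn_dualForm {e : Fin m → VField m M} {V : Set M} (hV : IsOpen V)
    (he : ∀ i, (e i).SmoothOn V) (hind : ∀ p ∈ V, LinearIndependent ℝ fun i => e i p)
    (i : Fin m) : (dualForm e i).SmoothOn V := by
  refine OneForm.smoothOn_of_apply hV fun Z W hW hWV hZ p hp => ?_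
  have hps := mem_extChartAt_source (I := 𝓡 m) p
  let A (y : EuclideanSpace ℝ (Fin m)) : (Fin m → ℝ) →L[ℝ] EuclideanSpace ℝ (Fin m) :=
    ∑ i, (ContinuousLinearMap.proj (R := ℝ) (φ := fun _ : Fin m => ℝ) i).smulRight ((e i).rep p y)
  let coeff (q : M) : Fin m → ℝ := (frameMap e q).inverse (Z q)
  have hA : ∀ y, A y = chartD p ((extChartAt (𝓡 m) p).symm y) ∘L
      frameMap e ((extChartAt (𝓡 m) p).symm y) := fun y => ContinuousLinearMap.ext fun a => by
    simp only [A, sum_apply, ContinuousLinearMap.smulRight_apply, ContinuousLinearMap.proj_apply,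
      ContinuousLinearMap.comp_apply, frameMap_apply, map_sum, map_smul]
    rfl
  have hcoeff : ContDiffAt ℝ ∞ (coeff ∘ (extChartAt (𝓡 m) p).symm) (extChartAt (𝓡 m) p p) := by
    refine contDiffAt_of_clm_apply_eq (A := A) (g := Z.rep p)
      (ContDiffAt.sum fun i _ => contDiffAt_const.smulRight
        ((he i).contDiffAt_rep hV (hWV hp) hps)) ?_ (hZ.contDiffAt_rep hW hp hps) ?_
    · rw [hA, (extChartAt (𝓡 m) p).left_inv hps]
      exact ContinuousLinearMap.IsInvertible.comp ⟨chartEquiv hps, rfl⟩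
        (frameMap_isInvertible (hind p (hWV hp)))
    · filter_upwards [target_inter_preimage_mem_nhds (hV.mem_nhds (hWV hp)) hps] with y hy
      rw [hA]
      exact congrArg _ ((frameMap_isInvertible (hind _ hy.2)).self_apply_inverse _)
  refine ((contMDiffAt_comp_extChartAt hps (contDiffAt_pi.1 hcoeff i)).congr_of_eventuallyEq
    ?_).contMDiffWithinAt
  filter_upwards [extChartAt_source_mem_nhds (I := 𝓡 m) p] with q hq
  simp only [Function.comp_apply, (extChartAt (𝓡 m) p).left_inv hq]
  rfl

theorem TopForm.IsVolumeOn.smoothFunOn_apply {Ω : TopForm m M} {V : Set M} (hV : IsOpen V)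
    (hΩ : Ω.IsVolumeOn V) {Y : Fin m → VField m M} (hY : ∀ i, (Y i).SmoothOn V) :
    SmoothFunOn (m := m) V fun p => Ω p fun i => Y i p := by
  intro p hp
  have hps := mem_extChartAt_source (I := 𝓡 m) p
  let b := (EuclideanSpace.basisFun (Fin m) ℝ).toBasis
  have hrep : ContDiffAt ℝ ∞ (Ω.rep p) (extChartAt (𝓡 m) p p) :=
    (hΩ.smooth p).contDiffAt (target_inter_preimage_mem_nhds (hV.mem_nhds hp) hps)
  have hbasis : ContDiffAt ℝ ∞ (fun y => Ω.rep p y b) (extChartAt (𝓡 m) p p) :=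
    (ContinuousAlternatingMap.apply ℝ (EuclideanSpace ℝ (Fin m)) ℝ b).contDiff.contDiffAt.comp
      _ hrep
  have hdet := hbasis.mul (contDiffAt_basis_det fun i => (hY i).contDiffAt_rep hV hp hps)
  refine ((contMDiffAt_comp_extChartAt hps hdet).congr_of_eventuallyEq ?_).contMDiffWithinAt
  filter_upwards [extChartAt_source_mem_nhds (I := 𝓡 m) p] with q hq
  have hcoord : ∀ i, coordField p ((Y i).rep p (extChartAt (𝓡 m) p q)) q = Y i q := fun i => by
    rw [VField.rep_extChartAt _ hq]
    exact coordField_coords _ hq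
  have hΩq := Ω.rep_extChartAt hq fun i => (Y i).rep p (extChartAt (𝓡 m) p q)
  simp only [hcoord] at hΩq
  rw [← hΩq]
  exact DFunLike.congr_fun
    ((Ω.rep p (extChartAt (𝓡 m) p q)).toAlternatingMap.eq_smul_basis_det b) _

end Frames

/-! ### Flags of involutive distributions spanned by a frame -/

section Flags

variable {m : ℕ} {M : Type*} [TopologicalSpace M] [ChartedSpace (EuclideanSpace ℝ (Fin m)) M]

theorem diff_congr {f g : M → ℝ} {V : Set M} (hV : IsOpen V) (hfg : ∀ q ∈ V, f q = g q) {p : M}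
    (hp : p ∈ V) : diff (m := m) f p = diff (m := m) g p :=
  Filter.EventuallyEq.mfderiv_eq (Filter.eventually_of_mem (hV.mem_nhds hp) hfg)

theorem diff_eq_zero_of_eqOn {f : M → ℝ} {V : Set M} (hV : IsOpen V) {c : ℝ}
    (hf : ∀ q ∈ V, f q = c) {p : M} (hp : p ∈ V) (v : TangentSpace (𝓡 m) p) :
    diff (m := m) f p v = 0 := by
  rw [diff_congr hV hf hp, diff, mfderiv_const]
  rfl

theorem dualForm_eq_zero_of_mem_span {e : Fin m → VField m M} {p : M}
    (he : LinearIndependent ℝ fun i => e i p) {ι : Type*} {Y : ι → TangentSpace (𝓡 m) p}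
    {c : Fin m} (hY : ∀ i, ∃ a, a ≠ c ∧ Y i = e a p) {v : TangentSpace (𝓡 m) p}
    (hv : v ∈ Submodule.span ℝ (Set.range Y)) : dualForm e c p v = 0 := by
  have hspan : Submodule.span ℝ (Set.range Y) ≤ LinearMap.ker (dualForm e c p).toLinearMap := by
    rw [Submodule.span_le]
    rintro _ ⟨i, rfl⟩
    obtain ⟨a, hac, ha⟩ := hY i
    change dualForm e c p (Y i) = 0
    rw [ha, dualForm_apply he, if_neg hac.symm]
  exact hspan hv

variable [IsManifold (𝓡 m) ∞ M]

theorem OneForm.SmoothOn.extd_apply {w : OneForm m M} {X Y : VField m M} {V : Set M}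
    (hw : w.SmoothOn V) (hX : X.SmoothOn V) (hY : Y.SmoothOn V) (hV : IsOpen V) :
    SmoothFunOn (m := m) V fun p => w.extd p (X p) (Y p) := by
  have hXY := (SmoothFunOn.diff hV (hw.apply hY hV)).apply hX hV
  have hYX := (SmoothFunOn.diff hV (hw.apply hX hV)).apply hY hV
  have hbracket := hw.apply (VField.SmoothOn.mlieBracket hV hX hY) hV
  exact ((ContMDiffOn.sub hXY hYX).sub hbracket).congr fun p hp =>
    extd_apply_eq_sub_mlieBracket hV hw hX hY hp

/-- A smooth frame on the open set `V` such that every `⟨e_0, …, e_{c-1}⟩` is involutive, which is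
expressed through the forms dual to the frame. -/
structure IsInvolutiveFlag (V : Set M) (e : Fin m → VField m M) : Prop where
  isOpen : IsOpen V
  smooth : ∀ i, (e i).SmoothOn V
  indep : ∀ p ∈ V, LinearIndependent ℝ fun i => e i p
  bracket : ∀ p ∈ V, ∀ a b c, a < c → b < c →
    dualForm e c p (VectorField.mlieBracket (𝓡 m) (e a) (e b) p) = 0

variable {V : Set M} {e : Fin m → VField m M}

theorem isInvolutiveFlag_of_mem_span (hV : IsOpen V) (hs : ∀ i, (e i).SmoothOn V)
    (hind : ∀ p ∈ V, LinearIndependent ℝ fun i => e i p)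
    (hbr : ∀ p ∈ V, ∀ a b, a < b → VectorField.mlieBracket (𝓡 m) (e b) (e a) p ∈
      Submodule.span ℝ (Set.range fun k : {k : Fin m // k ≤ b} => e k p)) :
    IsInvolutiveFlag V e := by
  refine ⟨hV, hs, hind, fun p hp => ?_⟩
  have hvanish : ∀ a b c, a < b → b < c →
      dualForm e c p (VectorField.mlieBracket (𝓡 m) (e b) (e a) p) = 0 :=
    fun a b c hab hbc => dualForm_eq_zero_of_mem_span (hind p hp)
      (ι := {k : Fin m // k ≤ b}) (Y := fun k => e k p)
      (fun k : {k : Fin m // k ≤ b} => ⟨k, (lt_of_le_of_lt k.2 hbc).ne, rfl⟩) (hbr p hp a b hab)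
  intro a b c hac hbc
  rcases lt_trichotomy a b with hab | rfl | hba
  · rw [VectorField.mlieBracket_swap_apply, map_neg, hvanish a b c hab hbc, neg_zero]
  · rw [VectorField.mlieBracket_self]
    exact map_zero _
  · exact hvanish b a c hba hac

namespace IsInvolutiveFlag

theorem smoothOn_dualForm (he : IsInvolutiveFlag V e) (i : Fin m) :
    (dualForm e i).SmoothOn V := ContactPfaff.smoothOn_dualForm he.isOpen he.smooth he.indep i

theorem extd_eq_zero (he : IsInvolutiveFlag V e) {w : OneForm m M} (hws : w.SmoothOn V)
    {g : M → ℝ} {c : Fin m} (hw : ∀ q ∈ V, ∀ v, w q v = g q * dualForm e c q v) {p : M}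
    (hp : p ∈ V) {a b : Fin m} (ha : a < c) (hb : b < c) : w.extd p (e a p) (e b p) = 0 := by
  have hframe : ∀ a, a < c → ∀ q ∈ V, w q (e a q) = 0 := fun a ha q hq => by
    rw [hw q hq, dualForm_apply (he.indep q hq), if_neg ha.ne', mul_zero]
  rw [extd_apply_eq_sub_mlieBracket he.isOpen hws (he.smooth a) (he.smooth b) hp,
    diff_eq_zero_of_eqOn he.isOpen (hframe b hb) hp,
    diff_eq_zero_of_eqOn he.isOpen (hframe a ha) hp, hw p hp, he.bracket p hp a b c ha hb,
    mul_zero, sub_zero, sub_zero]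

theorem dualForm_mlieBracket_eq_zero (he : IsInvolutiveFlag V e) {Z : VField m M}
    (hZ : Z.SmoothOn V) {j c : Fin m} (hjc : j < c)
    (hZj : ∀ a, j < a → ∀ q ∈ V, dualForm e a q (Z q) = 0) {p : M} (hp : p ∈ V) :
    dualForm e c p (VectorField.mlieBracket (𝓡 m) (e j) Z p) = 0 := by
  have hextd : (dualForm e c).extd p (e j p) (Z p) = 0 := by
    rw [← sum_dualForm (he.indep p hp) (Z p), map_sum]
    refine Finset.sum_eq_zero fun a _ => ?_
    rw [map_smul]
    rcases lt_or_ge a c with hac | hca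
    · rw [he.extd_eq_zero (he.smoothOn_dualForm c) (g := fun _ => 1)
        (fun _ _ _ => (one_mul _).symm) hp hjc hac, smul_zero]
    · rw [hZj a (hjc.trans_le hca) p hp, zero_smul]
  have hdual : ∀ q ∈ V, dualForm e c q (e j q) = 0 := fun q hq => by
    rw [dualForm_apply (he.indep q hq), if_neg hjc.ne']
  have hcartan :=
    extd_apply_eq_sub_mlieBracket he.isOpen (he.smoothOn_dualForm c) (he.smooth j) hZ hp
  rw [hextd, diff_eq_zero_of_eqOn he.isOpen (hZj c hjc) hp,
    diff_eq_zero_of_eqOn he.isOpen hdual hp] at hcartan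
  linarith

theorem inModule_of_dualForm_eq_zero (he : IsInvolutiveFlag V e) {ι : Type} [Fintype ι]
    {index : ι → Fin m} (hindex : Function.Injective index) {Z : VField m M} (hZ : Z.SmoothOn V)
    (hZ0 : ∀ c ∉ Set.range index, ∀ p ∈ V, dualForm e c p (Z p) = 0) :
    InModule V (fun i => e (index i)) Z := by
  refine ⟨fun i p => dualForm e (index i) p (Z p),
    fun i => (he.smoothOn_dualForm _).apply hZ he.isOpen, fun p hp => ?_⟩
  conv_lhs => rw [← sum_dualForm (he.indep p hp) (Z p)]
  refine (Fintype.sum_of_injective index hindex _ _ (fun c hc => ?_) fun _ => rfl).symm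
  rw [hZ0 c hc p hp, zero_smul]

theorem isCInfSymmetry (he : IsInvolutiveFlag V e) {ι : Type} [Fintype ι] {lower : ι → Fin m}
    (hinj : Function.Injective lower) {j : Fin m} (hlower : Set.range lower = Set.Iio j) :
    IsCInfSymmetry V (fun i => e (lower i)) (e j) where
  smooth := he.smooth j
  transverse p hp hmem := by
    have hzero := dualForm_eq_zero_of_mem_span (he.indep p hp) (c := j)
      (fun i => ⟨lower i, (hlower.le ⟨i, rfl⟩ : lower i < j).ne, rfl⟩) hmem
    rw [dualForm_apply (he.indep p hp), if_pos rfl] at hzero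
    exact one_ne_zero hzero
  bracket Z hZ hZm := by
    obtain ⟨c, -, hc⟩ := hZm
    have hZj : ∀ a, j < a → ∀ q ∈ V, dualForm e a q (Z q) = 0 := fun a ha q hq => by
      refine dualForm_eq_zero_of_mem_span (he.indep q hq) (Y := fun i => e (lower i) q)
        (fun i => ⟨lower i, ((hlower.le ⟨i, rfl⟩ : lower i < j).trans ha).ne, rfl⟩) ?_
      rw [hc q hq]
      exact sum_mem fun i _ => Submodule.smul_mem _ _ (Submodule.subset_span ⟨i, rfl⟩)
    have hindex : Function.Injective fun o : Option ι => o.elim j lower :=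
      Option.injective_iff.2 ⟨hinj, fun h => lt_irrefl j (hlower.le h)⟩
    have hmodule := he.inModule_of_dualForm_eq_zero hindex
      (VField.SmoothOn.mlieBracket he.isOpen (he.smooth j) hZ) fun a ha p hp => ?_
    · convert hmodule using 2 with o
      cases o <;> rfl
    · refine he.dualForm_mlieBracket_eq_zero hZ (not_le.1 fun haj => ha ?_) hZj hp
      rcases haj.eq_or_lt with rfl | haj
      · exact ⟨none, rfl⟩
      · obtain ⟨i, rfl⟩ := hlower.ge haj
        exact ⟨some i, rfl⟩

end IsInvolutiveFlag

theorem IsInvolutiveFlag.isCInfStructure {N : ℕ} {M : Type*} [TopologicalSpace M]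
    [ChartedSpace (EuclideanSpace ℝ (Fin (N + 1))) M] [IsManifold (𝓡 (N + 1)) ∞ M]
    {V : Set M} {e : Fin (N + 1) → VField (N + 1) M} (he : IsInvolutiveFlag V e) :
    IsCInfStructure V (fun _ : Fin 1 => e 0) (fun j : Fin N => e j.succ) where
  dim := Nat.add_comm 1 N
  smooth _ := he.smooth 0
  indep p hp := linearIndependent_unique_iff.2 ((he.indep p hp).ne_zero 0)
  symmetry j := by
    let lower : Fin 1 ⊕ {i : Fin N // i < j} → Fin (N + 1) :=
      Sum.elim (fun _ => 0) fun i => (i : Fin N).succ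
    have hinj : Function.Injective lower := Function.Injective.sumElim
      (Function.injective_of_subsingleton _) ((Fin.succ_injective N).comp Subtype.val_injective)
      fun _ i => (Fin.succ_ne_zero i.1).symm
    have hrange : Set.range lower = Set.Iio j.succ := by
      ext a
      cases a using Fin.cases <;> simp [lower]
    convert he.isCInfSymmetry hinj hrange using 2 with i
    cases i <;> rfl

end Flags

/-! ### First integrals of involutive families of 1-forms -/

section FirstIntegrals

variable {m : ℕ} {M : Type*} [TopologicalSpace M] [ChartedSpace (EuclideanSpace ℝ (Fin m)) M]
  {x q : M} {ι : Type*}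

/-- The local representative, in the chart at `x`, of the `ℝ^ι`-valued 1-form with the components
`β i`. -/
def coframeRep (β : ι → OneForm m M) (x : M) (y : EuclideanSpace ℝ (Fin m)) :
    EuclideanSpace ℝ (Fin m) →L[ℝ] (ι → ℝ) :=
  ContinuousLinearMap.pi fun i => (β i).rep x y

theorem coframeRep_apply_chartD [IsManifold (𝓡 m) ∞ M] (β : ι → OneForm m M)
    (hq : q ∈ (extChartAt (𝓡 m) x).source) (v : TangentSpace (𝓡 m) q) :
    coframeRep β x (extChartAt (𝓡 m) x q) (chartD x q v) = fun i => β i q v :=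
  funext fun i => ((β i).rep_extChartAt hq _).trans (congrArg (β i q) (chartDInv_chartD hq v))

theorem contDiffAt_coframeRep [Fintype ι] {β : ι → OneForm m M} {V : Set M} (hV : IsOpen V)
    (hβ : ∀ i, (β i).SmoothOn V) (hqV : q ∈ V) (hq : q ∈ (extChartAt (𝓡 m) x).source) :
    ContDiffAt ℝ ∞ (coframeRep β x) (extChartAt (𝓡 m) x q) :=
  contDiffAt_clm_pi fun i => (hβ i).contDiffAt_rep hV hqV hq

theorem fderiv_coframeRep_apply [Finite ι] {β : ι → OneForm m M} {V : Set M} (hV : IsOpen V)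
    (hβ : ∀ i, (β i).SmoothOn V) (hqV : q ∈ V) (hq : q ∈ (extChartAt (𝓡 m) x).source)
    (u v : EuclideanSpace ℝ (Fin m)) (i : ι) :
    fderiv ℝ (coframeRep β x) (extChartAt (𝓡 m) x q) u v i =
      fderiv ℝ ((β i).rep x) (extChartAt (𝓡 m) x q) u v := by
  have := Fintype.ofFinite ι
  have hfamily := ((contDiffAt_coframeRep hV hβ hqV hq).differentiableAt
    (by simp)).hasFDerivAt.clm_apply (hasFDerivAt_const v _)
  have hcomponent := (((hβ i).contDiffAt_rep hV hqV hq).differentiableAt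
    (by simp)).hasFDerivAt.clm_apply (hasFDerivAt_const v _)
  simpa using congrArg (fun L => L u) ((hasFDerivAt_pi'.1 hfamily i).unique hcomponent)

variable [Finite ι] [IsManifold (𝓡 m) ∞ M]

theorem diff_comp_extChartAt {f : EuclideanSpace ℝ (Fin m) → ℝ}
    (hf : DifferentiableAt ℝ f (extChartAt (𝓡 m) x q)) (hq : q ∈ (extChartAt (𝓡 m) x).source)
    (v : TangentSpace (𝓡 m) q) :
    diff (m := m) (f ∘ extChartAt (𝓡 m) x) q v =
      fderiv ℝ f (extChartAt (𝓡 m) x q) (chartD x q v) := by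
  rw [diff, mfderiv_comp q hf.mdifferentiableAt
    (mdifferentiableAt_extChartAt (by rwa [extChartAt_source] at hq)), mfderiv_eq_fderiv]
  rfl

theorem fderiv_coframeRep_symm {β : ι → OneForm m M} {V : Set M} (hV : IsOpen V)
    (hβ : ∀ i, (β i).SmoothOn V)
    (hint : ∀ q ∈ V, ∀ u v, (∀ i, β i q u = 0) → (∀ i, β i q v = 0) →
      ∀ i, (β i).extd q u v = 0) (hqV : q ∈ V) (hq : q ∈ (extChartAt (𝓡 m) x).source)
    {u v : EuclideanSpace ℝ (Fin m)} (hu : coframeRep β x (extChartAt (𝓡 m) x q) u = 0)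
    (hv : coframeRep β x (extChartAt (𝓡 m) x q) v = 0) :
    fderiv ℝ (coframeRep β x) (extChartAt (𝓡 m) x q) u v =
      fderiv ℝ (coframeRep β x) (extChartAt (𝓡 m) x q) v u := by
  have hker : ∀ u, coframeRep β x (extChartAt (𝓡 m) x q) u = 0 →
      ∀ i, β i q (chartDInv x q u) = 0 := fun u hu => by
    rw [← chartD_chartDInv hq u, coframeRep_apply_chartD β hq] at hu
    exact congrFun hu
  funext i
  have hextd := hint q hqV _ _ (hker u hu) (hker v hv) i
  rw [extd_apply_of_mem_source hV (hβ i) hqV hq, chartD_chartDInv hq, chartD_chartDInv hq,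
    sub_eq_zero] at hextd
  rw [fderiv_coframeRep_apply hV hβ hqV hq, fderiv_coframeRep_apply hV hβ hqV hq, hextd]

theorem exists_first_integrals {β : ι → OneForm m M} {V : Set M} (hV : IsOpen V)
    (hβ : ∀ i, (β i).SmoothOn V)
    (hint : ∀ q ∈ V, ∀ u v, (∀ i, β i q u = 0) → (∀ i, β i q v = 0) →
      ∀ i, (β i).extd q u v = 0) {p : M} (hp : p ∈ V)
    (hsurj : Function.Surjective fun v i => β i p v) :
    ∃ J : ι → M → ℝ, (∀ i, diff (m := m) (J i) p = β i p) ∧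
      ∃ W, IsOpen W ∧ p ∈ W ∧ W ⊆ V ∧ (∀ i, SmoothFunOn (m := m) W (J i)) ∧
        ∀ q ∈ W, ∀ v, (∀ i, β i q v = 0) → ∀ i, diff (m := m) (J i) q v = 0 := by
  have := Fintype.ofFinite ι
  have hps := mem_extChartAt_source (I := 𝓡 m) p
  have hchart : ∀ᶠ y in 𝓝 (extChartAt (𝓡 m) p p), ∃ q ∈ V, q ∈ (extChartAt (𝓡 m) p).source ∧
      extChartAt (𝓡 m) p q = y := by
    filter_upwards [target_inter_preimage_mem_nhds (hV.mem_nhds hp) hps] with y hy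
    exact ⟨_, hy.2, (extChartAt (𝓡 m) p).map_target hy.1, (extChartAt (𝓡 m) p).right_inv hy.1⟩
  obtain ⟨J, hJs, hJp, hJ⟩ := exists_first_integral (θ := coframeRep β p)
    (hchart.mono fun _ ⟨q, hqV, hq, hqy⟩ => hqy ▸ contDiffAt_coframeRep hV hβ hqV hq)
    (fun c => by
      obtain ⟨v, hv⟩ := hsurj c
      exact ⟨chartD p p v, (coframeRep_apply_chartD β hps v).trans hv⟩)
    (hchart.mono fun _ ⟨q, hqV, hq, hqy⟩ u v hu hv => by
      subst hqy
      exact fderiv_coframeRep_symm hV hβ hint hqV hq hu hv)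
  obtain ⟨W, hW, hWo, hpW⟩ := eventually_nhds_iff.1
    (((continuousAt_extChartAt p).eventually (hJs.and hJ)).and
      ((hV.eventually_mem hp).and ((isOpen_extChartAt_source (I := 𝓡 m) p).eventually_mem hps)))
  have hdiff : ∀ q ∈ W, ∀ i v, diff (m := m) ((fun y => J y i) ∘ extChartAt (𝓡 m) p) q v =
      fderiv ℝ J (extChartAt (𝓡 m) p q) (chartD p q v) i := fun q hq i v => by
    obtain ⟨⟨hJq, -⟩, -, hqs⟩ := hW q hq
    have hJd := hasFDerivAt_pi'.1 (hJq.differentiableAt (by simp)).hasFDerivAt i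
    rw [diff_comp_extChartAt hJd.differentiableAt hqs, hJd.fderiv]
    rfl
  refine ⟨fun i => (fun y => J y i) ∘ extChartAt (𝓡 m) p,
    fun i => ContinuousLinearMap.ext fun v => ?_, W, hWo, hpW, fun q hq => (hW q hq).2.1,
    fun i q hq => ?_, fun q hq v hv i => ?_⟩
  · rw [hdiff p hpW, hJp, coframeRep_apply_chartD β hps]
  · exact (contMDiffAt_comp_extChartAt (hW q hq).2.2
      (contDiffAt_pi.1 (hW q hq).1.1 i)).contMDiffWithinAt
  · rw [hdiff q hq, (hW q hq).1.2 _ ((coframeRep_apply_chartD β (hW q hq).2.2 v).trans (funext hv))]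
    rfl

end FirstIntegrals

/-! ### Pfaffian systems dual to an involutive flag -/

section Pfaff

theorem sum_sum_mul_mul_eq_of_skew {ι : Type*} [Fintype ι] [LinearOrder ι]
    [LocallyFiniteOrderBot ι] {D : ι → ι → ℝ} (hD : ∀ a b, D a b = -D b a) (x y : ι → ℝ) :
    ∑ a, ∑ b, x a * y b * D a b = ∑ b, ((∑ a ∈ Finset.Iio b, D a b * x a) * y b -
      (∑ a ∈ Finset.Iio b, D a b * y a) * x b) := by
  have hsplit : ∀ a b, x a * y b * D a b = (if a < b then D a b * x a * y b else 0) -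
      if b < a then D b a * y b * x a else 0 := by
    intro a b
    rcases lt_trichotomy a b with hab | rfl | hba
    · rw [if_pos hab, if_neg hab.not_gt]; ring
    · have hdiag : D a a = 0 := by linarith [hD a a]
      simp [hdiag]
    · rw [if_neg hba.not_gt, if_pos hba, hD a b]; ring
  have hIio : ∀ x y : ι → ℝ, ∀ b, ∑ a, (if a < b then D a b * x a * y b else 0) =
      (∑ a ∈ Finset.Iio b, D a b * x a) * y b := by
    intro x y b
    rw [Finset.sum_mul, ← Finset.sum_filter]
    congr 1
    ext a
    simp
  simp only [hsplit, Finset.sum_sub_distrib]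
  rw [Finset.sum_comm]
  simp only [hIio]

section Manifold

variable {m : ℕ} {M : Type*} [TopologicalSpace M] [ChartedSpace (EuclideanSpace ℝ (Fin m)) M]

theorem extd_apply_eq_sum {e : Fin m → VField m M} {p : M}
    (he : LinearIndependent ℝ fun i => e i p) (α : OneForm m M) (u v : TangentSpace (𝓡 m) p) :
    α.extd p u v =
      ∑ a, ∑ b, dualForm e a p u * dualForm e b p v * α.extd p (e a p) (e b p) := by
  conv_lhs => rw [← sum_dualForm he u, ← sum_dualForm he v]
  simp only [map_sum, map_smul, sum_apply, smul_apply, smul_eq_mul, Finset.mul_sum, mul_assoc]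
  rw [Finset.sum_comm]
  exact Finset.sum_congr rfl fun a _ => Finset.sum_congr rfl fun b _ => mul_left_comm _ _ _

theorem SolvesPfaff.mono {N : ℕ} {W W' : Set M} {w : Fin N → OneForm m M} {I : Fin N → M → ℝ}
    {k : Fin N} (h : SolvesPfaff W w I k) (hW' : W' ⊆ W) : SolvesPfaff W' w I k where
  smooth := h.smooth.mono hW'
  wedge p hp := h.wedge p (hW' hp)
  regular p hp := h.regular p (hW' hp)

theorem SolvesPfaff.diff_eq_zero_iff {N : ℕ} {W : Set M} {w : Fin N → OneForm m M}
    {I : Fin N → M → ℝ} {k : Fin N} (h : SolvesPfaff W w I k) {p : M} (hp : p ∈ W)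
    {u v : TangentSpace (𝓡 m) p} (hu : ∀ l, k < l → diff (m := m) (I l) p u = 0)
    (hv : ∀ l, k < l → diff (m := m) (I l) p v = 0) (hwv : w k p v ≠ 0) :
    diff (m := m) (I k) p u = 0 ↔ w k p u = 0 := by
  constructor
  · intro hIu
    obtain ⟨r, hr, hIr⟩ := h.regular p hp
    have hwedge := h.wedge p hp u r hu hr
    rw [hIu, zero_mul] at hwedge
    exact (mul_eq_zero.1 hwedge.symm).resolve_left hIr
  · intro hwu
    have hwedge := h.wedge p hp u v hu hv
    rw [hwu, mul_zero] at hwedge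
    exact (mul_eq_zero.1 hwedge).resolve_right hwv

theorem OneForm.smoothOn_sum_smul [IsManifold (𝓡 m) ∞ M] {ι : Type*} {s : Finset ι} {V : Set M}
    (hV : IsOpen V) {c : ι → M → ℝ} {β : ι → OneForm m M}
    (hc : ∀ a ∈ s, SmoothFunOn (m := m) V (c a)) (hβ : ∀ a ∈ s, (β a).SmoothOn V) :
    OneForm.SmoothOn V fun p => ∑ a ∈ s, c a p • β a p := by
  refine OneForm.smoothOn_of_apply hV fun Z W hW hWV hZ => ?_
  have hsum : SmoothFunOn (m := m) W fun p => ∑ a ∈ s, c a p * β a p (Z p) :=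
    contMDiffOn_finsetSum fun a ha =>
      ContMDiffOn.mul ((hc a ha).mono hWV) (((hβ a ha).mono hWV).apply hZ hW)
  refine hsum.congr fun p _ => ?_
  simp only [sum_apply, smul_apply, smul_eq_mul]

end Manifold

variable {N : ℕ} {M : Type*} [TopologicalSpace M]
  [ChartedSpace (EuclideanSpace ℝ (Fin (N + 1))) M] [IsManifold (𝓡 (N + 1)) ∞ M]

/-- The forms `w_i` are multiples `g_i e^{i+1}`, with smooth nowhere zero factors, of the forms
dual to an involutive flag `e_0, …, e_N`. -/
structure IsScaledDual (V : Set M) (e : Fin (N + 1) → VField (N + 1) M) (g : Fin N → M → ℝ)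
    (w : Fin N → OneForm (N + 1) M) : Prop where
  flag : IsInvolutiveFlag V e
  smooth : ∀ i, SmoothFunOn (m := N + 1) V (g i)
  ne_zero : ∀ p ∈ V, ∀ i, g i p ≠ 0
  eq : ∀ p ∈ V, ∀ i v, w i p v = g i p * dualForm e i.succ p v

variable {V : Set M} {e : Fin (N + 1) → VField (N + 1) M} {g : Fin N → M → ℝ}
  {w : Fin N → OneForm (N + 1) M}

namespace IsScaledDual

theorem apply_frame (h : IsScaledDual V e g w) {p : M} (hp : p ∈ V) (i : Fin N)
    (a : Fin (N + 1)) : w i p (e a p) = if i.succ = a then g i p else 0 := by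
  rw [h.eq p hp, dualForm_apply (h.flag.indep p hp), mul_ite, mul_one, mul_zero]

theorem apply_succ_ne_zero (h : IsScaledDual V e g w) {p : M} (hp : p ∈ V) (i : Fin N) :
    w i p (e i.succ p) ≠ 0 := by
  rw [h.apply_frame hp, if_pos rfl]
  exact h.ne_zero p hp i

theorem apply_succ_of_ne (h : IsScaledDual V e g w) {p : M} (hp : p ∈ V) {i j : Fin N}
    (hij : i ≠ j) : w i p (e j.succ p) = 0 := by
  rw [h.apply_frame hp, if_neg fun hsucc => hij (Fin.succ_injective _ hsucc)]

theorem smoothOn (h : IsScaledDual V e g w) (i : Fin N) : (w i).SmoothOn V := by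
  refine OneForm.smoothOn_of_apply h.flag.isOpen fun Z W hW hWV hZ => ?_
  have hdual := ((h.flag.smoothOn_dualForm i.succ).mono hWV).apply hZ hW
  exact (((h.smooth i).mono hWV).mul hdual).congr fun p hp => h.eq p (hWV hp) i _

theorem linearIndependent (h : IsScaledDual V e g w) {p : M} (hp : p ∈ V) :
    LinearIndependent ℝ fun i => w i p := by
  rw [Fintype.linearIndependent_iff]
  intro c hc i
  have heval : ∑ j, c j * w j p (e i.succ p) = 0 := by
    simpa only [sum_apply, smul_apply, smul_eq_mul, zero_apply] using
      congrArg (fun L => L (e i.succ p)) hc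
  rw [Finset.sum_eq_single i (fun j _ hj => by rw [h.apply_succ_of_ne hp hj, mul_zero])
    (by simp)] at heval
  exact (mul_eq_zero.1 heval).resolve_right (h.apply_succ_ne_zero hp i)

theorem surjective (h : IsScaledDual V e g w) {p : M} (hp : p ∈ V) (P : Fin N → Prop) :
    Function.Surjective fun v (i : {i // P i}) => w i p v := by
  classical
  intro c
  refine ⟨∑ l, (if hl : P l then c ⟨l, hl⟩ * (g l p)⁻¹ else 0) • e l.succ p,
    funext fun i => ?_⟩
  simp only [map_sum, map_smul, h.apply_frame hp, Fin.succ_inj, smul_eq_mul]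
  rw [Finset.sum_eq_single (i : Fin N)]
  · rw [dif_pos i.2, if_pos rfl, inv_mul_cancel_right₀ (h.ne_zero p hp i)]
  · intro j _ hj
    rw [if_neg hj.symm, mul_zero]
  · simp

theorem eq_zero_iff (h : IsScaledDual V e g w) {p : M} (hp : p ∈ V) (i : Fin N)
    (v : TangentSpace (𝓡 (N + 1)) p) : w i p v = 0 ↔ dualForm e i.succ p v = 0 := by
  rw [h.eq p hp, mul_eq_zero, or_iff_right (h.ne_zero p hp i)]

theorem forall_eq_zero_iff_mem_span (h : IsScaledDual V e g w) {p : M} (hp : p ∈ V)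
    (v : TangentSpace (𝓡 (N + 1)) p) :
    (∀ i, w i p v = 0) ↔ v ∈ Submodule.span ℝ {e 0 p} := by
  rw [Submodule.mem_span_singleton]
  constructor
  · intro hv
    have hexpand := sum_dualForm (h.flag.indep p hp) v
    rw [Fin.sum_univ_succ, Finset.sum_eq_zero, add_zero] at hexpand
    · exact ⟨_, hexpand⟩
    · intro i _
      rw [(h.eq_zero_iff hp i v).1 (hv i), zero_smul]
  · rintro ⟨c, rfl⟩ i
    rw [map_smul, h.apply_frame hp, if_neg i.succ_ne_zero, smul_zero]

theorem extd_eq_zero (h : IsScaledDual V e g w) {p : M} (hp : p ∈ V) (i : Fin N)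
    {a b : Fin (N + 1)} (ha : a < i.succ) (hb : b < i.succ) :
    (w i).extd p (e a p) (e b p) = 0 :=
  h.flag.extd_eq_zero (h.smoothOn i) (g := g i) (fun q hq v => h.eq q hq i v) hp ha hb

theorem extd_eq_zero_of_forall (h : IsScaledDual V e g w) {p : M} (hp : p ∈ V) {i : Fin N}
    {u v : TangentSpace (𝓡 (N + 1)) p} (hu : ∀ l, i ≤ l → w l p u = 0)
    (hv : ∀ l, i ≤ l → w l p v = 0) : (w i).extd p u v = 0 := by
  have hdual : ∀ u, (∀ l, i ≤ l → w l p u = 0) → ∀ a, i.succ ≤ a → dualForm e a p u = 0 := by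
    intro u hu a ha
    obtain ⟨l, rfl⟩ := Fin.exists_succ_eq.2 (ne_bot_of_gt (i.succ_pos.trans_le ha))
    exact (h.eq_zero_iff hp l u).1 (hu l (Fin.succ_le_succ_iff.1 ha))
  rw [extd_apply_eq_sum (h.flag.indep p hp)]
  refine Finset.sum_eq_zero fun a _ => Finset.sum_eq_zero fun b _ => ?_
  rcases lt_or_ge a i.succ with ha | ha
  · rcases lt_or_ge b i.succ with hb | hb
    · rw [h.extd_eq_zero hp i ha hb, mul_zero]
    · rw [hdual v hv b hb, mul_zero, zero_mul]
  · rw [hdual u hu a ha, zero_mul, zero_mul]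

theorem completely_integrable (h : IsScaledDual V e g w) (i : Fin N) :
    ∃ θ : Fin N → OneForm (N + 1) M, (∀ l, (θ l).SmoothOn V) ∧
      ∀ p ∈ V, ∀ u v : TangentSpace (𝓡 (N + 1)) p, (w i).extd p u v =
        ∑ l ∈ Finset.Ici i, (θ l p u * w l p v - θ l p v * w l p u) := by
  have hV := h.flag.isOpen
  let c (l : Fin N) (a : Fin (N + 1)) (p : M) : ℝ := (w i).extd p (e a p) (e l.succ p) / g l p
  let θ (l : Fin N) : OneForm (N + 1) M := fun p =>
    ∑ a ∈ Finset.Iio l.succ, c l a p • dualForm e a p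
  have hθ : ∀ p ∈ V, ∀ l u, θ l p u * g l p =
      ∑ a ∈ Finset.Iio l.succ, (w i).extd p (e a p) (e l.succ p) * dualForm e a p u := by
    intro p hp l u
    simp only [θ, c, sum_apply, smul_apply, smul_eq_mul, Finset.sum_mul]
    exact Finset.sum_congr rfl fun a _ => by field_simp [h.ne_zero p hp l]
  have hθ_lt : ∀ p ∈ V, ∀ l < i, θ l p = 0 := fun p hp l hl =>
    Finset.sum_eq_zero fun a ha => by
      have hsucc := Fin.succ_lt_succ_iff.2 hl
      simp only [c, h.extd_eq_zero hp i ((Finset.mem_Iio.1 ha).trans hsucc) hsucc, zero_div,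
        zero_smul]
  refine ⟨θ, fun l => OneForm.smoothOn_sum_smul hV (fun a _ => ?_)
    fun a _ => h.flag.smoothOn_dualForm a, fun p hp u v => ?_⟩
  · exact ContMDiffOn.div₀ ((h.smoothOn i).extd_apply (h.flag.smooth a) (h.flag.smooth l.succ) hV)
      (h.smooth l) fun p hp => h.ne_zero p hp l
  · rw [Finset.sum_subset (Finset.subset_univ _) fun l _ hl => by
        rw [hθ_lt p hp l (not_le.1 (Finset.mem_Ici.not.1 hl)), zero_apply, zero_apply, zero_mul,
          zero_mul, sub_zero],
      extd_apply_eq_sum (h.flag.indep p hp),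
      sum_sum_mul_mul_eq_of_skew fun a b => (w i).extd_skew p _ _, Fin.sum_univ_succ]
    have hIio : Finset.Iio (0 : Fin (N + 1)) = ∅ := Finset.Iio_bot
    simp only [hIio, Finset.sum_empty, zero_mul, sub_zero, zero_add,
      ← hθ p hp, h.eq p hp, mul_assoc]

theorem diff_eq_zero_iff (h : IsScaledDual V e g w) {W : Set M} (hWV : W ⊆ V) {I : Fin N → M → ℝ}
    {p : M} (hp : p ∈ W) {s : Set (Fin N)} (hs : IsUpperSet s)
    (hI : ∀ l ∈ s, SolvesPfaff W w I l) (u : TangentSpace (𝓡 (N + 1)) p) :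
    (∀ l ∈ s, diff (m := N + 1) (I l) p u = 0) ↔ ∀ l ∈ s, w l p u = 0 := by
  suffices hIci : ∀ k ∈ s, ∀ u, (∀ l, k ≤ l → diff (m := N + 1) (I l) p u = 0) ↔
      ∀ l, k ≤ l → w l p u = 0 from
    ⟨fun hu l hl => (hIci l hl u).1 (fun j hj => hu j (hs hj hl)) l le_rfl,
      fun hu l hl => (hIci l hl u).2 (fun j hj => hu j (hs hj hl)) l le_rfl⟩
  intro k
  induction k using WellFoundedGT.induction with
  | ind k ih =>
    intro hk u
    have hIoi : ∀ u, (∀ l, k < l → diff (m := N + 1) (I l) p u = 0) ↔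
        ∀ l, k < l → w l p u = 0 := fun u =>
      ⟨fun hu l hl => (ih l hl (hs hl.le hk) u).1 (fun j hj => hu j (hl.trans_le hj)) l le_rfl,
        fun hu l hl => (ih l hl (hs hl.le hk) u).2 (fun j hj => hu j (hl.trans_le hj)) l le_rfl⟩
    have hframe : ∀ l, k < l → diff (m := N + 1) (I l) p (e k.succ p) = 0 :=
      (hIoi _).2 fun l hl => h.apply_succ_of_ne (hWV hp) hl.ne'
    simp only [le_iff_eq_or_lt, or_imp, forall_and, forall_eq', ← hIoi u]
    exact and_congr_left fun hu =>
      (hI k hk).diff_eq_zero_iff hp hu hframe (h.apply_succ_ne_zero (hWV hp) k)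

theorem solvesPfaff_update (h : IsScaledDual V e g w) {W : Set M} (hWV : W ⊆ V)
    {I : Fin N → M → ℝ} {k : Fin N} (hI : ∀ l, k < l → SolvesPfaff W w I l) {J : M → ℝ}
    (hJ : SmoothFunOn (m := N + 1) W J)
    (hJw : ∀ q ∈ W, ∀ v, (∀ l, k ≤ l → w l q v = 0) → diff (m := N + 1) J q v = 0)
    (hJe : ∀ q ∈ W, diff (m := N + 1) J q (e k.succ q) ≠ 0) :
    SolvesPfaff W w (Function.update I k J) k := by
  have hupdate : ∀ l, k < l → Function.update I k J l = I l := fun l hl =>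
    Function.update_of_ne hl.ne' _ _
  have hker : ∀ q ∈ W, ∀ u,
      (∀ l, k < l → diff (m := N + 1) (Function.update I k J l) q u = 0) ↔
        ∀ l, k < l → w l q u = 0 := fun q hq u =>
    (forall₂_congr fun l hl => by rw [hupdate l hl]).trans
      (h.diff_eq_zero_iff hWV hq (isUpperSet_Ioi k) hI u)
  have hproportional : ∀ q ∈ W, ∀ u,
      (∀ l, k < l → diff (m := N + 1) (Function.update I k J l) q u = 0) →
        diff (m := N + 1) J q u =
          w k q u / w k q (e k.succ q) * diff (m := N + 1) J q (e k.succ q) := fun q hq u hu => by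
    have hJ0 := hJw q hq (u - (w k q u / w k q (e k.succ q)) • e k.succ q) fun l hl => by
      rw [map_sub, map_smul, smul_eq_mul]
      rcases hl.eq_or_lt with rfl | hl
      · rw [div_mul_cancel₀ _ (h.apply_succ_ne_zero (hWV hq) _), sub_self]
      · rw [(hker q hq u).1 hu l hl, h.apply_succ_of_ne (hWV hq) hl.ne', mul_zero, sub_zero]
    rwa [map_sub, map_smul, smul_eq_mul, sub_eq_zero] at hJ0
  refine ⟨?_, fun q hq u v hu hv => ?_, fun q hq => ⟨e k.succ q, ?_, ?_⟩⟩
  · rwa [Function.update_self]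
  · rw [Function.update_self, hproportional q hq u hu, hproportional q hq v hv]
    ring
  · exact (hker q hq _).2 fun l hl => h.apply_succ_of_ne (hWV hq) hl.ne'
  · rw [Function.update_self]
    exact hJe q hq

theorem exists_solution (h : IsScaledDual V e g w) {W : Set M} (hW : IsOpen W) (hWV : W ⊆ V)
    {I : Fin N → M → ℝ} {k : Fin N} (hI : ∀ l, k < l → SolvesPfaff W w I l) {p : M}
    (hp : p ∈ W) : ∃ W' : Set M, IsOpen W' ∧ p ∈ W' ∧ W' ⊆ W ∧
      ∃ J : M → ℝ, SolvesPfaff W' w (Function.update I k J) k := by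
  obtain ⟨J, hJp, W₁, hW₁, hpW₁, hW₁W, hJs, hJ⟩ := exists_first_integrals hW
    (β := fun l : {l // k ≤ l} => w l) (fun l => (h.smoothOn l).mono hWV)
    (fun q hq u v hu hv i => h.extd_eq_zero_of_forall (hWV hq)
      (fun l hl => hu ⟨l, i.2.trans hl⟩) fun l hl => hv ⟨l, i.2.trans hl⟩) hp
    (h.surjective (hWV hp) fun l => k ≤ l)
  let k' : {l // k ≤ l} := ⟨k, le_rfl⟩
  have hcont : ContinuousOn (fun q => diff (m := N + 1) (J k') q (e k.succ q)) W₁ :=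
    (((hJs k').diff hW₁).apply ((h.flag.smooth k.succ).mono (hW₁W.trans hWV)) hW₁).continuousOn
  have hpJ : diff (m := N + 1) (J k') p (e k.succ p) ≠ 0 := by
    rw [hJp]
    exact h.apply_succ_ne_zero (hWV hp) k
  have hsub : W₁ ∩ (fun q => diff (m := N + 1) (J k') q (e k.succ q)) ⁻¹' {0}ᶜ ⊆ W :=
    Set.inter_subset_left.trans hW₁W
  exact ⟨_, hcont.isOpen_inter_preimage hW₁ isOpen_compl_singleton, ⟨hpW₁, hpJ⟩, hsub, J k',
    h.solvesPfaff_update (hsub.trans hWV) (fun l hl => (hI l hl).mono hsub)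
      ((hJs k').mono Set.inter_subset_left)
      (fun q hq v hv => hJ q hq.1 v (fun l => hv l l.2) k') fun q hq => hq.2⟩

end IsScaledDual

end Pfaff

/-! ### Level sets -/

section LevelSets

theorem exists_injOn_of_hasStrictFDerivAt {E F : Type*} [NormedAddCommGroup E] [NormedSpace ℝ E]
    [CompleteSpace E] [NormedAddCommGroup F] [NormedSpace ℝ F] [FiniteDimensional ℝ F] {f : E → F}
    {f' : E →L[ℝ] F} {a : E} (hf : HasStrictFDerivAt f f' a) (hf' : Function.Injective f') :
    ∃ s ∈ 𝓝 a, Set.InjOn f s := by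
  obtain ⟨g, hg⟩ := f'.toLinearMap.exists_leftInverse_of_injective (LinearMap.ker_eq_bot.2 hf')
  have hgf : HasStrictFDerivAt (LinearMap.toContinuousLinearMap g ∘ f)
      (ContinuousLinearEquiv.refl ℝ E : E →L[ℝ] E) a := by
    refine ((LinearMap.toContinuousLinearMap g).hasStrictFDerivAt.comp a hf).congr_fderiv ?_
    ext v
    exact LinearMap.congr_fun hg v
  refine ⟨(hgf.toOpenPartialHomeomorph _).source,
    (hgf.toOpenPartialHomeomorph _).open_source.mem_nhds hgf.mem_toOpenPartialHomeomorph_source,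
    fun x hx y hy hxy => (hgf.toOpenPartialHomeomorph _).injOn hx hy ?_⟩
  exact congrArg g hxy

theorem isEmbedding_of_strictMonoOn_comp {X : Type*} [TopologicalSpace X] {γ : ℝ → X} {f : X → ℝ}
    {s : Set ℝ} {O : Set X} (hs : IsPreconnected s) (hγ : ContinuousOn γ s)
    (hmaps : Set.MapsTo γ s O) (hf : ContinuousOn f O) (hmono : StrictMonoOn (f ∘ γ) s) :
    Topology.IsEmbedding fun t : s => γ t := by
  let γ' : s → O := hmaps.restrict
  have hγ' : Continuous γ' := (continuousOn_iff_continuous_domRestrict.1 hγ).subtype_mk _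
  have hf' : Continuous (O.domRestrict f) := continuousOn_iff_continuous_domRestrict.1 hf
  have hmono' : StrictMono (O.domRestrict f ∘ γ') := fun t u htu => hmono t.2 u.2 htu
  have : PreconnectedSpace s := Subtype.preconnectedSpace hs
  have : s.OrdConnected := hs.ordConnected
  exact Topology.IsEmbedding.subtypeVal.comp (Topology.IsEmbedding.of_comp hγ' hf'
    (hmono'.isEmbedding_of_ordConnected (isPreconnected_range (hf'.comp hγ')).ordConnected))

theorem image_Ioo_eq_inter_of_strictMonoOn_comp {X : Type*} [TopologicalSpace X] {γ : ℝ → X}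
    {f : X → ℝ} {S O : Set X} {a b : ℝ} (hab : a ≤ b) (hf : ContinuousOn f O)
    (hinj : Set.InjOn f (S ∩ O)) (hγ : ContinuousOn γ (Set.Icc a b))
    (hmapsO : Set.MapsTo γ (Set.Icc a b) O) (hmapsS : Set.MapsTo γ (Set.Ioo a b) S)
    (hmono : StrictMonoOn (f ∘ γ) (Set.Icc a b)) :
    γ '' Set.Ioo a b = S ∩ (O ∩ f ⁻¹' Set.Ioo (f (γ a)) (f (γ b))) := by
  have hsub := Set.Ioo_subset_Icc_self (a := a) (b := b)
  apply Set.Subset.antisymm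
  · rintro _ ⟨t, ht, rfl⟩
    exact ⟨hmapsS ht, hmapsO (hsub ht), hmono (Set.left_mem_Icc.2 hab) (hsub ht) ht.1,
      hmono (hsub ht) (Set.right_mem_Icc.2 hab) ht.2⟩
  · rintro q ⟨hqS, hqO, hq⟩
    obtain ⟨t, ht, htq⟩ := intermediate_value_Ioo hab (hf.comp hγ hmapsO) hq
    exact ⟨t, ht, hinj ⟨hmapsS ht, hmapsO (hsub ht)⟩ ⟨hqS, hqO⟩ htq⟩

variable {m : ℕ} {M : Type*} [TopologicalSpace M] [ChartedSpace (EuclideanSpace ℝ (Fin m)) M]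

theorem hasDerivAt_comp_integralCurve {X : VField m M} {γ : ℝ → M} {f : M → ℝ} {t : ℝ}
    (hγ : HasMFDerivAt 𝓘(ℝ, ℝ) (𝓡 m) γ t ((1 : ℝ →L[ℝ] ℝ).smulRight (X (γ t))))
    (hf : ContMDiffAt (𝓡 m) 𝓘(ℝ, ℝ) ∞ f (γ t)) :
    HasDerivAt (f ∘ γ) (diff (m := m) f (γ t) (X (γ t))) t := by
  have hcomp : HasFDerivAt (f ∘ γ) ((diff (m := m) f (γ t)).comp
      ((1 : ℝ →L[ℝ] ℝ).smulRight (X (γ t)))) t :=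
    ((hf.mdifferentiableAt (by simp)).hasMFDerivAt.comp t hγ).hasFDerivAt
  refine hcomp.hasDerivAt.congr_deriv ?_
  change diff (m := m) f (γ t) ((1 : ℝ) • X (γ t)) = _
  rw [one_smul]

theorem strictMonoOn_comp_integralCurve {X : VField m M} {O : Set M} (hO : IsOpen O) {f : M → ℝ}
    (hf : SmoothFunOn (m := m) O f) (hfX : ∀ q ∈ O, 0 < diff (m := m) f q (X q)) {γ : ℝ → M}
    {a b : ℝ} (hγ : ∀ ⦃t⦄, t ∈ Set.Icc a b →
      HasMFDerivAt 𝓘(ℝ, ℝ) (𝓡 m) γ t ((1 : ℝ →L[ℝ] ℝ).smulRight (X (γ t))) ∧ γ t ∈ O) :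
    StrictMonoOn (f ∘ γ) (Set.Icc a b) := by
  have hderiv : ∀ t ∈ Set.Icc a b, HasDerivAt (f ∘ γ) (diff (m := m) f (γ t) (X (γ t))) t :=
    fun t ht => hasDerivAt_comp_integralCurve (hγ ht).1 (hf.contMDiffAt hO (hγ ht).2)
  refine strictMonoOn_of_deriv_pos (convex_Icc _ _)
    (fun t ht => (hderiv t ht).continuousAt.continuousWithinAt) fun t ht => ?_
  rw [(hderiv t (interior_subset ht)).deriv]
  exact hfX _ (hγ (interior_subset ht)).2

theorem comp_integralCurve_eq {X : VField m M} {W : Set M} (hW : IsOpen W) {f : M → ℝ}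
    (hf : SmoothFunOn (m := m) W f) (hfX : ∀ q ∈ W, diff (m := m) f q (X q) = 0) {γ : ℝ → M}
    {a b : ℝ} (hγ : ∀ t ∈ Set.Ioo a b,
      HasMFDerivAt 𝓘(ℝ, ℝ) (𝓡 m) γ t ((1 : ℝ →L[ℝ] ℝ).smulRight (X (γ t))) ∧ γ t ∈ W)
    {s t : ℝ} (hs : s ∈ Set.Ioo a b) (ht : t ∈ Set.Ioo a b) : f (γ s) = f (γ t) := by
  have hderiv : ∀ r ∈ Set.Ioo a b, HasDerivAt (f ∘ γ) 0 r := fun r hr => by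
    rw [← hfX _ (hγ r hr).2]
    exact hasDerivAt_comp_integralCurve (hγ r hr).1 (hf.contMDiffAt hW (hγ r hr).2)
  exact isOpen_Ioo.is_const_of_deriv_eq_zero isPreconnected_Ioo
    (fun r hr => (hderiv r hr).differentiableAt.differentiableWithinAt)
    (fun r hr => (hderiv r hr).deriv) hs ht

variable [IsManifold (𝓡 m) ∞ M]

theorem exists_injOn_of_diff_injective {ι : Type*} [Finite ι] {G : ι → M → ℝ} {p : M}
    (hG : ∀ i, ContMDiffAt (𝓡 m) 𝓘(ℝ, ℝ) ∞ (G i) p)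
    (hinj : ∀ u, (∀ i, diff (m := m) (G i) p u = 0) → u = 0) :
    ∃ O ∈ 𝓝 p, Set.InjOn (fun q i => G i q) O := by
  have := Fintype.ofFinite ι
  have hp := mem_extChartAt_source (I := 𝓡 m) p
  let Φ : EuclideanSpace ℝ (Fin m) → ι → ℝ := fun y i => G i ((extChartAt (𝓡 m) p).symm y)
  have hΦ : ContDiffAt ℝ ∞ Φ (extChartAt (𝓡 m) p p) :=
    contDiffAt_pi.2 fun i => contDiffAt_comp_extChartAt_symm hp (hG i)
  have hΦ' := hΦ.hasStrictFDerivAt (by simp)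
  obtain ⟨s, hs, hΦs⟩ := exists_injOn_of_hasStrictFDerivAt hΦ' <| by
    rw [injective_iff_map_eq_zero]
    intro u hu
    have hu0 := hinj (chartDInv p p u) fun i => by
      rw [diff_apply_eq_fderiv (hG i) hp, chartD_chartDInv hp]
      have hi := (hasFDerivAt_pi'.1 hΦ'.hasFDerivAt i).fderiv
      exact (congrArg (fun L => L u) hi).trans (congrFun hu i)
    rw [← chartD_chartDInv hp u, hu0, map_zero]
  refine ⟨_, Filter.inter_mem (extChartAt_source_mem_nhds (I := 𝓡 m) p)
    (continuousAt_extChartAt (I := 𝓡 m) p hs), fun q hq q' hq' hqq' => ?_⟩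
  refine (extChartAt (𝓡 m) p).injOn hq.1 hq'.1 (hΦs hq.2 hq'.2 ?_)
  simpa only [Φ, (extChartAt (𝓡 m) p).left_inv hq.1, (extChartAt (𝓡 m) p).left_inv hq'.1]
    using hqq'

theorem exists_smoothFunOn_diff_apply_pos {p : M} {v : TangentSpace (𝓡 m) p} (hv : v ≠ 0) :
    ∃ O : Set M, IsOpen O ∧ p ∈ O ∧ ∃ f : M → ℝ, SmoothFunOn (m := m) O f ∧
      0 < diff (m := m) f p v := by
  have hp := mem_extChartAt_source (I := 𝓡 m) p
  let z : EuclideanSpace ℝ (Fin m) := chartD p p v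
  have hz : z ≠ 0 := fun hz0 => hv <|
    (chartDInv_chartD hp v).symm.trans ((congrArg (chartDInv p p) hz0).trans (map_zero _))
  refine ⟨(extChartAt (𝓡 m) p).source, isOpen_extChartAt_source p, hp,
    innerSL ℝ z ∘ extChartAt (𝓡 m) p, fun q hq => (contMDiffAt_comp_extChartAt hq
      (innerSL ℝ z).contDiff.contDiffAt).contMDiffWithinAt, ?_⟩
  rw [diff_comp_extChartAt (innerSL ℝ z).differentiableAt hp, ContinuousLinearMap.fderiv]
  exact real_inner_self_pos.2 hz

theorem exists_injOn_levelSet_inter {ι : Type*} [Finite ι] {X : VField m M} {W : Set M}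
    (hW : IsOpen W) (hX : X.SmoothOn W) {I : ι → M → ℝ}
    (hI : ∀ i, SmoothFunOn (m := m) W (I i)) {p : M} (hp : p ∈ W) (hXp : X p ≠ 0)
    (hker : ∀ u, (∀ i, diff (m := m) (I i) p u = 0) → u ∈ Submodule.span ℝ {X p}) (c : ι → ℝ) :
    ∃ O : Set M, IsOpen O ∧ p ∈ O ∧ O ⊆ W ∧ ∃ f : M → ℝ, SmoothFunOn (m := m) O f ∧
      (∀ q ∈ O, 0 < diff (m := m) f q (X q)) ∧
      Set.InjOn f ({q | q ∈ W ∧ ∀ i, I i q = c i} ∩ O) := by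
  obtain ⟨O₁, hO₁, hpO₁, f, hf, hfp⟩ := exists_smoothFunOn_diff_apply_pos hXp
  obtain ⟨s, hs, hinj⟩ := exists_injOn_of_diff_injective (G := fun o : Option ι => o.elim f I)
    (p := p)
    (fun o => by
      cases o with
      | none => exact hf.contMDiffAt hO₁ hpO₁
      | some i => exact (hI i).contMDiffAt hW hp)
    (fun u hu => by
      obtain ⟨a, rfl⟩ := Submodule.mem_span_singleton.1 (hker u fun i => hu (some i))
      have ha : diff (m := m) f p (a • X p) = 0 := hu none
      rw [map_smul, smul_eq_mul] at ha
      rw [(mul_eq_zero.1 ha).resolve_right hfp.ne', zero_smul])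
  obtain ⟨O₂, hO₂s, hO₂, hpO₂⟩ := mem_nhds_iff.1 hs
  have hfW : SmoothFunOn (m := m) (W ∩ O₁) f := hf.mono Set.inter_subset_right
  have hfX : ContinuousOn (fun q => diff (m := m) f q (X q)) (W ∩ O₁) :=
    ((hfW.diff (hW.inter hO₁)).apply (hX.mono Set.inter_subset_left) (hW.inter hO₁)).continuousOn
  refine ⟨((W ∩ O₁) ∩ (fun q => diff (m := m) f q (X q)) ⁻¹' Set.Ioi 0) ∩ O₂,
    (hfX.isOpen_inter_preimage (hW.inter hO₁) isOpen_Ioi).inter hO₂, ⟨⟨⟨hp, hpO₁⟩, hfp⟩, hpO₂⟩,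
    fun q hq => hq.1.1.1, f, hf.mono fun q hq => hq.1.1.2, fun q hq => hq.1.2, ?_⟩
  rintro q ⟨hq, -, hqO₂⟩ q' ⟨hq', -, hqO₂'⟩ hqq'
  refine hinj (hO₂s hqO₂) (hO₂s hqO₂') (funext fun o => ?_)
  cases o with
  | none => exact hqq'
  | some i => exact (hq.2 i).trans (hq'.2 i).symm

theorem isIntegralManifold_levelSet {ι : Type*} [Finite ι] {X : VField m M} {W : Set M}
    (hW : IsOpen W) (hX : X.SmoothOn W) (hX0 : ∀ p ∈ W, X p ≠ 0) {I : ι → M → ℝ}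
    (hI : ∀ i, SmoothFunOn (m := m) W (I i))
    (hker : ∀ p ∈ W, ∀ u, (∀ i, diff (m := m) (I i) p u = 0) ↔ u ∈ Submodule.span ℝ {X p})
    (c : ι → ℝ) : IsIntegralManifold X {p | p ∈ W ∧ ∀ i, I i p = c i} := by
  rintro p ⟨hp, hpc⟩
  obtain ⟨O, hO, hpO, hOW, f, hf, hfX, hinj⟩ :=
    exists_injOn_levelSet_inter hW hX hI hp (hX0 p hp) (fun u => (hker p hp u).1) c
  obtain ⟨γ, hγ0, hγ⟩ := exists_isMIntegralCurveAt_of_contMDiffAt_boundaryless (I := 𝓡 m)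
    (x₀ := p) 0 ((hX.contMDiffAt hW hp).of_le (by simp))
  have hγO : ∀ᶠ t in 𝓝 (0 : ℝ), γ t ∈ O :=
    hγ.self_of_nhds.continuousAt.eventually_mem (hO.mem_nhds (by rwa [hγ0]))
  obtain ⟨ε, hε, hball⟩ := Metric.nhds_basis_closedBall.eventually_iff.1 (hγ.and hγO)
  simp only [Real.closedBall_eq_Icc, zero_sub, zero_add] at hball
  have hsub := Set.Ioo_subset_Icc_self (a := -ε) (b := ε)
  have hmono := strictMonoOn_comp_integralCurve hO hf hfX hball
  have hconst : ∀ t ∈ Set.Ioo (-ε) ε, ∀ i, I i (γ t) = c i := fun t ht i => by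
    have ht0 := comp_integralCurve_eq hW (hI i)
      (fun q hq => (hker q hq _).2 (Submodule.mem_span_singleton_self _) i)
      (fun s hs => ⟨(hball (hsub hs)).1, hOW (hball (hsub hs)).2⟩) ht
      (show (0 : ℝ) ∈ Set.Ioo (-ε) ε by simp [hε])
    rw [ht0, hγ0, hpc i]
  have hγcont : ContinuousOn γ (Set.Icc (-ε) ε) := fun t ht =>
    (hball ht).1.continuousAt.continuousWithinAt
  have himage := image_Ioo_eq_inter_of_strictMonoOn_comp (by linarith) hf.continuousOn hinj hγcont
    (fun t ht => (hball ht).2) (fun t ht => ⟨hOW (hball (hsub ht)).2, hconst t ht⟩) hmono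
  have hp' : p ∈ γ '' Set.Ioo (-ε) ε := ⟨0, by simp [hε], hγ0⟩
  exact ⟨_, hf.continuousOn.isOpen_inter_preimage hO isOpen_Ioo, (himage ▸ hp').2, ε, hε, γ, hγ0,
    fun t ht => (hball (hsub ht)).1.hasMFDerivWithinAt,
    isEmbedding_of_strictMonoOn_comp isPreconnected_Ioo (hγcont.mono hsub)
      (fun t ht => (hball (hsub ht)).2) hf.continuousOn (hmono.mono hsub), himage⟩

end LevelSets

section Integration

section Manifold

variable {m : ℕ} {M : Type*} [TopologicalSpace M] [ChartedSpace (EuclideanSpace ℝ (Fin m)) M]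

theorem TopForm.IsVolumeOn.apply_ne_zero {V : Set M} {Ω : TopForm m M} (hΩ : Ω.IsVolumeOn V) {p : M}
    (hp : p ∈ V) {v : Fin m → TangentSpace (𝓡 m) p} (hv : LinearIndependent ℝ v) : Ω p v ≠ 0 := by
  let b := Module.Basis.mk hv (hv.span_eq_top_of_card_eq_finrank'
    (by rw [finrank_tangentSpace, Fintype.card_fin])).ge
  have hb : (b : Fin m → TangentSpace (𝓡 m) p) = v := Module.Basis.coe_mk _ _
  rw [← hb]
  exact (AlternatingMap.map_basis_ne_zero_iff b (Ω p).toAlternatingMap).2 fun hΩ0 =>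
    hΩ.ne_zero p hp (ContinuousAlternatingMap.ext fun v => DFunLike.congr_fun hΩ0 v)

theorem TopForm.apply_update_eq_dualForm_mul {e : Fin m → VField m M} {p : M}
    (he : LinearIndependent ℝ fun i => e i p) (Ω : TopForm m M) (i : Fin m)
    (v : TangentSpace (𝓡 m) p) :
    Ω p (Function.update (fun c => e c p) i v) = dualForm e i p v * Ω p fun c => e c p := by
  conv_lhs => rw [← sum_dualForm he v]
  rw [← ContinuousAlternatingMap.coe_toAlternatingMap, AlternatingMap.map_update_sum]
  simp only [AlternatingMap.map_update_smul, smul_eq_mul]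
  rw [Finset.sum_eq_single i, Function.update_eq_self]
  · intro a _ ha
    rw [AlternatingMap.map_update_self _ _ ha.symm, mul_zero]
  · simp

theorem pfaffForm_apply {N : ℕ} {M : Type*} [TopologicalSpace M]
    [ChartedSpace (EuclideanSpace ℝ (Fin (N + 1))) M] (Ω : TopForm (N + 1) M)
    (e : Fin (N + 1) → VField (N + 1) M) (i : Fin N) (p : M) (v : TangentSpace (𝓡 (N + 1)) p) :
    pfaffForm Ω (e 0) (fun j => e j.succ) i p v =
      (-1) ^ (N - 1 - (i : ℕ)) * Ω p (Function.update (fun c => e c p) i.succ v) := by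
  have hcons : (Fin.cons (α := fun _ => TangentSpace (𝓡 (N + 1)) p) (e 0 p)
      fun j => e j.succ p) = fun c => e c p := by
    funext c
    refine Fin.cases ?_ (fun j => ?_) c <;> rfl
  rw [← hcons]
  rfl

end Manifold

variable {N : ℕ} {M : Type*} [TopologicalSpace M]
  [ChartedSpace (EuclideanSpace ℝ (Fin (N + 1))) M] [IsManifold (𝓡 (N + 1)) ∞ M]
  {V : Set M} {e : Fin (N + 1) → VField (N + 1) M}

theorem IsScaledDual.integratedByPfaff {g : Fin N → M → ℝ} {w : Fin N → OneForm (N + 1) M}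
    (h : IsScaledDual V e g w) : IntegratedByPfaff V (e 0) w where
  smooth := h.smoothOn
  indep _ hp := h.linearIndependent hp
  annihilator _ hp := h.forall_eq_zero_iff_mem_span hp
  completely_integrable := h.completely_integrable
  solvable W hW hWV I k hI p hp := h.exists_solution hW hWV hI hp
  integral W hW hWV I hI c := by
    refine isIntegralManifold_levelSet hW ((h.flag.smooth 0).mono hWV)
      (fun p hp => (h.flag.indep p (hWV hp)).ne_zero 0) (fun i => (hI i).smooth)
      (fun p hp u => ?_) c
    rw [← h.forall_eq_zero_iff_mem_span (hWV hp)]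
    simpa only [Set.mem_univ, true_implies] using
      h.diff_eq_zero_iff hWV hp isUpperSet_univ (fun l _ => hI l) u

theorem isScaledDual_pfaffForm (he : IsInvolutiveFlag V e) {Ω : TopForm (N + 1) M}
    (hΩ : Ω.IsVolumeOn V) :
    IsScaledDual V e (fun i p => (-1 : ℝ) ^ (N - 1 - (i : ℕ)) * Ω p fun c => e c p)
      (pfaffForm Ω (e 0) fun j => e j.succ) where
  flag := he
  smooth i := ContMDiffOn.mul contMDiffOn_const (hΩ.smoothFunOn_apply he.isOpen he.smooth)
  ne_zero p hp i :=
    mul_ne_zero (pow_ne_zero _ (by norm_num)) (hΩ.apply_ne_zero hp (he.indep p hp))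
  eq p hp i v := by
    rw [pfaffForm_apply, TopForm.apply_update_eq_dualForm_mul (he.indep p hp)]
    ring

end Integration

/-! ### Hamiltonian vector fields on a contact manifold -/

section ContactAlgebra

variable {m : ℕ} {M : Type*} [TopologicalSpace M] [ChartedSpace (EuclideanSpace ℝ (Fin m)) M]

theorem SmoothFunOn.mdifferentiableAt {f : M → ℝ} {V : Set M}
    (hf : SmoothFunOn (m := m) V f) (hV : IsOpen V) {p : M} (hp : p ∈ V) :
    MDifferentiableAt (𝓡 m) 𝓘(ℝ, ℝ) f p :=
  (hf.contMDiffAt hV hp).mdifferentiableAt (by simp)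

theorem diff_mul {f g : M → ℝ} {p : M} (hf : MDifferentiableAt (𝓡 m) 𝓘(ℝ, ℝ) f p)
    (hg : MDifferentiableAt (𝓡 m) 𝓘(ℝ, ℝ) g p) (v : TangentSpace (𝓡 m) p) :
    diff (m := m) (fun q => f q * g q) p v =
      f p * diff (m := m) g p v + g p * diff (m := m) f p v :=
  congrArg (fun L => L v) (hf.hasMFDerivAt.mul hg.hasMFDerivAt).mfderiv

theorem diff_add {f g : M → ℝ} {p : M} (hf : MDifferentiableAt (𝓡 m) 𝓘(ℝ, ℝ) f p)
    (hg : MDifferentiableAt (𝓡 m) 𝓘(ℝ, ℝ) g p) (v : TangentSpace (𝓡 m) p) :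
    diff (m := m) (fun q => f q + g q) p v = diff (m := m) f p v + diff (m := m) g p v :=
  congrArg (fun L => L v) (hf.hasMFDerivAt.add hg.hasMFDerivAt).mfderiv

theorem diff_neg (f : M → ℝ) (p : M) (v : TangentSpace (𝓡 m) p) :
    diff (m := m) (fun q => -f q) p v = -diff (m := m) f p v :=
  DFunLike.congr_fun (mfderiv_neg (f := f) (x := p)) v

theorem diff_comp {ι : Type*} [Fintype ι] [DecidableEq ι] {f : ι → M → ℝ} {G : (ι → ℝ) → ℝ}
    {p : M} (hf : ∀ k, ContMDiffAt (𝓡 m) 𝓘(ℝ, ℝ) ∞ (f k) p)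
    (hG : DifferentiableAt ℝ G fun k => f k p) (v : TangentSpace (𝓡 m) p) :
    diff (m := m) (fun q => G fun k => f k q) p v =
      ∑ k, fderiv ℝ G (fun k => f k p) (Pi.single k 1) * diff (m := m) (f k) p v := by
  have hf' := ((contMDiffAt_pi_space.2 hf : ContMDiffAt (𝓡 m) 𝓘(ℝ, ι → ℝ) ∞
    (fun q k => f k q) p).mdifferentiableAt (by simp)).hasMFDerivAt
  let z : ι → ℝ := mfderiv (𝓡 m) 𝓘(ℝ, ι → ℝ) (fun q k => f k q) p v
  have hz : ∀ k, z k = diff (m := m) (f k) p v := fun k =>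
    (congrArg (fun L => L v) (((ContinuousLinearMap.proj (R := ℝ) (φ := fun _ : ι => ℝ)
      k).hasMFDerivAt (x := fun k => f k p)).comp p hf').mfderiv).symm
  have hchain : diff (m := m) (fun q => G fun k => f k q) p v = fderiv ℝ G (fun k => f k p) z :=
    congrArg (fun L => L v) (hG.hasFDerivAt.hasMFDerivAt.comp p hf').mfderiv
  have hsum : z = ∑ k, z k • Pi.single k (1 : ℝ) := by
    simp only [← Pi.single_smul, smul_eq_mul, mul_one, Finset.univ_sum_single]
  rw [hchain, hsum, map_sum]
  simp only [map_smul, smul_eq_mul, hz, mul_comm]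

theorem flat_apply (η : OneForm m M) {p : M} (v u : TangentSpace (𝓡 m) p) :
    flat η p v u = η.extd p v u + η p v * η p u := rfl

theorem sharp_diff (η : OneForm m M) (f : M → ℝ) (p : M) :
    sharp η p (diff f p) = ham η f p + (diff f p (reeb η p) + f p) • reeb η p := by
  rw [ham, map_sub, map_smul]
  exact (sub_add_cancel _ _).symm

variable [IsManifold (𝓡 m) ∞ M]

theorem extd_self (α : OneForm m M) {p : M} (v : TangentSpace (𝓡 m) p) : α.extd p v v = 0 :=
  self_eq_neg.1 (α.extd_skew p v v)

namespace IsContactForm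

variable {η : OneForm m M}

theorem flat_injective (hη : IsContactForm η) (p : M) : Function.Injective (flat η p) := by
  rw [injective_iff_map_eq_zero]
  intro v hv
  have hvu : ∀ u, η.extd p v u + η p v * η p u = 0 := fun u => congrArg (fun L => L u) hv
  have hηv : η p v = 0 := by
    have hvv := hvu v
    rw [extd_self, zero_add] at hvv
    exact mul_self_eq_zero.1 hvv
  exact hη.nondegenerate p v hηv fun u _ => by simpa only [hηv, zero_mul, add_zero] using hvu u

theorem flat_isInvertible (hη : IsContactForm η) (p : M) : (flat η p).IsInvertible := by
  have : FiniteDimensional ℝ (TangentSpace (𝓡 m) p →L[ℝ] ℝ) :=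
    inferInstanceAs (FiniteDimensional ℝ (EuclideanSpace ℝ (Fin m) →L[ℝ] ℝ))
  refine isInvertible_of_injective (hη.flat_injective p) ?_
  rw [← (LinearMap.toContinuousLinearMap (𝕜 := ℝ) (E := TangentSpace (𝓡 m) p)
    (F' := ℝ)).finrank_eq]
  exact Subspace.dual_finrank_eq.symm

theorem flat_sharp (hη : IsContactForm η) (p : M) (α : TangentSpace (𝓡 m) p →L[ℝ] ℝ) :
    flat η p (sharp η p α) = α := (hη.flat_isInvertible p).self_apply_inverse α

theorem eq_of_apply_of_extd (hη : IsContactForm η) {p : M} {v v' : TangentSpace (𝓡 m) p}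
    (h : η p v = η p v') (hd : ∀ u, η.extd p v u = η.extd p v' u) : v = v' := by
  refine hη.flat_injective p (ContinuousLinearMap.ext fun u => ?_)
  rw [flat_apply, flat_apply, h, hd]

theorem extd_reeb_add (hη : IsContactForm η) {p : M} (u : TangentSpace (𝓡 m) p) :
    η.extd p (reeb η p) u + η p (reeb η p) * η p u = η p u :=
  congrArg (fun L => L u) (hη.flat_sharp p (η p))

theorem apply_reeb (hη : IsContactForm η) (p : M) : η p (reeb η p) = 1 := by
  have hsq := hη.extd_reeb_add (reeb η p)
  rw [extd_self, zero_add] at hsq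
  refine (mul_left_eq_self₀.1 hsq).resolve_right fun hzero => ?_
  have hreeb : reeb η p = 0 := hη.nondegenerate p _ hzero fun u hu => by
    simpa only [hu, mul_zero, add_zero] using hη.extd_reeb_add u
  refine hη.ne_zero p (ContinuousLinearMap.ext fun u => ?_)
  rw [← hη.extd_reeb_add u, hreeb]
  simp only [map_zero, zero_apply, zero_mul, add_zero]

theorem extd_reeb (hη : IsContactForm η) {p : M} (u : TangentSpace (𝓡 m) p) :
    η.extd p (reeb η p) u = 0 := by
  simpa only [hη.apply_reeb, one_mul, add_eq_right] using hη.extd_reeb_add u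

theorem flat_ham (hη : IsContactForm η) (f : M → ℝ) (p : M) :
    flat η p (ham η f p) = diff f p - (diff f p (reeb η p) + f p) • η p := hη.flat_sharp p _

theorem extd_ham_add (hη : IsContactForm η) (f : M → ℝ) {p : M} (u : TangentSpace (𝓡 m) p) :
    η.extd p (ham η f p) u + η p (ham η f p) * η p u =
      diff f p u - (diff f p (reeb η p) + f p) * η p u :=
  congrArg (fun L => L u) (hη.flat_ham f p)

theorem apply_ham (hη : IsContactForm η) (f : M → ℝ) (p : M) : η p (ham η f p) = -f p := by
  have h := hη.extd_ham_add f (reeb η p)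
  rw [η.extd_skew, hη.extd_reeb, hη.apply_reeb] at h
  linarith

theorem extd_ham (hη : IsContactForm η) (f : M → ℝ) {p : M} (u : TangentSpace (𝓡 m) p) :
    η.extd p (ham η f p) u = diff f p u - diff f p (reeb η p) * η p u := by
  have h := hη.extd_ham_add f u
  rw [hη.apply_ham] at h
  linarith

theorem diff_apply_ham (hη : IsContactForm η) (f : M → ℝ) {p : M} (v : TangentSpace (𝓡 m) p) :
    diff (m := m) (fun q => η q (ham η f q)) p v = -diff (m := m) f p v := by
  simp only [hη.apply_ham, diff_neg]

theorem jacobiBracket_eq (hη : IsContactForm η) (f g : M → ℝ) (p : M) :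
    jacobiBracket η f g p = diff g p (ham η f p) + g p * diff f p (reeb η p) := by
  have hreeb : ∀ u, η.extd p u (reeb η p) = 0 := fun u => by
    rw [η.extd_skew, hη.extd_reeb, neg_zero]
  have hsharp : η.extd p (sharp η p (diff f p)) (sharp η p (diff g p)) =
      -η.extd p (ham η g p) (ham η f p) := by
    simp only [sharp_diff, map_add, map_smul, add_apply, smul_apply, hη.extd_reeb, hreeb,
      smul_zero, add_zero]
    exact η.extd_skew p _ _
  rw [jacobiBracket, bivector, hsharp, hη.extd_ham, hη.apply_ham, jacobiE, map_neg, map_neg]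
  ring

theorem ham_comp (hη : IsContactForm η) {ι : Type*} [Fintype ι] [DecidableEq ι]
    {f : ι → M → ℝ} {G : (ι → ℝ) → ℝ} {p : M}
    (hf : ∀ k, ContMDiffAt (𝓡 m) 𝓘(ℝ, ℝ) ∞ (f k) p) (hG : DifferentiableAt ℝ G fun k => f k p) :
    ham η (fun q => G fun k => f k q) p =
      ∑ k, fderiv ℝ G (fun k => f k p) (Pi.single k 1) • ham η (f k) p +
        (G (fun k => f k p) - ∑ k, f k p * fderiv ℝ G (fun k => f k p) (Pi.single k 1)) •
          jacobiE η p := by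
  refine hη.eq_of_apply_of_extd ?_ fun u => ?_
  · simp only [hη.apply_ham, map_add, map_sum, map_smul, jacobiE, map_neg, hη.apply_reeb,
      smul_eq_mul, mul_neg, mul_one, Finset.sum_neg_distrib, mul_comm (f _ p)]
    ring
  · simp only [hη.extd_ham, map_add, map_sum, map_smul, jacobiE, map_neg, add_apply, sum_apply,
      smul_apply, neg_apply, hη.extd_reeb, diff_comp hf hG, smul_eq_mul, mul_sub,
      Finset.sum_sub_distrib, Finset.sum_mul, neg_zero, mul_zero, add_zero, mul_assoc]

end IsContactForm

end ContactAlgebra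

section ContactCalculus

variable {m : ℕ} {M : Type*} [TopologicalSpace M] [ChartedSpace (EuclideanSpace ℝ (Fin m)) M]
  [IsManifold (𝓡 m) ∞ M] {η : OneForm m M} {V : Set M}

theorem eq_zero_of_coordField {x q : M} (hq : q ∈ (extChartAt (𝓡 m) x).source)
    {α : TangentSpace (𝓡 m) q →L[ℝ] ℝ}
    (hα : ∀ i, α (coordField x (EuclideanSpace.basisFun (Fin m) ℝ i) q) = 0) : α = 0 := by
  have hcomp : α.comp (chartDInv x q) = 0 :=
    ContinuousLinearMap.coe_injective ((EuclideanSpace.basisFun (Fin m) ℝ).toBasis.ext fun i => by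
      rw [OrthonormalBasis.coe_toBasis]; exact hα i)
  refine ContinuousLinearMap.ext fun v => ?_
  rw [← chartDInv_chartD hq v]
  exact congrArg (fun L => L (chartD x q v)) hcomp

theorem mlieBracket_mlieBracket_left {X Y Z : VField m M} (hV : IsOpen V) (hX : X.SmoothOn V)
    (hY : Y.SmoothOn V) (hZ : Z.SmoothOn V) {p : M} (hp : p ∈ V) :
    VectorField.mlieBracket (𝓡 m) (VectorField.mlieBracket (𝓡 m) X Y) Z p =
      VectorField.mlieBracket (𝓡 m) X (VectorField.mlieBracket (𝓡 m) Y Z) p -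
      VectorField.mlieBracket (𝓡 m) Y (VectorField.mlieBracket (𝓡 m) X Z) p := by
  have := isManifold_minSmoothness (m := m) (M := M) 3
  rw [VectorField.leibniz_identity_mlieBracket_apply (I := 𝓡 m) (U := X)
    ((hX.contMDiffAt hV hp).of_le minSmoothness_two_le_infty)
    ((hY.contMDiffAt hV hp).of_le minSmoothness_two_le_infty)
    ((hZ.contMDiffAt hV hp).of_le minSmoothness_two_le_infty)]
  exact (add_sub_cancel_right _ _).symm

namespace IsContactForm

theorem smoothOn_of_flat (hη : IsContactForm η) {Z : VField m M}
    (hZ : OneForm.SmoothOn Set.univ fun p => flat η p (Z p)) : Z.SmoothOn Set.univ := by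
  intro x _
  let W := (extChartAt (𝓡 m) x).source
  have hW : IsOpen W := isOpen_extChartAt_source x
  let e : Fin m → VField m M := fun i => coordField x (EuclideanSpace.basisFun (Fin m) ℝ i)
  have he : ∀ i, (e i).SmoothOn W := fun i => smoothOn_coordField x _
  -- The 1-form `v ↦ flat v (e i)`: pairing it with `Z` only involves the smooth form `flat Z`.
  let β : Fin m → OneForm m M := fun i p => -η.extd p (e i p) + η p (e i p) • η p
  have hβ : ∀ i p v, β i p v = flat η p v (e i p) := fun i p v => by
    rw [flat_apply, η.extd_skew p v, mul_comm]
    rfl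
  refine ((VField.smoothOn_of_coframe (β := β) hW (fun i => ?_) (fun p hp v hv => ?_)
    fun i => ?_).contMDiffAt hW (mem_extChartAt_source (I := 𝓡 m) x)).contMDiffWithinAt
  · refine OneForm.smoothOn_of_apply hW fun Y W' hW' hWW' hY => ?_
    have hηW := hη.smooth.mono (Set.subset_univ W')
    have hei := (he i).mono hWW'
    simp only [hβ]
    exact ContMDiffOn.add (hηW.extd_apply hY hei hW')
      (ContMDiffOn.mul (hηW.apply hY hW') (hηW.apply hei hW'))
  · simp only [hβ] at hv
    exact (injective_iff_map_eq_zero _).1 (hη.flat_injective p) v (eq_zero_of_coordField hp hv)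
  · simp only [hβ]
    exact (hZ.mono (Set.subset_univ W)).apply (he i) hW

theorem smoothOn_reeb (hη : IsContactForm η) : (reeb η).SmoothOn Set.univ := by
  refine hη.smoothOn_of_flat ?_
  have hflat : (fun p => flat η p (reeb η p)) = η := funext fun p => hη.flat_sharp p (η p)
  rw [hflat]
  exact hη.smooth

theorem smoothFunOn_diff_reeb (hη : IsContactForm η) {f : M → ℝ}
    (hf : SmoothFunOn (m := m) Set.univ f) :
    SmoothFunOn (m := m) Set.univ fun p => diff f p (reeb η p) :=
  (hf.diff isOpen_univ).apply hη.smoothOn_reeb isOpen_univ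

theorem smoothOn_ham (hη : IsContactForm η) {f : M → ℝ} (hf : SmoothFunOn (m := m) Set.univ f) :
    (ham η f).SmoothOn Set.univ := by
  refine hη.smoothOn_of_flat ?_
  simp only [hη.flat_ham]
  refine OneForm.smoothOn_of_apply isOpen_univ fun Z W hW _ hZ => ?_
  have hWu := Set.subset_univ W
  exact ContMDiffOn.sub (((hf.diff isOpen_univ).mono hWu).apply hZ hW)
    (ContMDiffOn.mul (((hη.smoothFunOn_diff_reeb hf).mono hWu).add (hf.mono hWu))
      ((hη.smooth.mono hWu).apply hZ hW))

theorem apply_mlieBracket_ham (hη : IsContactForm η) {f : M → ℝ}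
    (hf : SmoothFunOn (m := m) Set.univ f) (hV : IsOpen V) {Z : VField m M} (hZ : Z.SmoothOn V)
    {p : M} (hp : p ∈ V) :
    η p (VectorField.mlieBracket (𝓡 m) (ham η f) Z p) =
      diff (m := m) (fun q => η q (Z q)) p (ham η f p) +
        diff (m := m) f p (reeb η p) * η p (Z p) := by
  have h := extd_apply_eq_sub_mlieBracket hV (hη.smooth.mono (Set.subset_univ V))
    ((hη.smoothOn_ham hf).mono (Set.subset_univ V)) hZ hp
  rw [hη.extd_ham, hη.diff_apply_ham] at h
  linarith

/- The hypothesis on `B` says that `(L_B η)(p) = -c η(p)`, since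
`(L_B η)(Z) = B(η(Z)) - η([B, Z])`: infinitesimal contact transformations are Hamiltonian. -/
theorem eq_ham_of_apply_mlieBracket (hη : IsContactForm η) {B : VField m M}
    (hB : B.SmoothOn Set.univ) {p : M} {c : ℝ}
    (hc : ∀ (V : Set M) (Z : VField m M), IsOpen V → p ∈ V → Z.SmoothOn V →
      η p (VectorField.mlieBracket (𝓡 m) B Z p) =
        diff (m := m) (fun q => η q (Z q)) p (B p) + c * η p (Z p)) :
    B p = ham η (fun q => -η q (B q)) p := by
  have hextd : ∀ (V : Set M) (Z : VField m M), IsOpen V → p ∈ V → Z.SmoothOn V →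
      η.extd p (B p) (Z p) = diff (m := m) (fun q => -η q (B q)) p (Z p) - c * η p (Z p) := by
    intro V Z hV hp hZ
    rw [extd_apply_eq_sub_mlieBracket hV (hη.smooth.mono (Set.subset_univ V))
      (hB.mono (Set.subset_univ V)) hZ hp, hc V Z hV hp hZ, diff_neg]
    ring
  have hreeb : diff (m := m) (fun q => -η q (B q)) p (reeb η p) = c := by
    have h := hextd _ _ isOpen_univ (Set.mem_univ p) hη.smoothOn_reeb
    rw [η.extd_skew, hη.extd_reeb, hη.apply_reeb] at h
    linarith
  refine hη.eq_of_apply_of_extd (by rw [hη.apply_ham, neg_neg]) fun u => ?_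
  have hp := mem_extChartAt_source (I := 𝓡 m) p
  have hu : coordField p (chartD p p u) p = u := chartDInv_chartD hp u
  rw [hη.extd_ham, hreeb, ← hu]
  exact hextd _ _ (isOpen_extChartAt_source (I := 𝓡 m) p) hp (smoothOn_coordField p _)

theorem apply_mlieBracket_ham_mlieBracket_ham (hη : IsContactForm η) {f g : M → ℝ}
    (hf : SmoothFunOn (m := m) Set.univ f) (hg : SmoothFunOn (m := m) Set.univ g) (hV : IsOpen V)
    {Z : VField m M} (hZ : Z.SmoothOn V) {p : M} (hp : p ∈ V) :
    η p (VectorField.mlieBracket (𝓡 m) (ham η f) (VectorField.mlieBracket (𝓡 m) (ham η g) Z) p) =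
      diff (m := m) (fun q => diff (m := m) (fun q => η q (Z q)) q (ham η g q)) p (ham η f p) +
        (diff (m := m) g p (reeb η p) * diff (m := m) (fun q => η q (Z q)) p (ham η f p) +
          η p (Z p) * diff (m := m) (fun q => diff (m := m) g q (reeb η q)) p (ham η f p)) +
        diff (m := m) f p (reeb η p) * (diff (m := m) (fun q => η q (Z q)) p (ham η g p) +
          diff (m := m) g p (reeb η p) * η p (Z p)) := by
  have hVu := Set.subset_univ V
  have hXg := (hη.smoothOn_ham hg).mono hVu
  have hgR : SmoothFunOn V _ := (hη.smoothFunOn_diff_reeb hg).mono hVu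
  have hηZ : SmoothFunOn V _ := (hη.smooth.mono hVu).apply hZ hV
  have hXgηZ : SmoothFunOn V _ := (hηZ.diff hV).apply hXg hV
  have hgRηZ : SmoothFunOn (m := m) V fun q => diff (m := m) g q (reeb η q) * η q (Z q) :=
    ContMDiffOn.mul hgR hηZ
  rw [hη.apply_mlieBracket_ham hf hV (VField.SmoothOn.mlieBracket hV hXg hZ) hp,
    diff_congr hV (fun q hq => hη.apply_mlieBracket_ham hg hV hZ hq) hp,
    diff_add (hXgηZ.mdifferentiableAt hV hp) (hgRηZ.mdifferentiableAt hV hp),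
    diff_mul (hgR.mdifferentiableAt hV hp) (hηZ.mdifferentiableAt hV hp),
    hη.apply_mlieBracket_ham hg hV hZ hp]

theorem apply_mlieBracket_mlieBracket_ham_ham (hη : IsContactForm η) {f g : M → ℝ}
    (hf : SmoothFunOn (m := m) Set.univ f) (hg : SmoothFunOn (m := m) Set.univ g) (hV : IsOpen V)
    {Z : VField m M} (hZ : Z.SmoothOn V) {p : M} (hp : p ∈ V) :
    η p (VectorField.mlieBracket (𝓡 m) (VectorField.mlieBracket (𝓡 m) (ham η f) (ham η g)) Z p) =
      diff (m := m) (fun q => η q (Z q)) p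
        (VectorField.mlieBracket (𝓡 m) (ham η f) (ham η g) p) +
      (diff (m := m) (fun q => diff (m := m) g q (reeb η q)) p (ham η f p) -
        diff (m := m) (fun q => diff (m := m) f q (reeb η q)) p (ham η g p)) * η p (Z p) := by
  have hVu := Set.subset_univ V
  have hXf := (hη.smoothOn_ham hf).mono hVu
  have hXg := (hη.smoothOn_ham hg).mono hVu
  rw [mlieBracket_mlieBracket_left hV hXf hXg hZ hp, map_sub,
    hη.apply_mlieBracket_ham_mlieBracket_ham hf hg hV hZ hp,
    hη.apply_mlieBracket_ham_mlieBracket_ham hg hf hV hZ hp,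
    diff_mlieBracket hV ((hη.smooth.mono hVu).apply hZ hV) hXf hXg hp]
  ring

theorem apply_mlieBracket_ham_ham (hη : IsContactForm η) {f g : M → ℝ}
    (hf : SmoothFunOn (m := m) Set.univ f) (hg : SmoothFunOn (m := m) Set.univ g) (p : M) :
    η p (VectorField.mlieBracket (𝓡 m) (ham η f) (ham η g) p) = -jacobiBracket η f g p := by
  rw [hη.jacobiBracket_eq, hη.apply_mlieBracket_ham hf isOpen_univ (hη.smoothOn_ham hg)
    (Set.mem_univ p), hη.diff_apply_ham, hη.apply_ham]
  ring

theorem mlieBracket_ham (hη : IsContactForm η) {f g : M → ℝ}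
    (hf : SmoothFunOn (m := m) Set.univ f) (hg : SmoothFunOn (m := m) Set.univ g) (p : M) :
    VectorField.mlieBracket (𝓡 m) (ham η f) (ham η g) p = ham η (jacobiBracket η f g) p := by
  have hB := VField.SmoothOn.mlieBracket isOpen_univ (hη.smoothOn_ham hf) (hη.smoothOn_ham hg)
  rw [hη.eq_ham_of_apply_mlieBracket hB fun V Z hV hp hZ =>
    hη.apply_mlieBracket_mlieBracket_ham_ham hf hg hV hZ hp]
  simp only [hη.apply_mlieBracket_ham_ham hf hg, neg_neg]

end IsContactForm

end ContactCalculus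

/-! ### Local complements and volume forms -/

section Local

variable {m : ℕ} {M : Type*} [TopologicalSpace M] [ChartedSpace (EuclideanSpace ℝ (Fin m)) M]

/-- The determinant on `ℝ^m`, as a continuous alternating map. -/
def detForm (m : ℕ) : EuclideanSpace ℝ (Fin m) [⋀^Fin m]→L[ℝ] ℝ where
  toMultilinearMap := (EuclideanSpace.basisFun (Fin m) ℝ).toBasis.det.toMultilinearMap
  cont := by
    change Continuous fun v => (EuclideanSpace.basisFun (Fin m) ℝ).toBasis.det v
    simp only [Module.Basis.det_apply]
    exact Continuous.matrix_det (continuous_matrix fun i j =>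
      (EuclideanSpace.proj (𝕜 := ℝ) i).continuous.comp (continuous_apply j))
  map_eq_zero_of_eq' v i j h hij :=
    (EuclideanSpace.basisFun (Fin m) ℝ).toBasis.det.map_eq_zero_of_eq v h hij

/-- The volume form `dx₁ ∧ ⋯ ∧ dx_m` of the preferred chart at `p`. -/
def chartVolume (p : M) : TopForm m M := fun q =>
  (detForm m).compContinuousLinearMap (chartD p q)

theorem TopForm.rep_eq_smul_detForm (Ω : TopForm m M) {x : M} {y : EuclideanSpace ℝ (Fin m)} :
    Ω.rep x y = Ω.rep x y (EuclideanSpace.basisFun (Fin m) ℝ).toBasis • detForm m :=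
  ContinuousAlternatingMap.ext fun v => DFunLike.congr_fun
    ((Ω.rep x y).toAlternatingMap.eq_smul_basis_det (EuclideanSpace.basisFun (Fin m) ℝ).toBasis) v

variable [IsManifold (𝓡 m) ∞ M]

theorem isOpen_setOf_linearIndependent_fields {ι : Type*} [Finite ι] {Y : ι → VField m M}
    {V : Set M} (hV : IsOpen V) (hY : ∀ i, (Y i).SmoothOn V) :
    IsOpen (V ∩ {p | LinearIndependent ℝ fun i => Y i p}) := by
  have := Fintype.ofFinite ι
  refine isOpen_iff_mem_nhds.2 fun p hp => ?_
  have hps := mem_extChartAt_source (I := 𝓡 m) p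
  have hcont : ContinuousAt (fun q i => (Y i).coords p q) p :=
    continuousAt_pi.2 fun i => ((hY i).contMDiffAt_coords hV hp.1 hps).continuousAt
  have hiff : ∀ q ∈ (extChartAt (𝓡 m) p).source,
      LinearIndependent ℝ (fun i => (Y i).coords p q) ↔ LinearIndependent ℝ fun i => Y i q :=
    fun q hq => LinearMap.linearIndependent_iff (v := fun i => Y i q)
      (chartEquiv hq).toLinearEquiv.toLinearMap (chartEquiv hq).toLinearEquiv.ker
  have hopen : IsOpen {f : ι → EuclideanSpace ℝ (Fin m) | LinearIndependent ℝ f} :=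
    isOpen_setOfPred_linearIndependent
  filter_upwards [hV.mem_nhds hp.1, extChartAt_source_mem_nhds (I := 𝓡 m) p,
    hcont.eventually_mem (hopen.mem_nhds ((hiff p hps).2 hp.2))] with q hqV hqs hq
  exact ⟨hqV, (hiff q hqs).1 hq⟩

theorem contDiffAt_chartVolume_rep {p x : M} {y : EuclideanSpace ℝ (Fin m)}
    (hy : y ∈ (extChartAt (𝓡 m) x).target)
    (hyp : (extChartAt (𝓡 m) x).symm y ∈ (extChartAt (𝓡 m) p).source) :
    ContDiffAt ℝ ∞ ((chartVolume (m := m) p).rep x) y := by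
  let b := (EuclideanSpace.basisFun (Fin m) ℝ).toBasis
  have hys := (extChartAt (𝓡 m) x).map_target hy
  have hcoord : ∀ i, ContDiffAt ℝ ∞
      ((coordField x (b i)).coords p ∘ (extChartAt (𝓡 m) x).symm) y := fun i => by
    have h := contDiffAt_comp_extChartAt_symm hys
      ((smoothOn_coordField x (b i)).contMDiffAt_coords (isOpen_extChartAt_source x) hys hyp)
    rwa [(extChartAt (𝓡 m) x).right_inv hy] at h
  refine ((contDiffAt_basis_det hcoord).smul
    (contDiffAt_const (c := detForm m))).congr_of_eventuallyEq ?_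
  filter_upwards [(isOpen_extChartAt_target x).mem_nhds hy] with z hz
  have hrep := (chartVolume p).rep_extChartAt ((extChartAt (𝓡 m) x).map_target hz) b
  rw [(extChartAt (𝓡 m) x).right_inv hz] at hrep
  rw [TopForm.rep_eq_smul_detForm, hrep]
  rfl

theorem isVolumeOn_chartVolume (p : M) :
    (chartVolume (m := m) p).IsVolumeOn (extChartAt (𝓡 m) p).source where
  smooth _ _ hy := (contDiffAt_chartVolume_rep hy.1 hy.2).contDiffWithinAt
  ne_zero q hq hzero := by
    let b := (EuclideanSpace.basisFun (Fin m) ℝ).toBasis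
    have hdet : detForm m (fun i => chartD p q (chartDInv p q (b i))) = 0 :=
      DFunLike.congr_fun hzero fun i => chartDInv p q (b i)
    simp only [chartD_chartDInv hq] at hdet
    exact one_ne_zero (b.det_self.symm.trans hdet)

end Local

/-! ### The frame completed by a transversal field -/

section Completed

variable {n : ℕ} {M : Type*} [TopologicalSpace M]
  [ChartedSpace (EuclideanSpace ℝ (Fin (2 * n + 1))) M]
  {η : OneForm (2 * n + 1) M} {H : C^∞⟮𝓡 (2 * n + 1), M; ℝ⟯}
  {F : Fin (2 * n - 1) → C^∞⟮𝓡 (2 * n + 1), M; ℝ⟯} {R : VField (2 * n + 1) M} {V : Set M}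

/-- The frame `(X_H, X_{f_1}, …, X_{f_{2n-1}}, R)`. -/
def completedFrame (η : OneForm (2 * n + 1) M) (H : C^∞⟮𝓡 (2 * n + 1), M; ℝ⟯)
    (F : Fin (2 * n - 1) → C^∞⟮𝓡 (2 * n + 1), M; ℝ⟯) (R : VField (2 * n + 1) M) :
    Fin (2 * n + 1) → VField (2 * n + 1) M :=
  Fin.cons (α := fun _ => VField (2 * n + 1) M) (ham η H) (completed η F R)

theorem completedFrame_castSucc (η : OneForm (2 * n + 1) M) (H : C^∞⟮𝓡 (2 * n + 1), M; ℝ⟯)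
    (F : Fin (2 * n - 1) → C^∞⟮𝓡 (2 * n + 1), M; ℝ⟯) (R : VField (2 * n + 1) M)
    (j : Fin (2 * n)) : completedFrame η H F R j.castSucc = ham η (family H F j) := by
  obtain ⟨_ | v, hv⟩ := j
  · rfl
  · change completed η F R ⟨v, _⟩ = _
    rw [completed, dif_pos (show v < 2 * n - 1 by omega), family, dif_neg (Nat.succ_ne_zero v)]
    rfl

theorem completedFrame_last (hn : 1 ≤ n) (η : OneForm (2 * n + 1) M)
    (H : C^∞⟮𝓡 (2 * n + 1), M; ℝ⟯) (F : Fin (2 * n - 1) → C^∞⟮𝓡 (2 * n + 1), M; ℝ⟯)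
    (R : VField (2 * n + 1) M) : completedFrame η H F R (Fin.last (2 * n)) = R := by
  have hlast : Fin.last (2 * n) = (⟨2 * n - 1, by omega⟩ : Fin (2 * n)).succ :=
    Fin.ext (by simp only [Fin.val_last, Fin.val_succ]; omega)
  rw [hlast]
  change completed η F R ⟨2 * n - 1, _⟩ = _
  rw [completed, dif_neg (lt_irrefl _)]

theorem linearIndependent_completedFrame_iff (hn : 1 ≤ n) {p : M} :
    (LinearIndependent ℝ fun i => completedFrame η H F R i p) ↔ p ∈ indepSet η H F ∧
      R p ∉ Submodule.span ℝ (Set.range fun j => ham η (family H F j) p) := by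
  have hinit : Fin.init (fun i => completedFrame η H F R i p) =
      fun j => ham η (family H F j) p := funext fun j =>
    congrFun (completedFrame_castSucc η H F R j) p
  rw [linearIndependent_finSucc', hinit, completedFrame_last hn]
  rfl

theorem exists_notMem_span_ham_family {p : M} (hp : p ∈ indepSet η H F) :
    ∃ v, v ∉ Submodule.span ℝ (Set.range fun j => ham η (family H F j) p) := by
  by_contra! h
  have hrank := finrank_span_eq_card (R := ℝ) hp
  rw [Submodule.eq_top_iff'.2 h, finrank_top, finrank_tangentSpace, Fintype.card_fin] at hrank
  omega

theorem smoothFunOn_contMDiffMap (f : C^∞⟮𝓡 (2 * n + 1), M; ℝ⟯) :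
    SmoothFunOn (m := 2 * n + 1) Set.univ f := f.contMDiff.contMDiffOn

variable [IsManifold (𝓡 (2 * n + 1)) ∞ M]

theorem smoothOn_completedFrame (hn : 1 ≤ n) (hη : IsContactForm η) (hR : R.SmoothOn V)
    (i : Fin (2 * n + 1)) : (completedFrame η H F R i).SmoothOn V := by
  refine Fin.lastCases ?_ (fun j => ?_) i
  · rwa [completedFrame_last hn]
  · rw [completedFrame_castSucc]
    exact (hη.smoothOn_ham (smoothFunOn_contMDiffMap _)).mono (Set.subset_univ V)

theorem isOpen_indepSet (hη : IsContactForm η) : IsOpen (indepSet η H F) := by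
  have h := isOpen_setOf_linearIndependent_fields (Y := fun j => ham η (family H F j)) isOpen_univ
    fun j => hη.smoothOn_ham (smoothFunOn_contMDiffMap _)
  rwa [Set.univ_inter] at h

theorem exists_isComplement (hn : 1 ≤ n) (hη : IsContactForm η) {p : M}
    (hp : p ∈ indepSet η H F) : ∃ V : Set M, IsOpen V ∧ p ∈ V ∧ V ⊆ indepSet η H F ∧
      (∃ R : VField (2 * n + 1) M, IsComplement η H F V R) ∧
      ∃ Ω : TopForm (2 * n + 1) M, Ω.IsVolumeOn V := by
  have hps := mem_extChartAt_source (I := 𝓡 (2 * n + 1)) p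
  obtain ⟨v, hv⟩ := exists_notMem_span_ham_family hp
  let R : VField (2 * n + 1) M := coordField p (chartD p p v)
  have hRp : R p = v := chartDInv_chartD hps v
  have hRs : R.SmoothOn (extChartAt (𝓡 (2 * n + 1)) p).source := smoothOn_coordField p _
  have hiff : ∀ q, (LinearIndependent ℝ fun i => completedFrame η H F R i q) ↔ _ := fun q =>
    linearIndependent_completedFrame_iff hn
  refine ⟨(extChartAt (𝓡 (2 * n + 1)) p).source ∩
    {q | LinearIndependent ℝ fun i => completedFrame η H F R i q},
    isOpen_setOf_linearIndependent_fields (isOpen_extChartAt_source p)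
      (smoothOn_completedFrame hn hη hRs), ⟨hps, (hiff p).2 ⟨hp, by rwa [hRp]⟩⟩,
    fun q hq => ((hiff q).1 hq.2).1, ⟨R, hRs.mono Set.inter_subset_left,
      fun q hq => ((hiff q).1 hq.2).2⟩, chartVolume p, fun x => ?_, fun q hq => ?_⟩
  · exact ((isVolumeOn_chartVolume p).smooth x).mono fun y hy => ⟨hy.1, hy.2.1⟩
  · exact (isVolumeOn_chartVolume p).ne_zero q hq.1

theorem mlieBracket_ham_family_mem_span (hη : IsContactForm η)
    (hF : IsJacobiCInfStructure η H F) {i j : Fin (2 * n)} (hij : i < j) {p : M}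
    (hp : p ∈ indepSet η H F) :
    VectorField.mlieBracket (𝓡 (2 * n + 1)) (ham η (family H F j)) (ham η (family H F i)) p ∈
      Submodule.span ℝ (Set.range fun k : {k : Fin (2 * n) // k ≤ j} =>
        ham η (family H F k) p) := by
  obtain ⟨G, hG, hbracket, hE⟩ := hF.closure i j hij
  obtain ⟨O, -, hpO, c, -, hc⟩ := hE p hp
  have hcp := hc p hpO
  beta_reduce at hcp
  rw [hη.mlieBracket_ham (smoothFunOn_contMDiffMap _) (smoothFunOn_contMDiffMap _),
    funext hbracket, hη.ham_comp (f := fun k : {k : Fin (2 * n) // k ≤ j} => family H F k)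
      (fun k => (smoothFunOn_contMDiffMap _).contMDiffAt isOpen_univ (Set.mem_univ p))
      (hG.differentiable (by simp) _), hcp]
  exact Submodule.add_mem _
    (Submodule.sum_mem _ fun k _ => Submodule.smul_mem _ _ (Submodule.subset_span ⟨k, rfl⟩))
    (Submodule.sum_mem _ fun k _ => Submodule.smul_mem _ _ (Submodule.subset_span ⟨k, rfl⟩))

theorem isInvolutiveFlag_completedFrame (hn : 1 ≤ n) (hη : IsContactForm η)
    (hF : IsJacobiCInfStructure η H F) (hV : IsOpen V) (hVU : V ⊆ indepSet η H F)
    (hR : IsComplement η H F V R) : IsInvolutiveFlag V (completedFrame η H F R) := by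
  have hind : ∀ p ∈ V, LinearIndependent ℝ fun i => completedFrame η H F R i p := fun p hp =>
    (linearIndependent_completedFrame_iff hn).2 ⟨hVU hp, hR.transverse p hp⟩
  refine isInvolutiveFlag_of_mem_span hV (smoothOn_completedFrame hn hη hR.smooth) hind
    fun p hp a b => ?_
  refine Fin.lastCases (fun _ => ?_) (fun j => ?_) b
  · rw [← sum_dualForm (hind p hp) (VectorField.mlieBracket _ _ _ p)]
    exact Submodule.sum_mem _ fun k _ => Submodule.smul_mem _ _
      (Submodule.subset_span ⟨⟨k, k.le_last⟩, rfl⟩)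
  · refine Fin.lastCases (fun h => absurd h (Fin.le_last _).not_gt) (fun i hij => ?_) a
    rw [completedFrame_castSucc, completedFrame_castSucc]
    refine Submodule.span_mono ?_
      (mlieBracket_ham_family_mem_span hη hF (Fin.castSucc_lt_castSucc_iff.1 hij) (hVU hp))
    rintro _ ⟨k, rfl⟩
    exact ⟨⟨(k : Fin (2 * n)).castSucc, Fin.castSucc_le_castSucc_iff.2 k.2⟩,
      congrFun (completedFrame_castSucc η H F R k) p⟩

end Completed

end ContactPfaff

end

theorem mainTheorem6_general (n : ℕ) (hn : 1 ≤ n) (M : Type*) [TopologicalSpace M]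
    [ChartedSpace (EuclideanSpace ℝ (Fin (2 * n + 1))) M] [IsManifold (𝓡 (2 * n + 1)) ∞ M]
    (η : ContactPfaff.OneForm (2 * n + 1) M) (hη : ContactPfaff.IsContactForm η)
    (H : C^∞⟮𝓡 (2 * n + 1), M; ℝ⟯) (F : Fin (2 * n - 1) → C^∞⟮𝓡 (2 * n + 1), M; ℝ⟯)
    (hF : ContactPfaff.IsJacobiCInfStructure η H F) :
    IsOpen (ContactPfaff.indepSet η H F) ∧ Dense (ContactPfaff.indepSet η H F) ∧
    (∀ p ∈ ContactPfaff.indepSet η H F, ∃ V : Set M, IsOpen V ∧ p ∈ V ∧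
      V ⊆ ContactPfaff.indepSet η H F ∧
      (∃ R : ContactPfaff.VField (2 * n + 1) M, ContactPfaff.IsComplement η H F V R) ∧
      ∃ Ω : ContactPfaff.TopForm (2 * n + 1) M, Ω.IsVolumeOn V) ∧
    ∀ V : Set M, IsOpen V → V ⊆ ContactPfaff.indepSet η H F →
      ∀ R : ContactPfaff.VField (2 * n + 1) M, ContactPfaff.IsComplement η H F V R →
        ContactPfaff.IsCInfStructure V (fun _ : Fin 1 => ContactPfaff.ham η H)
          (ContactPfaff.completed η F R) ∧
        ∀ Ω : ContactPfaff.TopForm (2 * n + 1) M, Ω.IsVolumeOn V →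
          ContactPfaff.IntegratedByPfaff V (ContactPfaff.ham η H)
            (ContactPfaff.pfaffForm Ω (ContactPfaff.ham η H)
              (ContactPfaff.completed η F R)) := by
  refine ⟨ContactPfaff.isOpen_indepSet hη, ?_,
    fun p hp => ContactPfaff.exists_isComplement hn hη hp, fun V hV hVU R hR => ?_⟩
  · obtain ⟨U, -, hU, hUi⟩ := hF.independence
    exact hU.mono hUi
  · have h := ContactPfaff.isInvolutiveFlag_completedFrame hn hη hF hV hVU hR
    exact ⟨h.isCInfStructure, fun Ω hΩ =>
      (ContactPfaff.isScaledDual_pfaffForm h hΩ).integratedByPfaff⟩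

theorem mainTheorem6 (n : ℕ) (hn : 1 ≤ n) (M : Type*) [TopologicalSpace M] [T2Space M]
    [SecondCountableTopology M] [ChartedSpace (EuclideanSpace ℝ (Fin (2 * n + 1))) M]
    [IsManifold (𝓡 (2 * n + 1)) ∞ M]
    (η : ContactPfaff.OneForm (2 * n + 1) M) (hη : ContactPfaff.IsContactForm η)
    (H : C^∞⟮𝓡 (2 * n + 1), M; ℝ⟯) (F : Fin (2 * n - 1) → C^∞⟮𝓡 (2 * n + 1), M; ℝ⟯)
    (hF : ContactPfaff.IsJacobiCInfStructure η H F) :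
    IsOpen (ContactPfaff.indepSet η H F) ∧ Dense (ContactPfaff.indepSet η H F) ∧
    (∀ p ∈ ContactPfaff.indepSet η H F, ∃ V : Set M, IsOpen V ∧ p ∈ V ∧
      V ⊆ ContactPfaff.indepSet η H F ∧
      (∃ R : ContactPfaff.VField (2 * n + 1) M, ContactPfaff.IsComplement η H F V R) ∧
      ∃ Ω : ContactPfaff.TopForm (2 * n + 1) M, Ω.IsVolumeOn V) ∧
    ∀ V : Set M, IsOpen V → V ⊆ ContactPfaff.indepSet η H F →
      ∀ R : ContactPfaff.VField (2 * n + 1) M, ContactPfaff.IsComplement η H F V R →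
        ContactPfaff.IsCInfStructure V (fun _ : Fin 1 => ContactPfaff.ham η H)
          (ContactPfaff.completed η F R) ∧
        ∀ Ω : ContactPfaff.TopForm (2 * n + 1) M, Ω.IsVolumeOn V →
          ContactPfaff.IntegratedByPfaff V (ContactPfaff.ham η H)
            (ContactPfaff.pfaffForm Ω (ContactPfaff.ham η H)
              (ContactPfaff.completed η F R)) :=
  mainTheorem6_general n hn M η hη H F hF
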